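/- Let $d\ge 3$ be an integer. For a prime power $q$ let $q\Gamma_{2d+1,\{d,d+1\}}$ be the graph whose vertices are the flags $\{A,B\}$ of $V=GF(q)^{2d+1}$ with $A\subset B$, $\operatorname{rank}A=d$, $\operatorname{rank}B=d+1$, two flags $f_1,f_2$ being adjacent if they are in general position, that is, if $U_1\cap U_2=\{0\}$ or $U_1+U_2=V$ for all $U_1\in f_1$ and $U_2\in f_2$. For a rank $1$ subspace $P$ of $V$, the point-pencil $F(P)$ is the set of all vertices $\{A,B\}$ with $P\subseteq A$; for a rank $2d$ subspace $H$ of $V$, the dual point-pencil $F(H)$ is the set of all vertices $\{A,B\}$ with $B\subseteq H$. Suppose that $\rho(d)$ is an integer such that for every prime power $q$ every maximal (with respect to inclusion) independent set of $q\Gamma_{2d+1,\{d,d+1\}}$ contains a point-pencil, contains a dual point-pencil, or has at most $\rho(d)\cdot q^{d^2+d-2}$ elements. Put $\alpha=\max\{5,\rho(d)\}$, and let $q$ be a prime power with $q>3\cdot 112^{2^{d+1}-1}\cdot 2^{-d-1}$ and $q\ge\frac32\alpha^2+\frac{21}{2}\alpha+17$. Then $$\chi(q\Gamma_{2d+1,\{d,d+1\}})=\frac{q^{d+2}-1}{q-1}-q.$$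 Moreover, let $\mathcal F$ be a set of exactly $\frac{q^{d+2}-1}{q-1}-q$ maximal independent sets of $q\Gamma_{2d+1,\{d,d+1\}}$ whose union is the whole vertex set. Then one of the following holds. (a) There are a rank $d+2$ subspace $U$ of $V$ and an injective map $\mu$ from $\mathcal F$ to the set of rank $1$ subspaces of $U$ such that $F(\mu(C))\subseteq C$ for all $C\in\mathcal F$. (b) (The dual of (a).) There are a rank $d-1$ subspace $U$ of $V$ and an injective map $\mu$ from $\mathcal F$ to the set of rank $2d$ subspaces of $V$ containing $U$ such that $F(\mu(C))\subseteq C$ for all $C\in\mathcal F$. -/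

import Mathlib

universe u

/-- A flag of a vector space: a set of non-trivial proper subspaces, any two of which are
comparable under inclusion. -/
def IsFlag {K V : Type u} [Field K] [AddCommGroup V] [Module K V]
    (f : Set (Submodule K V)) : Prop :=
  (∀ U ∈ f, U ≠ ⊥ ∧ U ≠ ⊤) ∧ ∀ U ∈ f, ∀ W ∈ f, U ≤ W ∨ W ≤ U

/-- The vectorial type of a flag: the set of the ranks of its members. -/
def vectorialType {K V : Type u} [Field K] [AddCommGroup V] [Module K V]
    (f : Set (Submodule K V)) : Set ℕ :=
  {r | ∃ U ∈ f, Module.finrank K U = r}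

/-- Two flags are in general position if any member of the first and any member of the second
intersect trivially or span the whole space. -/
def InGeneralPosition {K V : Type u} [Field K] [AddCommGroup V] [Module K V]
    (f g : Set (Submodule K V)) : Prop :=
  ∀ U ∈ f, ∀ W ∈ g, U ⊓ W = ⊥ ∨ U ⊔ W = ⊤

/-- The flags of vectorial type `J` of the vector space `K ^ n`. -/
def FlagOfType (K : Type u) [Field K] (n : ℕ) (J : Set ℕ) : Type u :=
  {f : Set (Submodule K (Fin n → K)) // IsFlag f ∧ vectorialType f = J}

/-- The `q`-Kneser graph of the flags of vectorial type `J` of `K ^ n`, where `K = GF(q)`: distinct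
flags are adjacent if they are in general position. (For `J = {d, d + 1}` and `n = 2 * d + 1` with
`d ≥ 1`, no flag is in general position to itself.) -/
def qKneserGraph (K : Type u) [Field K] (n : ℕ) (J : Set ℕ) : SimpleGraph (FlagOfType K n J) where
  Adj f g := f ≠ g ∧ InGeneralPosition f.1 g.1
  symm := ⟨fun f g h => ⟨h.1.symm, fun U hU W hW => by
    have := h.2 W hW U hU
    rwa [inf_comm, sup_comm] at this⟩⟩
  loopless := ⟨fun f h => h.1 rfl⟩

/-- The `q`-Kneser graph of the flags of vectorial type `{d, d + 1}` of `K ^ (2 * d + 1)`. -/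
abbrev flagGraph (K : Type u) [Field K] (d : ℕ) :
    SimpleGraph (FlagOfType K (2 * d + 1) {d, d + 1}) :=
  qKneserGraph K (2 * d + 1) {d, d + 1}

/-- An independent set of a graph that is maximal with respect to inclusion. -/
def IsMaxlIndepSet {X : Type u} (G : SimpleGraph X) (I : Set X) : Prop :=
  Maximal G.IsIndepSet I

/-- `F(P)`: the flags of vectorial type `{d, d + 1}` of `K ^ (2 * d + 1)` whose member of rank `d`
contains `P`. It is a point-pencil if `P` has rank 1. -/
def pencil {K : Type u} [Field K] (d : ℕ) (P : Submodule K (Fin (2 * d + 1) → K)) :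
    Set (FlagOfType K (2 * d + 1) {d, d + 1}) :=
  {f | ∃ A ∈ f.1, Module.finrank K A = d ∧ P ≤ A}

/-- `F(H)`: the flags of vectorial type `{d, d + 1}` of `K ^ (2 * d + 1)` whose member of rank
`d + 1` is contained in `H`. It is a dual point-pencil if `H` has rank `2 * d`. -/
def dualPencil {K : Type u} [Field K] (d : ℕ) (H : Submodule K (Fin (2 * d + 1) → K)) :
    Set (FlagOfType K (2 * d + 1) {d, d + 1}) :=
  {f | ∃ B ∈ f.1, Module.finrank K B = d + 1 ∧ B ≤ H}

/-- The conjecture on large maximal independent sets for the integer `d`, with the constant `ρ`: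
over every finite field `GF(q)`, every maximal independent set contains a point-pencil or a dual
point-pencil, or has at most `ρ * q ^ (d ^ 2 + d - 2)` elements. -/
def LargeIndepSetConjecture (d : ℕ) (ρ : ℤ) : Prop :=
  ∀ (K : Type u) [Field K] [Finite K] (I : Set (FlagOfType K (2 * d + 1) {d, d + 1})),
    IsMaxlIndepSet (flagGraph K d) I →
      (∃ P : Submodule K (Fin (2 * d + 1) → K), Module.finrank K P = 1 ∧ pencil d P ⊆ I) ∨
      (∃ H : Submodule K (Fin (2 * d + 1) → K), Module.finrank K H = 2 * d ∧ dualPencil d H ⊆ I) ∨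
      (I.ncard : ℤ) ≤ ρ * (Nat.card K : ℤ) ^ (d ^ 2 + d - 2)

/-! Write w and N for the number of points (rank 1 subspaces) of a space of rank d+1 and d+2, so N =
qw+1, and u = 1/q. With A, B the members of rank d, d+1, two flags are opposite iff A meets B'
trivially and A' meets B trivially.

Upper bound. A subspace U of rank d+2 meets every A in a point and every B in at least a line, so N
point-pencils cover all flags. To save q classes, fix a line ℓ of U, keep only one point P₀ of ℓ,
and enlarge the class of a point P to the flags with P ≤ A or L ≤ B, for one line L through P; such
a class is still independent. A flag whose A meets U only in dropped points has a line M in B ∩ U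
through such a point. Either M = ℓ, or M is assigned to a point of M off ℓ, injectively, by Hall's
theorem (`exists_representatives`, `exists_classes`).

Lower bound and structure. Consider a cover by at most N - q maximal independent sets. By hypothesis
each contains a point-pencil, contains a dual point-pencil, or is small (`FlagCover`). A set that
contains the pencil of P has few flags outside it: their members B pass through P and pairwise meet
in rank at least 2 (`two_le_finrank_inf`, `card_intersecting_le`). So almost all flags lie in the
pencils.

Let m and h be the mean numbers of pencil points in A and of pencil hyperplanes above B for a random
flag. Since N pencils have total mean at most 1 + u + 2u², there is only about u of waste:
superfluous incidences plus flags covered from both sides. A second and third moment argument shows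
that a point set of mean m wastes at least about u·m² (`le_sum_numBelow_sub_one`). As m + h is about
1, waste u(m²+h²) leaves at most about 2u·m·h for flags covered from both sides. A mixing inequality
for incidence of ranks d and d+1 (`mixing`) says that this overlap cannot be so small unless m or h
is negligible. Up to duality, h is negligible (`cover_estimates`).

Then the points attain the minimal waste almost exactly, and the same Cauchy-Schwarz inequality read
backwards says that an average line joining two of them consists almost wholly of them
(`le_of_variance_estimates`). The vectors spanning them are thus almost closed under addition, hence
close to a subspace (`exists_submodule_of_almost_closed`), and its rank is d+2
(`exists_subspace_of_superfluous_le`).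

It remains to show that at most q points of this U are missing. Let k be their number. Counting
flags with A ∩ U missing gives k = O(dα q^(d-1)). If k > q, consider lines of U with exactly one
missing point; there are about kw of them. The subspaces B meeting U in such a line must be covered
by extra flags, and one pencil member serves essentially one line only, so the fewer than qw members
cannot do it; all other members number at most k - q and contribute little (`card_missing_le`,
`missing_le_second`). Once k ≤ q, counting leaves no room for dual or small members, repeated
points, or points off U (`structure_of_card_le`). -/

open Module Finset
open scoped Classical

set_option linter.unusedSectionVars false

/-! ### Gaussian coefficients and numbers of subspaces. -/

section Counting

/-- The `q`-binomial coefficient as a real number. -/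
noncomputable def gauss (q : ℝ) : ℕ → ℕ → ℝ
  | _, 0 => 1
  | 0, _ + 1 => 0
  | n + 1, r + 1 => (q ^ (n + 1) - 1) / (q ^ (r + 1) - 1) * gauss q n r

@[simp] theorem gauss_zero_right (q : ℝ) (n : ℕ) : gauss q n 0 = 1 := by cases n <;> rfl

theorem gauss_succ_succ (q : ℝ) (n r : ℕ) :
    gauss q (n + 1) (r + 1) = (q ^ (n + 1) - 1) / (q ^ (r + 1) - 1) * gauss q n r := rfl

theorem gauss_one_right (q : ℝ) (n : ℕ) : gauss q n 1 = (q ^ n - 1) / (q - 1) := by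
  cases n with
  | zero => simp [gauss]
  | succ n => simp [gauss_succ_succ]

theorem gauss_succ_self {q : ℝ} (hq : 1 < q) (n : ℕ) :
    gauss q (n + 1) n = (q ^ (n + 1) - 1) / (q - 1) := by
  induction n with
  | zero =>
    have : q - 1 ≠ 0 := (sub_pos.2 hq).ne'
    simp [this]
  | succ n ih =>
    have : q ^ (n + 1) - 1 ≠ 0 := (sub_pos.2 (one_lt_pow₀ hq (by omega))).ne'
    have h1 : q - 1 ≠ 0 := (sub_pos.2 hq).ne'
    rw [gauss_succ_succ, ih]
    field_simp

theorem gauss_nonneg {q : ℝ} (hq : 1 < q) (n r : ℕ) : 0 ≤ gauss q n r := by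
  induction n generalizing r with
  | zero => cases r <;> simp [gauss]
  | succ n ih =>
    cases r with
    | zero => simp
    | succ r =>
      rw [gauss_succ_succ]
      exact mul_nonneg (div_nonneg (sub_nonneg.2 (one_le_pow₀ hq.le))
        (sub_nonneg.2 (one_le_pow₀ hq.le))) (ih r)

theorem pow_le_gauss {q : ℝ} (hq : 1 < q) (a r : ℕ) : q ^ (r * a) ≤ gauss q (a + r) r := by
  induction r with
  | zero => simp
  | succ r ih =>
    rw [← add_assoc, gauss_succ_succ]
    have h0 : 0 < q := by linarith
    have h1 : 0 < q ^ (r + 1) - 1 := sub_pos.2 (one_lt_pow₀ hq (by omega))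
    have h2 : q ^ a ≤ (q ^ (a + r + 1) - 1) / (q ^ (r + 1) - 1) := by
      rw [le_div_iff₀ h1]
      have : q ^ a * (q ^ (r + 1) - 1) = q ^ (a + r + 1) - q ^ a := by ring
      rw [this]
      have := one_le_pow₀ (n := a) hq.le
      linarith
    calc q ^ ((r + 1) * a) = q ^ a * q ^ (r * a) := by ring
      _ ≤ _ := mul_le_mul h2 ih (by positivity) (le_trans (by positivity) h2)

/-- The bound with constant 2 alone is not inductive. The factor 1/2 + q^(-r)/2, which falls from 1
towards 1/2, absorbs the error of each new quotient. -/
theorem gauss_le_aux {q : ℝ} (hq : 3 ≤ q) (a r : ℕ) :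
    gauss q (a + r) r * (1 / 2 + 1 / 2 * q⁻¹ ^ r) ≤ q ^ (r * a) := by
  induction r with
  | zero => simp; norm_num
  | succ r ih =>
    rw [← add_assoc, gauss_succ_succ]
    have h0 : 0 < q := by linarith
    have hq1 : 1 < q := by linarith
    have hi : q * q⁻¹ = 1 := mul_inv_cancel₀ h0.ne'
    have hx : 0 < q⁻¹ ^ r := by positivity
    have hx1 : q⁻¹ ^ r ≤ 1 := pow_le_one₀ (by positivity) (inv_le_one_of_one_le₀ hq1.le)
    have h1 : 0 < q ^ (r + 1) - 1 := sub_pos.2 (one_lt_pow₀ hq1 (by omega))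
    have hg := gauss_nonneg hq1 (a + r) r
    have hi3 : q⁻¹ ≤ 1 / 3 := by
      rw [inv_eq_one_div]; exact one_div_le_one_div_of_le (by norm_num) hq
    have hqi : 0 < q⁻¹ := by positivity
    have key : (q ^ (a + r + 1) - 1) / (q ^ (r + 1) - 1) * (1 / 2 + 1 / 2 * q⁻¹ ^ (r + 1)) ≤
        q ^ a * (1 / 2 + 1 / 2 * q⁻¹ ^ r) := by
      rw [div_mul_eq_mul_div, div_le_iff₀ h1]
      have e : q ^ (r + 1) * q⁻¹ ^ r = q := by
        rw [pow_succ, mul_comm (q ^ r), mul_assoc, ← mul_pow, hi, one_pow, mul_one]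
      have e2 : q ^ (r + 1) * q⁻¹ ^ (r + 1) = 1 := by rw [← mul_pow, hi, one_pow]
      have e3 : q⁻¹ ^ (r + 1) = q⁻¹ ^ r * q⁻¹ := pow_succ _ _
      have hqa : 0 < q ^ a := by positivity
      have lhs : (q ^ (a + r + 1) - 1) * (1 / 2 + 1 / 2 * q⁻¹ ^ (r + 1)) ≤
          q ^ a * (q ^ (r + 1) * (1 / 2) + 1 / 2) := by
        have : (q ^ (a + r + 1) - 1) * (1 / 2 + 1 / 2 * q⁻¹ ^ (r + 1)) =
          q ^ a * (q ^ (r + 1) * (1 / 2) + 1 / 2 * (q ^ (r + 1) * q⁻¹ ^ (r + 1))) -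
            (1 / 2 + 1 / 2 * q⁻¹ ^ (r + 1)) := by ring
        rw [this, e2]
        have : 0 < q⁻¹ ^ (r + 1) := by positivity
        linarith
      refine lhs.trans ?_
      have : q ^ a * (1 / 2 + 1 / 2 * q⁻¹ ^ r) * (q ^ (r + 1) - 1) =
        q ^ a * (q ^ (r + 1) * (1 / 2) + 1 / 2 * (q ^ (r + 1) * q⁻¹ ^ r) - 1 / 2 -
          1 / 2 * q⁻¹ ^ r) := by ring
      rw [this, e]
      apply mul_le_mul_of_nonneg_left _ hqa.le
      linarith
    calc _ = (q ^ (a + r + 1) - 1) / (q ^ (r + 1) - 1) * (1 / 2 + 1 / 2 * q⁻¹ ^ (r + 1)) *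
          gauss q (a + r) r := by ring
      _ ≤ q ^ a * (1 / 2 + 1 / 2 * q⁻¹ ^ r) * gauss q (a + r) r :=
          mul_le_mul_of_nonneg_right key hg
      _ = q ^ a * (gauss q (a + r) r * (1 / 2 + 1 / 2 * q⁻¹ ^ r)) := by ring
      _ ≤ q ^ a * q ^ (r * a) := mul_le_mul_of_nonneg_left ih (by positivity)
      _ = _ := by ring

theorem gauss_le {q : ℝ} (hq : 3 ≤ q) (a r : ℕ) : gauss q (a + r) r ≤ 2 * q ^ (r * a) := by
  have h := gauss_le_aux hq a r
  have hg := gauss_nonneg (show 1 < q by linarith) (a + r) r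
  have : 0 < q⁻¹ ^ r := by have : 0 < q := by linarith
                           positivity
  nlinarith

variable {K V : Type*} [Field K] [Finite K] [AddCommGroup V] [Module K V] [Module.Finite K V]

instance finite_submodule : Finite (Submodule K V) :=
  have : Finite V := Module.finite_of_finite K
  inferInstance

variable (K V) in
/-- The finset of subspaces of rank `r`. -/
noncomputable def Gr (r : ℕ) : Finset (Submodule K V) :=
  (Set.toFinite {A : Submodule K V | finrank K A = r}).toFinset

@[simp] theorem mem_Gr {r : ℕ} {A : Submodule K V} : A ∈ Gr K V r ↔ finrank K A = r := by
  simp [Gr]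

theorem one_lt_natCard : 1 < Nat.card K := Finite.one_lt_card

theorem one_lt_natCard_real : (1 : ℝ) < (Nat.card K : ℝ) := by
  exact_mod_cast (Finite.one_lt_card : 1 < Nat.card K)

theorem card_Gr_filter_ge (Z : Submodule K V) (r : ℕ) (hr : finrank K Z ≤ r) :
    #{A ∈ Gr K V r | Z ≤ A} = #(Gr K (V ⧸ Z) (r - finrank K Z)) := by
  have hrank : ∀ B : Submodule K (V ⧸ Z),
      finrank K (B.comap Z.mkQ) = finrank K B + finrank K Z := by
    intro B
    have h1 := LinearMap.finrank_range_add_finrank_ker (Z.mkQ.domRestrict (B.comap Z.mkQ))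
    rw [LinearMap.range_domRestrict, LinearMap.ker_domRestrict, Submodule.ker_mkQ,
      Submodule.map_comap_eq_of_surjective (Submodule.mkQ_surjective Z)] at h1
    rw [← h1]
    congr 1
    exact (LinearEquiv.finrank_eq
      (Submodule.comapSubtypeEquivOfLe (Submodule.le_comap_mkQ Z B)))
  symm
  apply Finset.card_bij (fun B _ => B.comap Z.mkQ)
  · intro B hB
    simp only [mem_filter, mem_Gr] at hB ⊢
    exact ⟨by rw [hrank, hB]; omega, Submodule.le_comap_mkQ Z B⟩
  · intro B _ B' _ h
    exact Submodule.comap_injective_of_surjective (Submodule.mkQ_surjective Z) h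
  · intro A hA
    simp only [mem_filter, mem_Gr] at hA
    have e : (A.map Z.mkQ).comap Z.mkQ = A := by
      rw [Submodule.comap_map_mkQ, sup_eq_right.2 hA.2]
    refine ⟨A.map Z.mkQ, ?_, e⟩
    have := hrank (A.map Z.mkQ)
    rw [e, hA.1] at this
    simp only [mem_Gr]
    omega

theorem card_ne_zero_vectors [Fintype V] (A : Submodule K V) :
    (#{v : V | v ∈ A ∧ v ≠ 0} : ℝ) = (Nat.card K : ℝ) ^ finrank K A - 1 := by
  have h1 : Nat.card A = Nat.card K ^ finrank K A := Module.natCard_eq_pow_finrank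
  have h2 : #{v : V | v ∈ A} = Nat.card A := by
    rw [Nat.card_eq_fintype_card, Fintype.card_subtype]
  have h3 : ({v : V | v ∈ A ∧ v ≠ 0} : Finset V) = ({v : V | v ∈ A} : Finset V).erase 0 := by
    ext v; simp [and_comm]
  rw [h3, Finset.card_erase_of_mem (by simp), h2, h1,
    Nat.cast_sub (Nat.one_le_pow _ _ (by have := one_lt_natCard (K := K); omega))]
  simp

/-- Double count pairs of a nonzero vector v and a subspace containing it. The subspaces through v
are those of the quotient by the span of v, so the induction on the rank must run over all spaces.
-/
theorem card_Gr (r : ℕ) : (#(Gr K V r) : ℝ) = gauss (Nat.card K) (finrank K V) r := by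
  suffices h : ∀ (n r : ℕ) (V : Type _) [AddCommGroup V] [Module K V] [Module.Finite K V],
      finrank K V = n → (#(Gr K V r) : ℝ) = gauss (Nat.card K) n r from h _ r V rfl
  intro n
  induction n with
  | zero =>
    intro r V _ _ _ hn
    cases r with
    | zero =>
      have : Gr K V 0 = {⊥} := by
        ext A; simp
      rw [this]; simp
    | succ r =>
      have : Gr K V (r + 1) = ∅ := by
        ext A
        have := Submodule.finrank_le A
        simp; omega
      rw [this]; simp [gauss]
  | succ n ih =>
    intro r V _ _ _ hn
    cases r with
    | zero =>
      have : Gr K V 0 = {⊥} := by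
        ext A; simp
      rw [this]; simp
    | succ r =>
      have : Finite V := Module.finite_of_finite K
      have := Fintype.ofFinite V
      have hq := one_lt_natCard_real (K := K)
      have h1 : (0 : ℝ) < (Nat.card K : ℝ) ^ (r + 1) - 1 :=
        sub_pos.2 (one_lt_pow₀ hq (by omega))
      rw [gauss_succ_succ, div_mul_eq_mul_div, eq_div_iff h1.ne']
      have hdc : ∑ A ∈ Gr K V (r + 1), #{v ∈ (univ : Finset V).erase 0 | v ∈ A} =
          ∑ v ∈ (univ : Finset V).erase 0, #{A ∈ Gr K V (r + 1) | v ∈ A} :=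
        Finset.sum_card_bipartiteAbove_eq_sum_card_bipartiteBelow (fun A v => v ∈ A)
      have hl : ∀ A ∈ Gr K V (r + 1), (#{v ∈ (univ : Finset V).erase 0 | v ∈ A} : ℝ) =
          (Nat.card K : ℝ) ^ (r + 1) - 1 := by
        intro A hA
        rw [mem_Gr] at hA
        rw [← hA, ← card_ne_zero_vectors A]
        congr 2; ext v; simp [and_comm]
      have hr : ∀ v ∈ (univ : Finset V).erase 0, (#{A ∈ Gr K V (r + 1) | v ∈ A} : ℝ) =
          gauss (Nat.card K) n r := by
        intro v hv
        have hv0 : v ≠ 0 := by simpa using hv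
        have hs := finrank_span_singleton (K := K) hv0
        have : ({A ∈ Gr K V (r + 1) | v ∈ A} : Finset _) =
            ({A ∈ Gr K V (r + 1) | Submodule.span K {v} ≤ A} : Finset _) := by
          ext A; simp [Submodule.span_singleton_le_iff_mem]
        rw [this, card_Gr_filter_ge _ _ (by omega), hs]
        apply ih
        have := Submodule.finrank_quotient_add_finrank (Submodule.span K {v})
        omega
      have hc := congrArg (Nat.cast (R := ℝ)) hdc
      push_cast at hc
      rw [Finset.sum_congr rfl hl, Finset.sum_congr rfl hr, Finset.sum_const, Finset.sum_const,
        nsmul_eq_mul, nsmul_eq_mul] at hc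
      rw [hc]
      congr 1
      have := card_ne_zero_vectors (⊤ : Submodule K V)
      rw [finrank_top, hn] at this
      rw [← this]
      congr 2; ext v; simp

theorem card_Gr_ge (Z : Submodule K V) {r : ℕ} (hr : finrank K Z ≤ r) :
    (#{A ∈ Gr K V r | Z ≤ A} : ℝ) =
      gauss (Nat.card K) (finrank K V - finrank K Z) (r - finrank K Z) := by
  rw [card_Gr_filter_ge Z r hr, card_Gr]
  have := Submodule.finrank_quotient_add_finrank Z
  congr 1; omega

theorem card_Gr_between {Z H : Submodule K V} (hZH : Z ≤ H) {r : ℕ} (hr : finrank K Z ≤ r) :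
    (#{A ∈ Gr K V r | Z ≤ A ∧ A ≤ H} : ℝ) =
      gauss (Nat.card K) (finrank K H - finrank K Z) (r - finrank K Z) := by
  have hz : finrank K (Z.comap H.subtype) = finrank K Z :=
    LinearEquiv.finrank_eq (Submodule.comapSubtypeEquivOfLe hZH)
  rw [← hz, ← card_Gr_ge _ (by omega)]
  norm_cast
  symm
  apply Finset.card_bij (fun B _ => B.map H.subtype)
  · intro B hB
    simp only [mem_filter, mem_Gr] at hB ⊢
    refine ⟨by rw [Submodule.finrank_map_subtype_eq, hB.1], ?_, Submodule.map_subtype_le _ _⟩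
    have := Submodule.map_mono (f := H.subtype) hB.2
    rwa [Submodule.map_comap_subtype, inf_eq_right.2 hZH] at this
  · intro B _ B' _ h
    exact Submodule.map_injective_of_injective H.injective_subtype h
  · intro A hA
    simp only [mem_filter, mem_Gr] at hA
    have e : (A.comap H.subtype).map H.subtype = A := by
      rw [Submodule.map_comap_subtype, inf_eq_right.2 hA.2.2]
    refine ⟨A.comap H.subtype, ?_, e⟩
    simp only [mem_filter, mem_Gr]
    refine ⟨?_, Submodule.comap_mono hA.2.1⟩
    rw [← Submodule.finrank_map_subtype_eq, e, hA.1]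

theorem card_Gr_le (H : Submodule K V) (r : ℕ) :
    (#{A ∈ Gr K V r | A ≤ H} : ℝ) = gauss (Nat.card K) (finrank K H) r := by
  have := card_Gr_between (bot_le : (⊥ : Submodule K V) ≤ H) (r := r) (by simp)
  simpa using this

end Counting

/-! ### Transitivity of the linear group and duality. -/

section Transitivity

variable {K V V' : Type*} [Field K] [AddCommGroup V] [Module K V]
  [AddCommGroup V'] [Module K V']

theorem exists_linearEquiv_of_isCompl {A B : Submodule K V} {A' B' : Submodule K V'}
    (h : IsCompl A B) (h' : IsCompl A' B') (e : A ≃ₗ[K] A') (f : B ≃ₗ[K] B') :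
    ∃ g : V ≃ₗ[K] V', (∀ x : A, g x = e x) ∧ ∀ x : B, g x = f x := by
  refine ⟨(Submodule.prodEquivOfIsCompl A B h).symm ≪≫ₗ (e.prodCongr f) ≪≫ₗ
    Submodule.prodEquivOfIsCompl A' B' h', fun x => ?_, fun x => ?_⟩
  · simp
  · simp

theorem map_eq_of_extends {A : Submodule K V} {A' : Submodule K V'} {e : A ≃ₗ[K] A'}
    {g : V ≃ₗ[K] V'} (h : ∀ x : A, g x = e x) : A.map (g : V →ₗ[K] V') = A' := by
  ext y
  simp only [Submodule.mem_map]
  constructor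
  · rintro ⟨x, hx, rfl⟩
    have := h ⟨x, hx⟩
    simp only [LinearEquiv.coe_coe] at this ⊢
    rw [this]; exact (e _).2
  · intro hy
    refine ⟨e.symm ⟨y, hy⟩, (e.symm ⟨y, hy⟩).2, ?_⟩
    simp [h]

variable [Module.Finite K V] [Module.Finite K V']

theorem exists_linearEquiv_extending (hV : finrank K V = finrank K V')
    {A : Submodule K V} {A' : Submodule K V'} (e : A ≃ₗ[K] A') :
    ∃ g : V ≃ₗ[K] V', ∀ x : A, g x = e x := by
  obtain ⟨B, hB⟩ := Submodule.exists_isCompl A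
  obtain ⟨B', hB'⟩ := Submodule.exists_isCompl A'
  have h1 := Submodule.finrank_add_eq_of_isCompl hB
  have h2 := Submodule.finrank_add_eq_of_isCompl hB'
  have h3 := e.finrank_eq
  obtain ⟨g, hg, -⟩ := exists_linearEquiv_of_isCompl hB hB' e
    (LinearEquiv.ofFinrankEq _ _ (by omega))
  exact ⟨g, hg⟩

/-- An isomorphism of the small members is extended twice, first to the large members and then to
the whole space. -/
theorem exists_linearEquiv_flag {A B A' B' : Submodule K V} (hAB : A ≤ B) (hAB' : A' ≤ B')
    (hA : finrank K A = finrank K A') (hB : finrank K B = finrank K B') :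
    ∃ g : V ≃ₗ[K] V, A.map (g : V →ₗ[K] V) = A' ∧ B.map (g : V →ₗ[K] V) = B' := by
  have ha : finrank K (A.comap B.subtype) = finrank K A :=
    LinearEquiv.finrank_eq (Submodule.comapSubtypeEquivOfLe hAB)
  have ha' : finrank K (A'.comap B'.subtype) = finrank K A' :=
    LinearEquiv.finrank_eq (Submodule.comapSubtypeEquivOfLe hAB')
  obtain ⟨f, hf⟩ := exists_linearEquiv_extending hB
    (LinearEquiv.ofFinrankEq (A.comap B.subtype) (A'.comap B'.subtype) (by omega))
  obtain ⟨g, hg⟩ := exists_linearEquiv_extending rfl f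
  refine ⟨g, ?_, map_eq_of_extends hg⟩
  have h1 := map_eq_of_extends hf
  have e1 : (A.comap B.subtype).map B.subtype = A := by
    rw [Submodule.map_comap_subtype, inf_eq_right.2 hAB]
  have e2 : (A'.comap B'.subtype).map B'.subtype = A' := by
    rw [Submodule.map_comap_subtype, inf_eq_right.2 hAB']
  rw [← e1, ← e2, ← h1, ← Submodule.map_comp, ← Submodule.map_comp]
  congr 1
  ext x
  simp [hg]

theorem exists_linearEquiv_isCompl {A B A' B' : Submodule K V} (h : IsCompl A B)
    (h' : IsCompl A' B') (hA : finrank K A = finrank K A') :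
    ∃ g : V ≃ₗ[K] V, A.map (g : V →ₗ[K] V) = A' ∧ B.map (g : V →ₗ[K] V) = B' := by
  have h1 := Submodule.finrank_add_eq_of_isCompl h
  have h2 := Submodule.finrank_add_eq_of_isCompl h'
  obtain ⟨g, hg, hg'⟩ := exists_linearEquiv_of_isCompl h h'
    (LinearEquiv.ofFinrankEq _ _ hA) (LinearEquiv.ofFinrankEq B B' (by omega))
  exact ⟨g, map_eq_of_extends hg, map_eq_of_extends hg'⟩

/-- A map from a finite type with fibres of constant size pushes the uniform distribution to the
uniform distribution. -/
theorem card_filter_mul_card_of_fibres {G X : Type*} [Fintype G] (φ : G → X) (O : Finset X)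
    (hφ : ∀ g, φ g ∈ O)
    (htr : ∀ x ∈ O, ∀ y ∈ O, ∃ h : G → G, Function.Injective h ∧ ∀ g, φ g = x → φ (h g) = y)
    (p : X → Prop) : #{g | p (φ g)} * #O = Fintype.card G * #{x ∈ O | p x} := by
  have hle : ∀ x ∈ O, ∀ y ∈ O, #{g | φ g = x} ≤ #{g | φ g = y} := by
    intro x hx y hy
    obtain ⟨h, hi, hh⟩ := htr x hx y hy
    apply Finset.card_le_card_of_injOn h
    · intro g hg
      simp only [coe_filter, mem_univ, true_and, Set.mem_ofPred_eq] at hg ⊢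
      exact hh g hg
    · exact hi.injOn
  rcases O.eq_empty_or_nonempty with rfl | ⟨x₀, hx₀⟩
  · have : #({g | p (φ g)} : Finset G) ≤ #(univ : Finset G) := card_filter_le _ _
    simp
  have hc : ∀ x ∈ O, #{g | φ g = x} = #{g | φ g = x₀} := fun x hx =>
    le_antisymm (hle x hx x₀ hx₀) (hle x₀ hx₀ x hx)
  have h1 : Fintype.card G = ∑ x ∈ O, #{g | φ g = x} := by
    rw [← Finset.card_univ]
    exact Finset.card_eq_sum_card_fiberwise fun g _ => hφ g
  have h2 : #{g | p (φ g)} = ∑ x ∈ O with p x, #{g | φ g = x} := by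
    rw [Finset.card_eq_sum_card_fiberwise (t := {x ∈ O | p x}) (f := φ)]
    · apply Finset.sum_congr rfl
      intro x hx
      congr 1
      ext g
      simp only [mem_filter, mem_univ, true_and] at hx ⊢
      constructor
      · exact fun h => h.2
      · rintro rfl; exact ⟨hx.2, rfl⟩
    · intro g hg
      simpa [hφ g] using hg
  rw [h1, h2, Finset.sum_congr rfl hc,
    Finset.sum_congr rfl (fun x hx => hc x (mem_of_mem_filter x hx))]
  simp only [sum_const, smul_eq_mul]
  ring

variable (K V) in
/-- An order-reversing bijection of the subspaces that complements ranks. -/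
theorem exists_duality : ∃ D : Submodule K V ≃ Submodule K V,
    (∀ A B : Submodule K V, D A ≤ D B ↔ B ≤ A) ∧
    ∀ A : Submodule K V, finrank K (D A) = finrank K V - finrank K A := by
  -- The duality is the annihilator followed by an arbitrary identification of the dual space with
  -- V.
  have e : Dual K V ≃ₗ[K] V := LinearEquiv.ofFinrankEq _ _ Subspace.dual_finrank_eq
  let o := (Subspace.orderIsoFiniteDimensional (K := K) (V := V)).trans
    (Submodule.orderIsoMapComap e).dual
  refine ⟨o.toEquiv.trans OrderDual.ofDual, fun A B => ?_, fun A => ?_⟩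
  · exact OrderDual.ofDual_le_ofDual.trans o.le_iff_le
  · have h1 := Subspace.finrank_add_finrank_dualAnnihilator_eq A
    have h2 : finrank K (A.dualAnnihilator.map (e : Dual K V →ₗ[K] V)) =
      finrank K A.dualAnnihilator := LinearEquiv.finrank_map_eq e _
    change finrank K (A.dualAnnihilator.map (e : Dual K V →ₗ[K] V)) = _
    omega

end Transitivity

/-! ### Moments of the number of points of a set in a random subspace. -/

section Moments

variable {K V : Type*} [Field K] [Finite K] [AddCommGroup V] [Module K V] [Module.Finite K V]

/-- The number of members of `M` that are contained in `A`. -/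
noncomputable def numBelow (M : Finset (Submodule K V)) (A : Submodule K V) : ℕ :=
  #{P ∈ M | P ≤ A}

/-- The number of members of `M` that contain `B`. -/
noncomputable def numAbove (M : Finset (Submodule K V)) (B : Submodule K V) : ℕ :=
  #{H ∈ M | B ≤ H}

theorem sum_numBelow {M : Finset (Submodule K V)} (hM : M ⊆ Gr K V 1) {r : ℕ} (hr : 1 ≤ r) :
    (∑ A ∈ Gr K V r, (numBelow M A : ℝ)) =
      #M * gauss (Nat.card K) (finrank K V - 1) (r - 1) := by
  have h : ∑ A ∈ Gr K V r, numBelow M A = ∑ P ∈ M, #{A ∈ Gr K V r | P ≤ A} :=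
    Finset.sum_card_bipartiteAbove_eq_sum_card_bipartiteBelow (fun A P => P ≤ A)
  have h' := congrArg (Nat.cast (R := ℝ)) h
  push_cast at h'
  rw [h', Finset.sum_congr rfl (g := fun _ => gauss (Nat.card K) (finrank K V - 1) (r - 1))]
  · simp
  · intro P hP
    have h1 := mem_Gr.1 (hM hP)
    rw [card_Gr_ge P (by omega), h1]

theorem finrank_sup_points {P Q : Submodule K V} (hP : finrank K P = 1) (hQ : finrank K Q = 1)
    (h : P ≠ Q) : finrank K ↥(P ⊔ Q) = 2 := by
  have h1 := Submodule.finrank_sup_add_finrank_inf_eq P Q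
  have h2 : finrank K ↥(P ⊓ Q) = 0 := by
    by_contra h0
    have h3 : P ⊓ Q = P := Submodule.eq_of_le_of_finrank_le inf_le_left (by omega)
    have h4 : P ⊓ Q = Q := Submodule.eq_of_le_of_finrank_le inf_le_right (by omega)
    exact h (h3.symm.trans h4)
  omega

theorem finrank_sup_point {W P : Submodule K V} (hP : finrank K P = 1) (h : ¬ P ≤ W) :
    finrank K ↥(W ⊔ P) = finrank K W + 1 := by
  have h1 := Submodule.finrank_sup_add_finrank_inf_eq W P
  have h2 : finrank K ↥(W ⊓ P) = 0 := by
    by_contra h0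
    have h4 : W ⊓ P = P := Submodule.eq_of_le_of_finrank_le inf_le_right (by omega)
    exact h (inf_eq_right.1 h4)
  omega

theorem card_offDiag_filter (M : Finset (Submodule K V)) (A : Submodule K V) :
    #{p ∈ M.offDiag | p.1 ≤ A ∧ p.2 ≤ A} = numBelow M A * (numBelow M A - 1) := by
  have : ({p ∈ M.offDiag | p.1 ≤ A ∧ p.2 ≤ A} : Finset _) = ({P ∈ M | P ≤ A} : Finset _).offDiag := by
    ext p
    simp only [mem_filter, mem_offDiag]
    tauto
  rw [this, offDiag_card, numBelow, Nat.mul_sub, mul_one]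

theorem card_offDiag_real {α : Type*} (M : Finset α) :
    (#M.offDiag : ℝ) = (#M : ℝ) * ((#M : ℝ) - 1) := by
  rw [offDiag_card, Nat.cast_sub (Nat.le_mul_self _)]
  push_cast; ring

theorem sum_numBelow_mul {M : Finset (Submodule K V)} (hM : M ⊆ Gr K V 1) {r : ℕ} (hr : 2 ≤ r) :
    (∑ A ∈ Gr K V r, ((numBelow M A * (numBelow M A - 1) : ℕ) : ℝ)) =
      #M * (#M - 1) * gauss (Nat.card K) (finrank K V - 2) (r - 2) := by
  have h : ∑ A ∈ Gr K V r, numBelow M A * (numBelow M A - 1) =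
      ∑ p ∈ M.offDiag, #{A ∈ Gr K V r | p.1 ≤ A ∧ p.2 ≤ A} := by
    simp_rw [← card_offDiag_filter]
    exact Finset.sum_card_bipartiteAbove_eq_sum_card_bipartiteBelow
      (fun (A : Submodule K V) (p : Submodule K V × Submodule K V) => p.1 ≤ A ∧ p.2 ≤ A)
  have h' := congrArg (Nat.cast (R := ℝ)) h
  push_cast at h' ⊢
  rw [h', Finset.sum_congr rfl (g := fun _ => gauss (Nat.card K) (finrank K V - 2) (r - 2))]
  · rw [sum_const, nsmul_eq_mul, card_offDiag_real]
  · rintro ⟨P, Q⟩ hp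
    obtain ⟨hP, hQ, hne⟩ := mem_offDiag.1 hp
    have h2 : finrank K ↥(P ⊔ Q) = 2 := finrank_sup_points (mem_Gr.1 (hM hP)) (mem_Gr.1 (hM hQ)) hne
    simp_rw [← sup_le_iff]
    rw [card_Gr_ge _ (by omega), h2]

/-- Count triples (P, Q, R) of points of A with P ≠ Q. If R lies on the line PQ, it imposes no
further condition on A; otherwise the three points span rank 3. The first kind is kept exactly,
because it measures how full the joining lines are. -/
theorem sum_numBelow_sq_mul_le {M : Finset (Submodule K V)} (hM : M ⊆ Gr K V 1) {r : ℕ}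
    (hr : 3 ≤ r) :
    (∑ A ∈ Gr K V r, ((numBelow M A * (numBelow M A - 1) * numBelow M A : ℕ) : ℝ)) ≤
      (∑ p ∈ M.offDiag, (numBelow M (p.1 ⊔ p.2) : ℝ)) *
        gauss (Nat.card K) (finrank K V - 2) (r - 2) +
      #M * (#M - 1) * #M * gauss (Nat.card K) (finrank K V - 3) (r - 3) := by
  have hq := one_lt_natCard_real (K := K)
  have h : ∑ A ∈ Gr K V r, numBelow M A * (numBelow M A - 1) * numBelow M A =
      ∑ p ∈ M.offDiag, ∑ R ∈ M, #{A ∈ Gr K V r | p.1 ⊔ p.2 ≤ A ∧ R ≤ A} := by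
    have h1 : ∀ A, numBelow M A * (numBelow M A - 1) * numBelow M A =
        #{x ∈ M.offDiag ×ˢ M | x.1.1 ⊔ x.1.2 ≤ A ∧ x.2 ≤ A} := by
      intro A
      rw [← card_offDiag_filter, numBelow, ← Finset.card_product]
      congr 1
      ext x
      simp only [mem_product, mem_filter, sup_le_iff]
      tauto
    simp_rw [h1]
    rw [← Finset.sum_product' (s := M.offDiag) (t := M)
      (f := fun p R => #{A ∈ Gr K V r | p.1 ⊔ p.2 ≤ A ∧ R ≤ A})]
    exact Finset.sum_card_bipartiteAbove_eq_sum_card_bipartiteBelow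
      (fun (A : Submodule K V) (x : (Submodule K V × Submodule K V) × Submodule K V) =>
        x.1.1 ⊔ x.1.2 ≤ A ∧ x.2 ≤ A)
  have h' := congrArg (Nat.cast (R := ℝ)) h
  push_cast at h' ⊢
  rw [h', Finset.sum_mul, ← card_offDiag_real, mul_assoc, ← nsmul_eq_mul, ← Finset.sum_const,
    ← Finset.sum_add_distrib]
  apply Finset.sum_le_sum
  rintro ⟨P, Q⟩ hp
  obtain ⟨hP, hQ, hne⟩ := mem_offDiag.1 hp
  have h2 : finrank K ↥(P ⊔ Q) = 2 := finrank_sup_points (mem_Gr.1 (hM hP)) (mem_Gr.1 (hM hQ)) hne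
  simp only [numBelow]
  rw [← Finset.sum_filter_add_sum_filter_not M (fun R => R ≤ P ⊔ Q)]
  apply add_le_add
  · rw [← nsmul_eq_mul, ← Finset.sum_const]
    apply le_of_eq
    apply Finset.sum_congr rfl
    intro R hR
    have hR' := (mem_filter.1 hR).2
    have hc := card_Gr_ge (P ⊔ Q) (r := r) (by omega)
    rw [h2] at hc
    rw [← hc]
    congr 2
    ext A
    simp only [mem_filter]
    exact ⟨fun h => ⟨h.1, h.2.1⟩, fun h => ⟨h.1, h.2, hR'.trans h.2⟩⟩
  · calc _ ≤ ∑ R ∈ M with ¬ R ≤ P ⊔ Q, gauss (Nat.card K) (finrank K V - 3) (r - 3) := by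
          apply le_of_eq
          apply Finset.sum_congr rfl
          intro R hR
          obtain ⟨hRM, hR'⟩ := mem_filter.1 hR
          have h3 := finrank_sup_point (mem_Gr.1 (hM hRM)) hR'
          simp_rw [← sup_le_iff (a := P ⊔ Q)]
          rw [card_Gr_ge _ (by omega), h3, h2]
      _ ≤ _ := by
          rw [sum_const, nsmul_eq_mul]
          apply mul_le_mul_of_nonneg_right _ (gauss_nonneg hq _ _)
          exact_mod_cast card_filter_le _ _

/-- Cauchy-Schwarz for the weights x - 1 and x²(x - 1), with product (x(x - 1))². Truncated
subtraction makes all of them vanish at x = 0. -/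
theorem sq_sum_numBelow_mul_le (M S : Finset (Submodule K V)) :
    (∑ A ∈ S, ((numBelow M A * (numBelow M A - 1) : ℕ) : ℝ)) ^ 2 ≤
      (∑ A ∈ S, ((numBelow M A - 1 : ℕ) : ℝ)) *
      ∑ A ∈ S, ((numBelow M A * (numBelow M A - 1) * numBelow M A : ℕ) : ℝ) := by
  apply Finset.sum_sq_le_sum_mul_sum_of_sq_le_mul
  · intro A _; positivity
  · intro A _; positivity
  · intro A _; apply le_of_eq; push_cast; ring

theorem numBelow_line_le {M : Finset (Submodule K V)} (hM : M ⊆ Gr K V 1) {L : Submodule K V}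
    (hL : finrank K L = 2) : (numBelow M L : ℝ) ≤ Nat.card K + 1 := by
  have hq := one_lt_natCard_real (K := K)
  have h1 := card_Gr_le L 1
  rw [hL, gauss_one_right] at h1
  have h2 : ((Nat.card K : ℝ) ^ 2 - 1) / (Nat.card K - 1) = Nat.card K + 1 := by
    have : (Nat.card K : ℝ) - 1 ≠ 0 := by linarith
    field_simp; ring
  rw [← h2, ← h1]
  exact_mod_cast card_le_card (filter_subset_filter _ hM)

/-- Lower bound for the number of superfluous incidences of a set of points. -/
theorem le_sum_numBelow_sub_one {M : Finset (Submodule K V)} (hM : M ⊆ Gr K V 1) {r : ℕ}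
    (hr : 3 ≤ r) {t : ℝ} (ht : 0 ≤ t)
    (ht' : #M * gauss (Nat.card K) (finrank K V - 3) (r - 3) ≤
      t * gauss (Nat.card K) (finrank K V - 2) (r - 2)) :
    #M * (#M - 1) * gauss (Nat.card K) (finrank K V - 2) (r - 2) ≤
      (∑ A ∈ Gr K V r, ((numBelow M A - 1 : ℕ) : ℝ)) * (Nat.card K + 1 + t) := by
  set g2 := gauss (Nat.card K) (finrank K V - 2) (r - 2)
  have hq := one_lt_natCard_real (K := K)
  have hg2 : 0 ≤ g2 := gauss_nonneg hq _ _
  set s := (#M : ℝ) * (#M - 1) * g2 with hs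
  set S := ∑ A ∈ Gr K V r, ((numBelow M A - 1 : ℕ) : ℝ)
  have hMM : (0 : ℝ) ≤ #M * (#M - 1) := by rw [← card_offDiag_real]; positivity
  have hs0 : 0 ≤ s := mul_nonneg hMM hg2
  have hS0 : 0 ≤ S := sum_nonneg fun _ _ => Nat.cast_nonneg _
  have h1 := sq_sum_numBelow_mul_le M (Gr K V r)
  rw [sum_numBelow_mul hM (by omega)] at h1
  have h2 := sum_numBelow_sq_mul_le hM hr
  have h3 : (∑ p ∈ M.offDiag, (numBelow M (p.1 ⊔ p.2) : ℝ)) ≤ #M * (#M - 1) * (Nat.card K + 1) := by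
    rw [← card_offDiag_real, ← nsmul_eq_mul]
    apply Finset.sum_le_card_nsmul
    rintro ⟨P, Q⟩ hp
    obtain ⟨hP, hQ, hne⟩ := mem_offDiag.1 hp
    exact numBelow_line_le hM (finrank_sup_points (mem_Gr.1 (hM hP)) (mem_Gr.1 (hM hQ)) hne)
  -- A joining line has at most q + 1 points of M, and t bounds the share of third points off it.
  -- Dividing by s then gives the claim.
  have h4 : s ^ 2 ≤ S * (s * (Nat.card K + 1 + t)) := by
    refine h1.trans (mul_le_mul_of_nonneg_left (h2.trans ?_) hS0)
    have h5 := mul_le_mul_of_nonneg_right h3 hg2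
    have h6 := mul_le_mul_of_nonneg_left ht' hMM
    rw [hs]
    nlinarith
  rcases hs0.eq_or_lt with h0 | h0
  · rw [← h0]; positivity
  · nlinarith

end Moments

/-! ### Flags as pairs of subspaces. -/

section Flags

variable {K V : Type*} [Field K] [Finite K] [AddCommGroup V] [Module K V] [Module.Finite K V]

variable (K V) in
/-- The flags of type `{d, d + 1}`, as pairs of subspaces. -/
noncomputable def flags (d : ℕ) : Finset (Submodule K V × Submodule K V) :=
  {f ∈ Gr K V d ×ˢ Gr K V (d + 1) | f.1 ≤ f.2}

theorem mem_flags {d : ℕ} {f : Submodule K V × Submodule K V} :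
    f ∈ flags K V d ↔ finrank K f.1 = d ∧ finrank K f.2 = d + 1 ∧ f.1 ≤ f.2 := by
  simp [flags, and_assoc]

theorem card_flags_filter_fst {d : ℕ} {A : Submodule K V} (hA : finrank K A = d) :
    (#{f ∈ flags K V d | f.1 = A} : ℝ) = gauss (Nat.card K) (finrank K V - d) 1 := by
  rw [← Nat.add_sub_cancel_left (n := d) (m := 1), ← hA, ← card_Gr_ge A (by omega)]
  norm_cast
  symm
  apply Finset.card_bij (fun B _ => (A, B))
  · intro B h
    obtain ⟨h1, h2⟩ := mem_filter.1 h
    exact mem_filter.2 ⟨mem_flags.2 ⟨rfl, mem_Gr.1 h1, h2⟩, rfl⟩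
  · intro B _ B' _ h
    exact (Prod.ext_iff.1 h).2
  · rintro ⟨A', B⟩ h
    obtain ⟨h1, h2⟩ := mem_filter.1 h
    obtain ⟨h3, h4, h5⟩ := mem_flags.1 h1
    simp only at h2 h4 h5
    subst h2
    exact ⟨B, mem_filter.2 ⟨mem_Gr.2 h4, h5⟩, rfl⟩

theorem card_flags_filter_snd {d : ℕ} {B : Submodule K V} (hB : finrank K B = d + 1) :
    (#{f ∈ flags K V d | f.2 = B} : ℝ) = gauss (Nat.card K) (d + 1) 1 := by
  have hq := one_lt_natCard_real (K := K)
  rw [gauss_one_right, ← gauss_succ_self hq, ← hB, ← card_Gr_le B d]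
  norm_cast
  symm
  apply Finset.card_bij (fun A _ => (A, B))
  · intro A h
    obtain ⟨h1, h2⟩ := mem_filter.1 h
    exact mem_filter.2 ⟨mem_flags.2 ⟨mem_Gr.1 h1, hB, h2⟩, rfl⟩
  · intro A _ A' _ h
    exact (Prod.ext_iff.1 h).1
  · rintro ⟨A, B'⟩ h
    obtain ⟨h1, h2⟩ := mem_filter.1 h
    obtain ⟨h3, h4, h5⟩ := mem_flags.1 h1
    simp only at h2 h3 h5
    subst h2
    exact ⟨A, mem_filter.2 ⟨mem_Gr.2 h3, h5⟩, rfl⟩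

/-- In rank 2d+1 every A lies in as many B as every B contains A, so the incidence graph is regular,
of degree `gauss q (d + 1) 1`. This is one of the two marginals. -/
theorem sum_flags_fst {d : ℕ} (hV : finrank K V = 2 * d + 1) (φ : Submodule K V → ℝ) :
    ∑ f ∈ flags K V d, φ f.1 = gauss (Nat.card K) (d + 1) 1 * ∑ A ∈ Gr K V d, φ A := by
  rw [Finset.mul_sum, ← Finset.sum_fiberwise_of_maps_to (t := Gr K V d) (g := Prod.fst)]
  · apply Finset.sum_congr rfl
    intro A hA
    rw [Finset.sum_congr rfl (g := fun _ => φ A)]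
    · rw [sum_const, nsmul_eq_mul, card_flags_filter_fst (mem_Gr.1 hA), hV]
      congr 2; omega
    · intro f hf
      rw [(mem_filter.1 hf).2]
  · intro f hf
    exact mem_Gr.2 (mem_flags.1 hf).1

theorem sum_flags_snd {d : ℕ} (φ : Submodule K V → ℝ) :
    ∑ f ∈ flags K V d, φ f.2 = gauss (Nat.card K) (d + 1) 1 * ∑ B ∈ Gr K V (d + 1), φ B := by
  rw [Finset.mul_sum, ← Finset.sum_fiberwise_of_maps_to (t := Gr K V (d + 1)) (g := Prod.snd)]
  · apply Finset.sum_congr rfl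
    intro B hB
    rw [Finset.sum_congr rfl (g := fun _ => φ B)]
    · rw [sum_const, nsmul_eq_mul, card_flags_filter_snd (mem_Gr.1 hB)]
    · intro f hf
      rw [(mem_filter.1 hf).2]
  · intro f hf
    exact mem_Gr.2 (mem_flags.1 hf).2.1

theorem card_flags {d : ℕ} (hV : finrank K V = 2 * d + 1) :
    (#(flags K V d) : ℝ) =
      gauss (Nat.card K) (d + 1) 1 * gauss (Nat.card K) (2 * d + 1) d := by
  have := sum_flags_fst hV (fun _ => 1)
  simpa [card_Gr, hV] using this

theorem card_flags_filter_fst_le {d : ℕ} (hV : finrank K V = 2 * d + 1)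
    (p : Submodule K V → Prop) :
    (#{f ∈ flags K V d | p f.1} : ℝ) = gauss (Nat.card K) (d + 1) 1 * #{A ∈ Gr K V d | p A} := by
  have := sum_flags_fst hV (fun A => if p A then 1 else 0)
  simpa using this

theorem card_flags_filter_snd_le {d : ℕ} (p : Submodule K V → Prop) :
    (#{f ∈ flags K V d | p f.2} : ℝ) =
      gauss (Nat.card K) (d + 1) 1 * #{B ∈ Gr K V (d + 1) | p B} := by
  have := sum_flags_snd (K := K) (V := V) (d := d) (fun A => if p A then 1 else 0)
  simpa using this

end Flags

/-! ### Spans of consecutive basis vectors. -/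

section Windows

variable {K V : Type*} [Field K] [AddCommGroup V] [Module K V] [Module.Finite K V]

/-- The span of the `r` consecutive vectors of a basis that start at position `i`. -/
def window {n : ℕ} (b : Basis (Fin n) K V) (i r : ℕ) : Submodule K V :=
  Submodule.span K (b '' {j | i ≤ j.val ∧ j.val < i + r})

theorem finrank_window {n : ℕ} (b : Basis (Fin n) K V) {i r : ℕ} (h : i + r ≤ n) :
    finrank K (window b i r) = r := by
  have hli : LinearIndependent K (fun j : {j : Fin n | i ≤ j.val ∧ j.val < i + r} => b j) :=
    b.linearIndependent.comp _ Subtype.val_injective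
  have h1 := finrank_span_eq_card hli
  have h2 : Set.range (fun j : {j : Fin n | i ≤ j.val ∧ j.val < i + r} => b j) =
      b '' {j | i ≤ j.val ∧ j.val < i + r} := by
    rw [Set.image_eq_range]
  rw [h2] at h1
  rw [window, h1]
  rw [Fintype.card_subtype]
  have : (univ.filter fun j : Fin n => i ≤ j.val ∧ j.val < i + r).map Fin.valEmbedding =
      Finset.Ico i (i + r) := by
    ext x
    simp only [mem_map, mem_filter, mem_univ, true_and, Fin.valEmbedding_apply, mem_Ico]
    constructor
    · rintro ⟨j, hj, rfl⟩; exact hj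
    · intro hx; exact ⟨⟨x, by omega⟩, hx, rfl⟩
  have h3 := congrArg Finset.card this
  rw [card_map, Nat.card_Ico] at h3
  simp only [Set.mem_ofPred_eq]
  omega

theorem window_mono {n : ℕ} (b : Basis (Fin n) K V) {i r i' r' : ℕ} (h : i' ≤ i)
    (h' : i + r ≤ i' + r') : window b i r ≤ window b i' r' := by
  apply Submodule.span_mono
  apply Set.image_mono
  intro j hj
  simp only [Set.mem_ofPred_eq] at hj ⊢
  omega

theorem disjoint_window {n : ℕ} (b : Basis (Fin n) K V) {i r i' r' : ℕ} (h : i + r ≤ i') :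
    Disjoint (window b i r) (window b i' r') := by
  apply b.linearIndependent.disjoint_span_image
  rw [Set.disjoint_left]
  intro j hj hj'
  simp only [Set.mem_ofPred_eq] at hj hj'
  omega

end Windows

/-! ### A mixing inequality from a path of flags between complementary subspaces. -/

section Mixing

variable {K V : Type*} [Field K] [Finite K] [AddCommGroup V] [Module K V] [Module.Finite K V]

/-- A uniformly random linear automorphism moves a fixed flag to a uniformly random flag, by
transitivity. -/
theorem card_flags_pushforward [Fintype (V ≃ₗ[K] V)] {d : ℕ} {A B : Submodule K V}
    (hA : finrank K A = d) (hB : finrank K B = d + 1) (hAB : A ≤ B)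
    (p : Submodule K V × Submodule K V → Prop) :
    #{g : V ≃ₗ[K] V | p (A.map (g : V →ₗ[K] V), B.map (g : V →ₗ[K] V))} * #(flags K V d) =
      Fintype.card (V ≃ₗ[K] V) * #{f ∈ flags K V d | p f} := by
  apply card_filter_mul_card_of_fibres
    (φ := fun g : V ≃ₗ[K] V => (A.map (g : V →ₗ[K] V), B.map (g : V →ₗ[K] V)))
  · intro g
    exact mem_flags.2 ⟨by rw [LinearEquiv.finrank_map_eq]; exact hA,
      by rw [LinearEquiv.finrank_map_eq]; exact hB, Submodule.map_mono hAB⟩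
  · intro x hx y hy
    obtain ⟨x1, x2, x3⟩ := mem_flags.1 hx
    obtain ⟨y1, y2, y3⟩ := mem_flags.1 hy
    obtain ⟨h, h1, h2⟩ := exists_linearEquiv_flag x3 y3 (x1.trans y1.symm) (x2.trans y2.symm)
    refine ⟨fun g => g ≪≫ₗ h, fun g g' e => ?_, ?_⟩
    · ext v
      have := LinearEquiv.congr_fun e v
      simpa using this
    · rintro g rfl
      ext1
      · rw [← h1, ← Submodule.map_comp]; rfl
      · rw [← h2, ← Submodule.map_comp]; rfl

variable (K V) in
/-- The pairs of complementary subspaces whose first member has rank `d`. -/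
noncomputable def complPairs (d : ℕ) : Finset (Submodule K V × Submodule K V) :=
  {f ∈ Gr K V d ×ˢ Gr K V (d + 1) | IsCompl f.1 f.2}

theorem card_complPairs_pushforward [Fintype (V ≃ₗ[K] V)] {d : ℕ} {A B : Submodule K V}
    (hA : finrank K A = d) (hB : finrank K B = d + 1) (hAB : IsCompl A B)
    (p : Submodule K V × Submodule K V → Prop) :
    #{g : V ≃ₗ[K] V | p (A.map (g : V →ₗ[K] V), B.map (g : V →ₗ[K] V))} * #(complPairs K V d) =
      Fintype.card (V ≃ₗ[K] V) * #{f ∈ complPairs K V d | p f} := by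
  apply card_filter_mul_card_of_fibres
    (φ := fun g : V ≃ₗ[K] V => (A.map (g : V →ₗ[K] V), B.map (g : V →ₗ[K] V)))
  · intro g
    refine mem_filter.2 ⟨mem_product.2 ⟨mem_Gr.2 ?_, mem_Gr.2 ?_⟩, ?_⟩
    · rw [LinearEquiv.finrank_map_eq]; exact hA
    · rw [LinearEquiv.finrank_map_eq]; exact hB
    · exact (Submodule.orderIsoMapComap g).isCompl hAB
  · intro x hx y hy
    obtain ⟨x1, x3⟩ := mem_filter.1 hx
    obtain ⟨y1, y3⟩ := mem_filter.1 hy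
    have x1 := mem_Gr.1 (mem_product.1 x1).1
    have y1 := mem_Gr.1 (mem_product.1 y1).1
    obtain ⟨h, h1, h2⟩ := exists_linearEquiv_isCompl x3 y3 (x1.trans y1.symm)
    refine ⟨fun g => g ≪≫ₗ h, fun g g' e => ?_, ?_⟩
    · ext v
      have := LinearEquiv.congr_fun e v
      simpa using this
    · rintro g rfl
      ext1
      · rw [← h1, ← Submodule.map_comp]; rfl
      · rw [← h2, ← Submodule.map_comp]; rfl

/-- If `p` on rank `d` and the negation of `r` on rank `d + 1` agree on most flags, then few
complementary pairs satisfy both `p` and `r`. -/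
theorem card_complPairs_filter_le {d : ℕ} (hV : finrank K V = 2 * d + 1)
    (p r : Submodule K V → Prop) :
    #{f ∈ complPairs K V d | p f.1 ∧ r f.2} * #(flags K V d) ≤
      (2 * d + 1) * #{f ∈ flags K V d | p f.1 ↔ r f.2} * #(complPairs K V d) := by
  have : Finite V := Module.finite_of_finite K
  have : Finite (V ≃ₗ[K] V) := Finite.of_injective _ DFunLike.coe_injective
  have := Fintype.ofFinite (V ≃ₗ[K] V)
  let b : Basis (Fin (2 * d + 1)) K V := finBasisOfFinrankEq K V hV
  set W := window b with hW
  have hG : 0 < Fintype.card (V ≃ₗ[K] V) := Fintype.card_pos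
  set G := Fintype.card (V ≃ₗ[K] V)
  set β := #{f ∈ flags K V d | p f.1 ↔ r f.2} with hβ
  let bad (A B : Submodule K V) : Finset (V ≃ₗ[K] V) :=
    {g | p (A.map (g : V →ₗ[K] V)) ↔ r (B.map (g : V →ₗ[K] V))}
  -- A window of length d starting at i lies in the window of length d+1 starting at i or at i - 1,
  -- so consecutive windows form a path of flags.
  have hbad : ∀ i j, i ≤ d → j ≤ d → j ≤ i → i ≤ j + 1 →
      #(bad (W i d) (W j (d + 1))) * #(flags K V d) = G * β := by
    intro i j hi hj hij hij'
    convert card_flags_pushforward (finrank_window b (i := i) (r := d) (by omega))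
      (finrank_window b (i := j) (r := d + 1) (by omega))
      (window_mono b (i := i) (r := d) (i' := j) (r' := d + 1) hij (by omega))
      (fun f => p f.1 ↔ r f.2)
  have hcompl : IsCompl (W 0 d) (W d (d + 1)) := by
    rw [Submodule.isCompl_iff_disjoint]
    · exact disjoint_window b (by omega)
    · rw [finrank_window b (by omega), finrank_window b (by omega), hV]; omega
  have hend := card_complPairs_pushforward (finrank_window b (by omega))
    (finrank_window b (by omega)) hcompl (fun f => p f.1 ∧ r f.2)
  have hend' : #{g : V ≃ₗ[K] V | p ((W 0 d).map (g : V →ₗ[K] V)) ∧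
      r ((W d (d + 1)).map (g : V →ₗ[K] V))} * #(complPairs K V d) =
      G * #{f ∈ complPairs K V d | p f.1 ∧ r f.2} := by convert hend
  -- The path has 2d+1 flags and joins the complementary windows `W 0 d` and `W d (d + 1)`. If `p`
  -- and `r` disagreed on each of its flags, then `p` would pass along all d-windows and `r` would
  -- fail at the end.
  have hsub : ({g : V ≃ₗ[K] V | p ((W 0 d).map (g : V →ₗ[K] V)) ∧
      r ((W d (d + 1)).map (g : V →ₗ[K] V))} : Finset _) ⊆
      (range (d + 1)).biUnion (fun i => bad (W i d) (W i (d + 1))) ∪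
      (range d).biUnion (fun i => bad (W (i + 1) d) (W i (d + 1))) := by
    intro g hg
    by_contra hcon
    simp only [mem_union, mem_biUnion, mem_range, not_or, not_exists, not_and] at hcon
    obtain ⟨h1, h2⟩ := hcon
    simp only [mem_filter, mem_univ, true_and, bad] at hg h1 h2
    have key : ∀ i ≤ d, p ((W i d).map (g : V →ₗ[K] V)) := by
      intro i
      induction i with
      | zero => intro _; exact hg.1
      | succ i ih =>
        intro hi
        have a1 := ih (by omega)
        have a2 := h1 i (by omega)
        have a3 := h2 i (by omega)
        tauto
    have a1 := key d le_rfl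
    have a2 := h1 d (by omega)
    tauto
  have hcard := (card_le_card hsub).trans ((card_union_le _ _).trans
    (add_le_add card_biUnion_le card_biUnion_le))
  have hm := Nat.mul_le_mul_right (#(flags K V d)) hcard
  rw [add_mul, sum_mul, sum_mul,
    sum_congr rfl (fun i hi => hbad i i (by have := mem_range.1 hi; omega)
      (by have := mem_range.1 hi; omega) (by omega) (by omega)),
    sum_congr rfl (fun i hi => hbad (i + 1) i (by have := mem_range.1 hi; omega)
      (by have := mem_range.1 hi; omega) (by omega) (by omega)), sum_const, sum_const,
    card_range, card_range, smul_eq_mul, smul_eq_mul] at hm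
  have hm2 := Nat.mul_le_mul_right (#(complPairs K V d)) hm
  apply Nat.le_of_mul_le_mul_left _ hG
  calc _ = G * #{f ∈ complPairs K V d | p f.1 ∧ r f.2} * #(flags K V d) := by ring
    _ = _ := by rw [← hend']; exact mul_right_comm _ _ _
    _ ≤ _ := hm2
    _ = _ := by ring

theorem card_Gr_succ {d : ℕ} (hV : finrank K V = 2 * d + 1) :
    (#(Gr K V (d + 1)) : ℝ) = gauss (Nat.card K) (2 * d + 1) d := by
  have h1 := sum_flags_fst hV (fun _ => 1)
  have h2 := sum_flags_snd (K := K) (V := V) (d := d) (fun _ => 1)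
  rw [h1] at h2
  simp only [sum_const, nsmul_eq_mul, mul_one] at h2
  rw [card_Gr, hV] at h2
  have hq := one_lt_natCard_real (K := K)
  have h3 := pow_le_gauss hq d 1
  have h4 : 0 < (Nat.card K : ℝ) ^ (1 * d) := by positivity
  exact (mul_left_cancel₀ (lt_of_lt_of_le h4 h3).ne' h2).symm

/-- An expander mixing inequality for the incidence graph of ranks `d` and `d + 1`. -/
theorem mixing {d : ℕ} (hd : 1 ≤ d) (hV : finrank K V = 2 * d + 1)
    (p r : Submodule K V → Prop) :
    (#{B ∈ Gr K V (d + 1) | r B} : ℝ) * (#{A ∈ Gr K V d | p A} -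
        gauss (Nat.card K) (d + 1) 1 * gauss (Nat.card K) (2 * d) (d - 1)) *
        gauss (Nat.card K) (d + 1) 1 ≤
      (2 * d + 1) * #{f ∈ flags K V d | p f.1 ↔ r f.2} * gauss (Nat.card K) (2 * d + 1) d := by
  have hq := one_lt_natCard_real (K := K)
  set w := gauss (Nat.card K) (d + 1) 1
  set g0 := gauss (Nat.card K) (2 * d + 1) d with hg0
  set g1 := gauss (Nat.card K) (2 * d) (d - 1)
  have hg0pos : 0 < g0 := by
    have := pow_le_gauss hq (d + 1) d
    rw [show d + 1 + d = 2 * d + 1 by omega] at this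
    exact lt_of_lt_of_le (by positivity) this
  have h1 := card_complPairs_filter_le hV p r
  have h1' : (#{f ∈ complPairs K V d | p f.1 ∧ r f.2} : ℝ) * #(flags K V d) ≤
      (2 * d + 1) * #{f ∈ flags K V d | p f.1 ↔ r f.2} * #(complPairs K V d) := by
    exact_mod_cast h1
  have h2 : (#(complPairs K V d) : ℝ) ≤ g0 * g0 := by
    calc (#(complPairs K V d) : ℝ) ≤ #(Gr K V d ×ˢ Gr K V (d + 1)) := by
          exact_mod_cast card_filter_le _ _
      _ = _ := by rw [card_product, Nat.cast_mul, card_Gr, hV, card_Gr_succ hV]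
  -- A subspace of rank d that meets B nontrivially contains one of the `w` points of B.
  have h3 : ∀ B ∈ Gr K V (d + 1), (#{A ∈ Gr K V d | ¬ Disjoint A B} : ℝ) ≤ w * g1 := by
    intro B hB
    have hs : ({A ∈ Gr K V d | ¬ Disjoint A B} : Finset _) ⊆
        ({P ∈ Gr K V 1 | P ≤ B} : Finset _).biUnion (fun P => {A ∈ Gr K V d | P ≤ A}) := by
      intro A hA
      obtain ⟨hA1, hA2⟩ := mem_filter.1 hA
      rw [disjoint_iff, Submodule.eq_bot_iff] at hA2
      push Not at hA2
      obtain ⟨x, hx, hx0⟩ := hA2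
      simp only [mem_biUnion, mem_filter]
      refine ⟨Submodule.span K {x}, ⟨mem_Gr.2 (finrank_span_singleton hx0), ?_⟩, hA1, ?_⟩
      · rw [Submodule.span_singleton_le_iff_mem]; exact hx.2
      · rw [Submodule.span_singleton_le_iff_mem]; exact hx.1
    have hc := (card_le_card hs).trans card_biUnion_le
    have hc' : (#{A ∈ Gr K V d | ¬ Disjoint A B} : ℝ) ≤
      ∑ P ∈ Gr K V 1 with P ≤ B, (#{A ∈ Gr K V d | P ≤ A} : ℝ) := by exact_mod_cast hc
    refine hc'.trans ?_
    rw [Finset.sum_congr rfl (g := fun _ => g1), sum_const, nsmul_eq_mul, card_Gr_le,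
      mem_Gr.1 hB]
    intro P hP
    have hP1 := mem_Gr.1 (mem_filter.1 hP).1
    rw [card_Gr_ge P (by omega), hP1, hV]; rfl
  -- For each B with `r`, discard the A that are not complementary to it.
  have h4 : (#{B ∈ Gr K V (d + 1) | r B} : ℝ) * (#{A ∈ Gr K V d | p A} - w * g1) ≤
      #{f ∈ complPairs K V d | p f.1 ∧ r f.2} := by
    have e1 : #{f ∈ complPairs K V d | p f.1 ∧ r f.2} =
        ∑ B ∈ Gr K V (d + 1) with r B, #{A ∈ Gr K V d | p A ∧ Disjoint A B} := by
      rw [Finset.card_eq_sum_card_fiberwise (t := {B ∈ Gr K V (d + 1) | r B}) (f := Prod.snd)]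
      · apply sum_congr rfl
        intro B hB
        obtain ⟨hB1, hB2⟩ := mem_filter.1 hB
        symm
        apply Finset.card_bij (fun A _ => (A, B))
        · intro A hA
          obtain ⟨a1, a2, a3⟩ := mem_filter.1 hA
          simp only [mem_filter, complPairs, mem_product, and_true]
          refine ⟨⟨⟨a1, hB1⟩, ?_⟩, a2, hB2⟩
          rw [Submodule.isCompl_iff_disjoint]
          · exact a3
          · rw [mem_Gr.1 a1, mem_Gr.1 hB1, hV]; omega
        · intro A _ A' _ h
          exact (Prod.ext_iff.1 h).1
        · rintro ⟨A, B'⟩ h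
          obtain ⟨h', rfl⟩ := mem_filter.1 h
          obtain ⟨a1, a2, -⟩ := mem_filter.1 h'
          obtain ⟨a3, a4⟩ := mem_filter.1 a1
          exact ⟨A, mem_filter.2 ⟨(mem_product.1 a3).1, a2, a4.disjoint⟩, rfl⟩
      · intro f hf
        simp only [coe_filter, complPairs, mem_filter, mem_product, Set.mem_ofPred_eq] at hf ⊢
        exact ⟨hf.1.1.2, hf.2.2⟩
    rw [e1, Nat.cast_sum, ← nsmul_eq_mul, ← sum_const]
    apply sum_le_sum
    intro B hB
    have h5 := h3 B (mem_filter.1 hB).1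
    have h6 : #{A ∈ Gr K V d | p A} ≤ #{A ∈ Gr K V d | p A ∧ Disjoint A B} +
        #{A ∈ Gr K V d | ¬ Disjoint A B} := by
      rw [← card_union_add_card_inter]
      refine le_trans (card_le_card ?_) (Nat.le_add_right _ _)
      intro A hA
      obtain ⟨a1, a2⟩ := mem_filter.1 hA
      simp only [mem_union, mem_filter]
      tauto
    have h6' : (#{A ∈ Gr K V d | p A} : ℝ) ≤ #{A ∈ Gr K V d | p A ∧ Disjoint A B} +
        #{A ∈ Gr K V d | ¬ Disjoint A B} := by exact_mod_cast h6
    linarith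
  rw [card_flags hV] at h1'
  have hw : 0 < w := lt_of_lt_of_le (by positivity) (pow_le_gauss hq d 1)
  have h7 := mul_le_mul_of_nonneg_right h4 (mul_pos hw hg0pos).le
  have h8 := mul_le_mul_of_nonneg_left h2
    (show (0 : ℝ) ≤ (2 * d + 1) * #{f ∈ flags K V d | p f.1 ↔ r f.2} by positivity)
  have h9 := h7.trans (h1'.trans h8)
  refine le_of_mul_le_mul_right ?_ hg0pos
  linarith

end Mixing

/-! ### Stability: a cone almost closed under addition is close to a subspace. -/

section AlmostClosed

variable {K V : Type*} [Field K] [AddCommGroup V] [Module K V]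

/-- The number of elements of `M` that the translation by `x` moves out of `M`. -/
noncomputable def translationDefect (M : Finset V) (x : V) : ℕ := #{u ∈ M | x + u ∉ M}

/-- If x + y moves u out of M, then y moves u out, or x moves y + u out. -/
theorem translationDefect_add (M : Finset V) (x y : V) :
    translationDefect M (x + y) ≤ translationDefect M x + translationDefect M y := by
  have h : ({u ∈ M | x + y + u ∉ M} : Finset V) ⊆
      ({u ∈ M | y + u ∈ M ∧ x + (y + u) ∉ M} : Finset V) ∪ ({u ∈ M | y + u ∉ M} : Finset V) := by
    intro u hu
    simp only [mem_filter, mem_union, ← add_assoc] at hu ⊢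
    tauto
  refine (card_le_card h).trans ((card_union_le _ _).trans (Nat.add_le_add_right ?_ _))
  apply Finset.card_le_card_of_injOn (fun u => y + u)
  · intro u hu
    simp only [coe_filter, Set.mem_ofPred_eq] at hu ⊢
    exact hu.2
  · exact (add_right_injective y).injOn

theorem translationDefect_zero (M : Finset V) : translationDefect M (0 : V) = 0 := by
  simp [translationDefect]

theorem translationDefect_smul {M : Finset V}
    (hM : ∀ c : K, c ≠ 0 → ∀ v ∈ M, c • v ∈ M) {c : K} (hc : c ≠ 0) (x : V) :
    translationDefect M (c • x) = translationDefect M x := by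
  have key : ∀ (c : K), c ≠ 0 → ∀ x : V, translationDefect M (c • x) ≤ translationDefect M x := by
    intro c hc x
    apply Finset.card_le_card_of_injOn (fun u => c⁻¹ • u)
    · intro u hu
      simp only [coe_filter, Set.mem_ofPred_eq] at hu ⊢
      refine ⟨hM _ (inv_ne_zero hc) _ hu.1, fun h => hu.2 ?_⟩
      have := hM c hc _ h
      rwa [smul_add, smul_smul, mul_inv_cancel₀ hc, one_smul] at this
    · exact (smul_right_injective V (inv_ne_zero hc)).injOn
  apply le_antisymm (key c hc x)
  have := key c⁻¹ (inv_ne_zero hc) (c • x)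
  rwa [smul_smul, inv_mul_cancel₀ hc, one_smul] at this

/-- A set of vectors that is closed under non-zero scalars and almost closed under addition is
close to a subspace. -/
theorem exists_submodule_of_almost_closed [Finite V] {M : Finset V} (hne : M.Nonempty)
    (hM : ∀ c : K, c ≠ 0 → ∀ v ∈ M, c • v ∈ M) {η : ℝ} (hη : η ≤ 1 / 64)
    (hE : (#{p ∈ M ×ˢ M | p.1 + p.2 ∉ M} : ℝ) ≤ η * (#M : ℝ) ^ 2) :
    ∃ U : Submodule K V, (#{v ∈ M | v ∉ U} : ℝ) ≤ 8 * η * #M ∧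
      3 * (Nat.card U : ℝ) ≤ 4 * #M := by
  have hm : (0 : ℝ) < #M := by exact_mod_cast hne.card_pos
  obtain ⟨m, hmdef⟩ : ∃ m : ℝ, m = (#M : ℝ) := ⟨_, rfl⟩
  rw [← hmdef] at hm hE ⊢
  set S : Finset V := {x ∈ M | 8 * (translationDefect M x : ℝ) ≤ m} with hS
  -- Markov's inequality: the defects of the elements of M add up to the number of pairs whose sum
  -- leaves M.
  have hSc : (#{x ∈ M | x ∉ S} : ℝ) ≤ 8 * η * m := by
    have h1 : #{p ∈ M ×ˢ M | p.1 + p.2 ∉ M} = ∑ x ∈ M, translationDefect M x := by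
      rw [Finset.card_eq_sum_card_fiberwise (t := M) (f := Prod.fst)]
      · apply sum_congr rfl
        intro x hx
        symm
        apply Finset.card_bij (fun u _ => (x, u))
        · intro u hu
          obtain ⟨h1, h2⟩ := mem_filter.1 hu
          simp [hx, h1, h2]
        · intro u _ u' _ h
          exact (Prod.ext_iff.1 h).2
        · rintro ⟨x', u⟩ h
          obtain ⟨h', rfl⟩ := mem_filter.1 h
          obtain ⟨a1, a2⟩ := mem_filter.1 h'
          exact ⟨u, mem_filter.2 ⟨(mem_product.1 a1).2, a2⟩, rfl⟩
      · intro p hp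
        simp only [coe_filter, mem_product, Set.mem_ofPred_eq] at hp
        exact hp.1.1
    have h2 : (#{x ∈ M | x ∉ S} : ℝ) * (m / 8) ≤ ∑ x ∈ M, (translationDefect M x : ℝ) := by
      rw [← nsmul_eq_mul, ← sum_const]
      refine le_trans (sum_le_sum ?_) (sum_le_sum_of_subset_of_nonneg
        (filter_subset (fun x => x ∉ S) M) (fun _ _ _ => Nat.cast_nonneg _))
      intro x hx
      simp only [hS, mem_filter, not_and, not_le] at hx
      have := hx.2 hx.1
      linarith
    rw [h1] at hE
    push_cast at hE
    have h3 := h2.trans hE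
    have : (#{x ∈ M | x ∉ S} : ℝ) * (m / 8) ≤ (8 * η * m) * (m / 8) := by
      refine h3.trans (le_of_eq ?_); ring
    exact le_of_mul_le_mul_right this (by positivity)
  have hSc8 : (#{x ∈ M | x ∉ S} : ℝ) ≤ m / 8 := by nlinarith
  have hneg : ∀ x, translationDefect M (-x) = translationDefect M x := by
    intro x
    have := translationDefect_smul hM (neg_ne_zero.2 (one_ne_zero : (1 : K) ≠ 0)) x
    simpa using this
  -- A gap for the defect: at most m/2 forces at most m/4. At most m/8 elements of M lie outside S,
  -- so some u has u and z + u in S. Then z = (z + u) - u has defect at most m/8 + m/8.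
  have key : ∀ z : V, 2 * (translationDefect M z : ℝ) ≤ m → 4 * (translationDefect M z : ℝ) ≤ m := by
    intro z hz
    have hex : ∃ u ∈ S, z + u ∈ S := by
      by_contra hcon
      push Not at hcon
      have hsub : M ⊆ ({u ∈ M | z + u ∉ M} : Finset V) ∪ (({u ∈ M | u ∉ S} : Finset V) ∪
          ({u ∈ M | z + u ∈ M ∧ z + u ∉ S} : Finset V)) := by
        intro u hu
        simp only [mem_union, mem_filter]
        have := hcon u
        tauto
      have h1 : #{u ∈ M | z + u ∈ M ∧ z + u ∉ S} ≤ #{u ∈ M | u ∉ S} := by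
        apply Finset.card_le_card_of_injOn (fun u => z + u)
        · intro u hu
          simp only [coe_filter, Set.mem_ofPred_eq] at hu ⊢
          exact hu.2
        · exact (add_right_injective z).injOn
      have h2 := (card_le_card hsub).trans ((card_union_le _ _).trans
        (Nat.add_le_add_left (card_union_le _ _) _))
      have h2' : m ≤ translationDefect M z + (#{u ∈ M | u ∉ S} +
        #{u ∈ M | z + u ∈ M ∧ z + u ∉ S} : ℝ) := by
        rw [hmdef]; exact_mod_cast h2
      have h1' : (#{u ∈ M | z + u ∈ M ∧ z + u ∉ S} : ℝ) ≤ #{u ∈ M | u ∉ S} := by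
        exact_mod_cast h1
      linarith
    obtain ⟨u, hu, hzu⟩ := hex
    have h1 := (mem_filter.1 hu).2
    have h2 := (mem_filter.1 hzu).2
    have h3 := translationDefect_add M (z + u) (-u)
    rw [add_neg_cancel_right, hneg] at h3
    have h3' : (translationDefect M z : ℝ) ≤ translationDefect M (z + u) + translationDefect M u := by
      exact_mod_cast h3
    linarith
  -- Two defects of at most m/4 add up to at most m/2, and the gap brings this back to m/4, so the
  -- set is closed under addition.
  let U : Submodule K V :=
    { carrier := {z | 4 * (translationDefect M z : ℝ) ≤ m}
      zero_mem' := by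
        simp only [Set.mem_ofPred_eq, translationDefect_zero]; simpa using hm.le
      add_mem' := by
        intro x y hx hy
        simp only [Set.mem_ofPred_eq] at hx hy ⊢
        apply key
        have : (translationDefect M (x + y) : ℝ) ≤ translationDefect M x + translationDefect M y := by
          exact_mod_cast translationDefect_add M x y
        linarith
      smul_mem' := by
        intro c x hx
        simp only [Set.mem_ofPred_eq] at hx ⊢
        by_cases hc : c = 0
        · rw [hc, zero_smul, translationDefect_zero]; simpa using hm.le
        · rwa [translationDefect_smul hM hc] }
  have hmemU : ∀ z, z ∈ U ↔ 4 * (translationDefect M z : ℝ) ≤ m := fun z => Iff.rfl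
  refine ⟨U, le_trans ?_ hSc, ?_⟩
  · have : ({v ∈ M | v ∉ U} : Finset V) ⊆ ({x ∈ M | x ∉ S} : Finset V) := by
      intro v hv
      obtain ⟨h1, h2⟩ := mem_filter.1 hv
      refine mem_filter.2 ⟨h1, fun h => h2 ?_⟩
      rw [hmemU]
      have := (mem_filter.1 h).2
      have h0 : (0 : ℝ) ≤ translationDefect M v := Nat.cast_nonneg _
      linarith
    exact_mod_cast card_le_card this
  · have := Fintype.ofFinite V
    set T : Finset V := {z | z ∈ U}
    have hT : Nat.card U = #T := by
      rw [Nat.card_eq_fintype_card, Fintype.card_subtype]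
    -- Count pairs (z, u) with z in U and both u, z + u in M: each z gives at least 3m/4, each u at
    -- most m.
    have h1 : ∑ z ∈ T, #{u ∈ M | z + u ∈ M} = ∑ u ∈ M, #{z ∈ T | z + u ∈ M} :=
      Finset.sum_card_bipartiteAbove_eq_sum_card_bipartiteBelow (fun z u => z + u ∈ M)
    have h2 : ∑ u ∈ M, #{z ∈ T | z + u ∈ M} ≤ #M * #M := by
      rw [← smul_eq_mul]
      apply Finset.sum_le_card_nsmul
      intro u _
      apply Finset.card_le_card_of_injOn (fun z => z + u)
      · intro z hz
        simp only [coe_filter, Set.mem_ofPred_eq] at hz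
        exact hz.2
      · exact (add_left_injective u).injOn
    have h3 : (#T : ℝ) * (3 / 4 * m) ≤ ∑ z ∈ T, (#{u ∈ M | z + u ∈ M} : ℝ) := by
      rw [← nsmul_eq_mul, ← sum_const]
      apply sum_le_sum
      intro z hz
      have hz' : 4 * (translationDefect M z : ℝ) ≤ m := (hmemU z).1 (mem_filter.1 hz).2
      have h4 : #{u ∈ M | z + u ∈ M} + translationDefect M z = #M :=
        card_filter_add_card_filter_not _
      have h4' : (#{u ∈ M | z + u ∈ M} : ℝ) + translationDefect M z = m := by
        rw [hmdef]; exact_mod_cast h4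
      linarith
    rw [← h1] at h2
    have h2' : ∑ z ∈ T, (#{u ∈ M | z + u ∈ M} : ℝ) ≤ m * m := by
      rw [hmdef]; exact_mod_cast h2
    rw [hT]
    have h5 : (3 * (#T : ℝ)) * m ≤ (4 * m) * m := by linarith
    exact le_of_mul_le_mul_right h5 hm

end AlmostClosed

/-! ### Families of subspaces through a point that pairwise meet in rank at least 2. -/

section Intersecting

variable {K V : Type*} [Field K] [Finite K] [AddCommGroup V] [Module K V] [Module.Finite K V]

theorem exists_between_finrank_succ {W X : Submodule K V} (h : W ≤ X)
    (hr : finrank K W < finrank K X) :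
    ∃ E, W ≤ E ∧ E ≤ X ∧ finrank K E = finrank K W + 1 := by
  have hlt : W < X := lt_of_le_of_ne h (by rintro rfl; exact lt_irrefl _ hr)
  obtain ⟨x, hx, hxW⟩ := SetLike.exists_of_lt hlt
  refine ⟨W ⊔ Submodule.span K {x}, le_sup_left, sup_le h ?_, ?_⟩
  · rwa [Submodule.span_singleton_le_iff_mem]
  · exact finrank_sup_point (finrank_span_singleton (by rintro rfl; exact hxW W.zero_mem))
      (by rwa [Submodule.span_singleton_le_iff_mem])

theorem gauss_one_mono {q : ℝ} (hq : 1 < q) {m n : ℕ} (h : m ≤ n) :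
    gauss q m 1 ≤ gauss q n 1 := by
  rw [gauss_one_right, gauss_one_right]
  apply div_le_div_of_nonneg_right _ (by linarith)
  have := pow_le_pow_right₀ hq.le h
  linarith

/-- The lines through `P` in `X`. -/
noncomputable def linesThrough (P X : Submodule K V) : Finset (Submodule K V) :=
  {L ∈ Gr K V 2 | P ≤ L ∧ L ≤ X}

theorem card_linesThrough {P X : Submodule K V} (hP : finrank K P = 1) (h : P ≤ X) :
    (#(linesThrough P X) : ℝ) = gauss (Nat.card K) (finrank K X - 1) 1 := by
  rw [linesThrough, card_Gr_between h (by omega), hP]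

variable {d : ℕ} {P : Submodule K V} {S : Finset (Submodule K V)}

theorem card_filter_le_of_rank (hV : finrank K V = 2 * d + 1) (hS : ∀ B ∈ S, finrank K B = d + 1)
    {E : Submodule K V} (hE : finrank K E ≤ d + 1) :
    (#{B ∈ S | E ≤ B} : ℝ) ≤
      gauss (Nat.card K) (2 * d + 1 - finrank K E) (d + 1 - finrank K E) := by
  rw [← hV, ← card_Gr_ge E hE]
  have : ({B ∈ S | E ≤ B} : Finset _) ⊆ {B ∈ Gr K V (d + 1) | E ≤ B} := by
    intro B hB
    obtain ⟨h1, h2⟩ := mem_filter.1 hB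
    exact mem_filter.2 ⟨mem_Gr.2 (hS B h1), h2⟩
  exact_mod_cast card_le_card this

theorem eq_inf_of_finrank_le_one {B E : Submodule K V} (hP : finrank K P = 1) (h1 : P ≤ B)
    (h2 : P ≤ E) (h : finrank K ↥(B ⊓ E) ≤ 1) : B ⊓ E = P :=
  (Submodule.eq_of_le_of_finrank_le (le_inf h1 h2) (by omega)).symm

theorem finrank_sup_line {E L : Submodule K V} (hP : finrank K P = 1) (hL : finrank K L = 2)
    (h : E ⊓ L = P) : finrank K ↥(E ⊔ L) = finrank K E + 1 := by
  have := Submodule.finrank_sup_add_finrank_inf_eq E L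
  rw [h] at this
  omega

/-- Members of an intersecting family through `E` are distributed among the joins of `E` with the
lines of a member that meets `E` trivially. -/
theorem card_filter_le_sum_lines (hP : finrank K P = 1) (hPS : ∀ B ∈ S, P ≤ B)
    (hint : ∀ B ∈ S, ∀ B' ∈ S, 2 ≤ finrank K ↥(B ⊓ B')) (E : Submodule K V)
    {B₀ : Submodule K V} (hB₀ : B₀ ∈ S) :
    (#{B ∈ S | E ≤ B} : ℝ) ≤ ∑ L ∈ linesThrough P B₀, (#{B ∈ S | E ⊔ L ≤ B} : ℝ) := by
  have : ({B ∈ S | E ≤ B} : Finset _) ⊆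
      (linesThrough P B₀).biUnion (fun L => {B ∈ S | E ⊔ L ≤ B}) := by
    intro B hB
    obtain ⟨h1, h2⟩ := mem_filter.1 hB
    obtain ⟨L, hL1, hL2, hL3⟩ := exists_between_finrank_succ
      (le_inf (hPS B h1) (hPS B₀ hB₀)) (by have := hint B h1 B₀ hB₀; omega)
    simp only [mem_biUnion, linesThrough, mem_filter, mem_Gr]
    exact ⟨L, ⟨by omega, hL1, hL2.trans inf_le_right⟩, h1, sup_le h2 (hL2.trans inf_le_left)⟩
  exact_mod_cast (card_le_card this).trans card_biUnion_le

theorem finrank_sup_of_mem_linesThrough {B₀ E L : Submodule K V} (hP : finrank K P = 1)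
    (hPE : P ≤ E) (hL : L ∈ linesThrough P B₀) (hE : finrank K ↥(B₀ ⊓ E) ≤ 1) :
    finrank K ↥(E ⊔ L) = finrank K E + 1 := by
  obtain ⟨h1, h2, h3⟩ := mem_filter.1 hL
  apply finrank_sup_line hP (mem_Gr.1 h1)
  apply eq_inf_of_finrank_le_one hP hPE h2
  rw [inf_comm]
  exact (Submodule.finrank_mono (inf_le_inf_right E h3)).trans hE

/-- The branching step. Members through E meet B₀ in a line through P. Such a line meets E only in
P, so joining it to E raises the rank by one, and B₀ has only `gauss q d 1` such lines. -/
theorem card_filter_le_mul (hP : finrank K P = 1) (hS : ∀ B ∈ S, finrank K B = d + 1)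
    (hPS : ∀ B ∈ S, P ≤ B)
    (hint : ∀ B ∈ S, ∀ B' ∈ S, 2 ≤ finrank K ↥(B ⊓ B')) {E : Submodule K V} (hPE : P ≤ E)
    {B₀ : Submodule K V} (hB₀ : B₀ ∈ S) (hE : finrank K ↥(B₀ ⊓ E) ≤ 1) {c : ℝ}
    (hc : ∀ E', E ≤ E' → finrank K E' = finrank K E + 1 → (#{B ∈ S | E' ≤ B} : ℝ) ≤ c) :
    (#{B ∈ S | E ≤ B} : ℝ) ≤ gauss (Nat.card K) d 1 * c := by
  have h := card_filter_le_sum_lines hP hPS hint E hB₀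
  refine h.trans ?_
  have h2 := card_linesThrough hP (hPS B₀ hB₀)
  rw [hS B₀ hB₀, Nat.add_sub_cancel] at h2
  rw [← h2, ← nsmul_eq_mul, ← sum_const]
  apply sum_le_sum
  intro L hL
  exact hc _ le_sup_left (finrank_sup_of_mem_linesThrough hP hPE hL hE)

theorem finrank_inf_le_one_of_not_le {B L : Submodule K V} (hL : finrank K L = 2)
    (h : ¬ L ≤ B) : finrank K ↥(B ⊓ L) ≤ 1 := by
  by_contra hcon
  have : B ⊓ L = L := Submodule.eq_of_le_of_finrank_le inf_le_right (by omega)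
  exact h (inf_eq_right.1 this)

/-- A bound for the size of an intersecting family of subspaces. -/
theorem card_intersecting_le (hd : 3 ≤ d) (hV : finrank K V = 2 * d + 1)
    (hq : 3 ≤ (Nat.card K : ℝ)) (hP : finrank K P = 1)
    (hS : ∀ B ∈ S, finrank K B = d + 1) (hPS : ∀ B ∈ S, P ≤ B)
    (hint : ∀ B ∈ S, ∀ B' ∈ S, 2 ≤ finrank K ↥(B ⊓ B')) :
    (#S : ℝ) ≤ 16 * (Nat.card K : ℝ) ^ (d ^ 2 - 3) := by
  obtain ⟨e, rfl⟩ : ∃ e, d = e + 3 := ⟨d - 3, by omega⟩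
  have hq1 := one_lt_natCard_real (K := K)
  set q : ℝ := (Nat.card K : ℝ) with hqdef
  have hq0 : 0 < q := by linarith
  have hg : gauss q (e + 3) 1 ≤ 2 * q ^ (e + 2) := by
    have := gauss_le hq (e + 2) 1
    rwa [one_mul] at this
  have hg0 := gauss_nonneg hq1 (e + 3) 1
  have hD2 : ∀ L : Submodule K V, finrank K L = 2 → (#{B ∈ S | L ≤ B} : ℝ) ≤
      2 * q ^ ((e + 2) * (e + 3)) := by
    intro L hL
    refine (card_filter_le_of_rank hV hS (by omega)).trans ?_
    rw [hL, show 2 * (e + 3) + 1 - 2 = (e + 3) + (e + 2) by omega,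
      show e + 3 + 1 - 2 = e + 2 by omega]
    exact gauss_le hq _ _
  have hD3 : ∀ E : Submodule K V, finrank K E = 3 → (#{B ∈ S | E ≤ B} : ℝ) ≤
      2 * q ^ ((e + 1) * (e + 3)) := by
    intro L hL
    refine (card_filter_le_of_rank hV hS (by omega)).trans ?_
    rw [hL, show 2 * (e + 3) + 1 - 3 = (e + 3) + (e + 1) by omega,
      show e + 3 + 1 - 3 = e + 1 by omega]
    exact gauss_le hq _ _
  have hD4 : ∀ E : Submodule K V, finrank K E = 4 → (#{B ∈ S | E ≤ B} : ℝ) ≤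
      2 * q ^ (e * (e + 3)) := by
    intro L hL
    refine (card_filter_le_of_rank hV hS (by omega)).trans ?_
    rw [hL, show 2 * (e + 3) + 1 - 4 = (e + 3) + e by omega,
      show e + 3 + 1 - 4 = e by omega]
    exact gauss_le hq _ _
  have hexp : (e + 3) ^ 2 - 3 = e ^ 2 + 6 * e + 6 := by
    have : (e + 3) ^ 2 = e ^ 2 + 6 * e + 9 := by ring
    omega
  rw [hexp]
  -- All members on one line: the trivial bound suffices. Otherwise every line through P is missed
  -- by some member, and branching applies at lines.
  by_cases hline : ∃ L : Submodule K V, finrank K L = 2 ∧ P ≤ L ∧ ∀ B ∈ S, L ≤ B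
  · obtain ⟨L, hL, -, hLS⟩ := hline
    have := hD2 L hL
    rw [filter_true_of_mem hLS] at this
    refine this.trans ?_
    have : q ^ ((e + 2) * (e + 3)) ≤ q ^ (e ^ 2 + 6 * e + 6) :=
      pow_le_pow_right₀ hq1.le (by nlinarith)
    have : 0 < q ^ (e ^ 2 + 6 * e + 6) := by positivity
    linarith
  push Not at hline
  have hlineD : ∀ L : Submodule K V, finrank K L = 2 → P ≤ L → (#{B ∈ S | L ≤ B} : ℝ) ≤
      gauss q (e + 3) 1 * (2 * q ^ ((e + 1) * (e + 3))) := by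
    intro L hL hPL
    obtain ⟨B₀, hB₀, hLB⟩ := hline L hL hPL
    exact card_filter_le_mul hP hS hPS hint hPL hB₀ (finrank_inf_le_one_of_not_le hL hLB)
      (fun E' _ hE' => hD3 E' (by omega))
  -- If all members meet one E of rank 3 in rank at least 2, they are distributed over its q + 1
  -- lines through P. Otherwise branching applies at rank 3 as well, and three branchings from P
  -- give the exponent 3(d - 1) + (d - 3)d = d² - 3.
  by_cases hplane : ∃ E : Submodule K V, finrank K E = 3 ∧ P ≤ E ∧
      ∀ B ∈ S, 2 ≤ finrank K ↥(B ⊓ E)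
  · obtain ⟨E, hE, hPE, hES⟩ := hplane
    have hsub : S ⊆ (linesThrough P E).biUnion (fun L => {B ∈ S | L ≤ B}) := by
      intro B hB
      obtain ⟨L, hL1, hL2, hL3⟩ := exists_between_finrank_succ
        (le_inf (hPS B hB) hPE) (by have := hES B hB; omega)
      simp only [mem_biUnion, linesThrough, mem_filter, mem_Gr]
      exact ⟨L, ⟨by omega, hL1, hL2.trans inf_le_right⟩, hB, hL2.trans inf_le_left⟩
    have h1 : (#S : ℝ) ≤ ∑ L ∈ linesThrough P E, (#{B ∈ S | L ≤ B} : ℝ) := by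
      exact_mod_cast (card_le_card hsub).trans card_biUnion_le
    have h2 : (∑ L ∈ linesThrough P E, (#{B ∈ S | L ≤ B} : ℝ)) ≤
        gauss q 2 1 * (gauss q (e + 3) 1 * (2 * q ^ ((e + 1) * (e + 3)))) := by
      have h3 := card_linesThrough hP hPE
      rw [hE] at h3
      rw [← h3, ← nsmul_eq_mul, ← sum_const]
      apply sum_le_sum
      intro L hL
      obtain ⟨a1, a2, a3⟩ := mem_filter.1 hL
      exact hlineD L (mem_Gr.1 a1) a2
    have hg2 : gauss q 2 1 ≤ 2 * q ^ 1 := by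
      have := gauss_le hq 1 1
      rwa [one_mul] at this
    calc (#S : ℝ) ≤ _ := h1.trans h2
      _ ≤ (2 * q ^ 1) * ((2 * q ^ (e + 2)) * (2 * q ^ ((e + 1) * (e + 3)))) := by
          gcongr
      _ = 8 * q ^ (1 + (e + 2) + (e + 1) * (e + 3)) := by rw [pow_add, pow_add]; ring
      _ ≤ 16 * q ^ (e ^ 2 + 6 * e + 6) := by
          have h4 : q ^ (1 + (e + 2) + (e + 1) * (e + 3)) ≤ q ^ (e ^ 2 + 6 * e + 6) :=
            pow_le_pow_right₀ hq1.le (by nlinarith)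
          have : 0 < q ^ (e ^ 2 + 6 * e + 6) := by positivity
          linarith
  push Not at hplane
  rcases S.eq_empty_or_nonempty with rfl | ⟨B₁, hB₁⟩
  · simp; positivity
  have h4 : ∀ E : Submodule K V, finrank K E = 3 → P ≤ E → (#{B ∈ S | E ≤ B} : ℝ) ≤
      gauss q (e + 3) 1 * (2 * q ^ (e * (e + 3))) := by
    intro E hE hPE
    obtain ⟨B₀, hB₀, hlt⟩ := hplane E hE hPE
    exact card_filter_le_mul hP hS hPS hint hPE hB₀ (by omega)
      (fun E' _ hE' => hD4 E' (by omega))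
  have h5 : ∀ L : Submodule K V, finrank K L = 2 → P ≤ L → (#{B ∈ S | L ≤ B} : ℝ) ≤
      gauss q (e + 3) 1 * (gauss q (e + 3) 1 * (2 * q ^ (e * (e + 3)))) := by
    intro L hL hPL
    obtain ⟨B₀, hB₀, hLB⟩ := hline L hL hPL
    exact card_filter_le_mul hP hS hPS hint hPL hB₀ (finrank_inf_le_one_of_not_le hL hLB)
      (fun E' hE1 hE' => h4 E' (by omega) (hPL.trans hE1))
  have h6 : (#{B ∈ S | P ≤ B} : ℝ) ≤
      gauss q (e + 3) 1 * (gauss q (e + 3) 1 * (gauss q (e + 3) 1 * (2 * q ^ (e * (e + 3))))) :=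
    card_filter_le_mul hP hS hPS hint le_rfl hB₁
      ((Submodule.finrank_mono inf_le_right).trans hP.le)
      (fun E' hE1 hE' => h5 E' (by omega) hE1)
  rw [filter_true_of_mem hPS] at h6
  calc (#S : ℝ) ≤ _ := h6
    _ ≤ (2 * q ^ (e + 2)) * ((2 * q ^ (e + 2)) * ((2 * q ^ (e + 2)) *
        (2 * q ^ (e * (e + 3))))) := by gcongr
    _ = 16 * q ^ ((e + 2) + (e + 2) + (e + 2) + e * (e + 3)) := by
        rw [pow_add, pow_add, pow_add]; ring
    _ = _ := by
        congr 2; ring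

/-- An intersecting family whose members meet `U` in a line of a small set `𝓛` of lines through
`P` is either small or has all its members on one line. -/
theorem card_intersecting_on_lines_le (hd : 3 ≤ d) (hV : finrank K V = 2 * d + 1)
    (hq : 3 ≤ (Nat.card K : ℝ)) (hP : finrank K P = 1)
    (hS : ∀ B ∈ S, finrank K B = d + 1) (hPS : ∀ B ∈ S, P ≤ B)
    (hint : ∀ B ∈ S, ∀ B' ∈ S, 2 ≤ finrank K ↥(B ⊓ B')) {U : Submodule K V}
    {𝓛 : Finset (Submodule K V)} (h𝓛 : ∀ L ∈ 𝓛, finrank K L = 2 ∧ P ≤ L)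
    (hU : ∀ B ∈ S, B ⊓ U ∈ 𝓛) :
    (∃ L ∈ 𝓛, ∀ B ∈ S, B ⊓ U = L) ∨
    (#S : ℝ) ≤ 4 * (Nat.card K : ℝ) ^ (d ^ 2 - d - 1) +
      12 * #𝓛 * (Nat.card K : ℝ) ^ (d ^ 2 - d - 2) := by
  rcases S.eq_empty_or_nonempty with rfl | ⟨B₁, hB₁⟩
  · right; simp; positivity
  by_cases hone : ∃ L ∈ 𝓛, ∀ B ∈ S, B ⊓ U = L
  · exact Or.inl hone
  right
  push Not at hone
  obtain ⟨e, rfl⟩ : ∃ e, d = e + 3 := ⟨d - 3, by omega⟩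
  have hq1 := one_lt_natCard_real (K := K)
  set q : ℝ := (Nat.card K : ℝ) with hqdef
  have hq0 : 0 < q := by linarith
  have hg : gauss q (e + 3) 1 ≤ 2 * q ^ (e + 2) := by
    have := gauss_le hq (e + 2) 1
    rwa [one_mul] at this
  have hg0 := gauss_nonneg hq1 (e + 3) 1
  have hD3 : ∀ E : Submodule K V, finrank K E = 3 → (#{B ∈ S | E ≤ B} : ℝ) ≤
      2 * q ^ ((e + 1) * (e + 3)) := by
    intro L hL
    refine (card_filter_le_of_rank hV hS (by omega)).trans ?_
    rw [hL, show 2 * (e + 3) + 1 - 3 = (e + 3) + (e + 1) by omega,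
      show e + 3 + 1 - 3 = e + 1 by omega]
    exact gauss_le hq _ _
  have hD4 : ∀ E : Submodule K V, finrank K E = 4 → (#{B ∈ S | E ≤ B} : ℝ) ≤
      2 * q ^ (e * (e + 3)) := by
    intro L hL
    refine (card_filter_le_of_rank hV hS (by omega)).trans ?_
    rw [hL, show 2 * (e + 3) + 1 - 4 = (e + 3) + e by omega,
      show e + 3 + 1 - 4 = e by omega]
    exact gauss_le hq _ _
  have hexp1 : (e + 3) ^ 2 - (e + 3) - 1 = e ^ 2 + 5 * e + 5 := by
    have : (e + 3) ^ 2 = e ^ 2 + 6 * e + 9 := by ring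
    omega
  have hexp2 : (e + 3) ^ 2 - (e + 3) - 2 = e ^ 2 + 5 * e + 4 := by
    have : (e + 3) ^ 2 = e ^ 2 + 6 * e + 9 := by ring
    omega
  rw [hexp1, hexp2]
  have hUL : ∀ B ∈ S, ∀ L ∈ 𝓛, L ≤ U → L ≤ B → B ⊓ U = L := by
    intro B hB L hL hLU hLB
    exact (Submodule.eq_of_le_of_finrank_le (le_inf hLB hLU)
      (by rw [(h𝓛 _ (hU B hB)).1, (h𝓛 L hL).1])).symm
  have hsum : (#S : ℝ) ≤ ∑ L ∈ 𝓛, (#{B ∈ S | B ⊓ U = L} : ℝ) := by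
    have : #S = ∑ L ∈ 𝓛, #{B ∈ S | B ⊓ U = L} := Finset.card_eq_sum_card_fiberwise hU
    exact_mod_cast this.le
  have hlineD : ∀ L ∈ 𝓛, (#{B ∈ S | B ⊓ U = L} : ℝ) ≤ 4 * q ^ (e ^ 2 + 5 * e + 5) := by
    intro L hL
    by_cases hLU : L ≤ U
    · obtain ⟨B₀, hB₀, hne⟩ := hone L hL
      have hnot : ¬ L ≤ B₀ := fun h => hne (hUL B₀ hB₀ L hL hLU h)
      have h1 := card_filter_le_mul hP hS hPS hint (h𝓛 L hL).2 hB₀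
        (finrank_inf_le_one_of_not_le (h𝓛 L hL).1 hnot)
        (fun E' _ hE' => hD3 E' (by rw [hE', (h𝓛 L hL).1]))
      have h2 : (#{B ∈ S | B ⊓ U = L} : ℝ) ≤ #{B ∈ S | L ≤ B} := by
        have : ({B ∈ S | B ⊓ U = L} : Finset _) ⊆ {B ∈ S | L ≤ B} := by
          intro B hB
          obtain ⟨a1, a2⟩ := mem_filter.1 hB
          exact mem_filter.2 ⟨a1, a2 ▸ inf_le_left⟩
        exact_mod_cast card_le_card this
      calc _ ≤ _ := h2.trans h1
        _ ≤ (2 * q ^ (e + 2)) * (2 * q ^ ((e + 1) * (e + 3))) := by gcongr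
        _ = 4 * q ^ ((e + 2) + (e + 1) * (e + 3)) := by rw [pow_add]; ring
        _ = _ := by congr 2; ring
    · rw [filter_false_of_mem]
      · simp; positivity
      · intro B _ h
        exact hLU (h ▸ inf_le_right)
  -- Either two members on one line L₁ share nothing more than rank 2, and together they restrict
  -- the members on all other lines to a lower order, or members on a common line always share rank
  -- 3.
  by_cases hpair : ∃ L₁ ∈ 𝓛, ∃ B ∈ S, ∃ B' ∈ S, B ⊓ U = L₁ ∧ B' ⊓ U = L₁ ∧
      finrank K ↥(B ⊓ B') ≤ 2
  · obtain ⟨L₁, hL₁, B, hB, B', hB', hBL, hBL', hBB⟩ := hpair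
    have hother : ∀ L ∈ 𝓛, L ≠ L₁ → (#{B ∈ S | B ⊓ U = L} : ℝ) ≤
        12 * q ^ (e ^ 2 + 5 * e + 4) := by
      intro L hL hLne
      by_cases hLU : L ≤ U
      swap
      · rw [filter_false_of_mem]
        · simp; positivity
        · intro B _ h
          exact hLU (h ▸ inf_le_right)
      obtain ⟨hL2, hPL⟩ := h𝓛 L hL
      have hLB : ¬ L ≤ B := fun h => hLne ((hUL B hB L hL hLU h).symm.trans hBL)
      have hLB' : ¬ L ≤ B' := fun h => hLne ((hUL B' hB' L hL hLU h).symm.trans hBL')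
      have hBL1 := finrank_inf_le_one_of_not_le hL2 hLB
      have hBL1' := finrank_inf_le_one_of_not_le hL2 hLB'
      -- A member through L meets B in a line M. Only the few M in X can make L ⊔ M meet B' beyond
      -- P; for all other M one branches a second time, using B'.
      set X := B ⊓ (L ⊔ B') with hX
      have hPX : P ≤ X := le_inf (hPS B hB) (hPL.trans le_sup_left)
      have hXr : finrank K X ≤ 3 := by
        have h1 := Submodule.finrank_sup_add_finrank_inf_eq X B'
        have h2 : X ⊓ B' = B ⊓ B' := by
          rw [hX, inf_assoc, inf_eq_right.2 (le_sup_right : B' ≤ L ⊔ B')]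
        have h3 : finrank K ↥(X ⊔ B') ≤ finrank K ↥(L ⊔ B') :=
          Submodule.finrank_mono (sup_le inf_le_right le_sup_right)
        have h4 := Submodule.finrank_sup_add_finrank_inf_eq L B'
        have h5 : 1 ≤ finrank K ↥(L ⊓ B') := by
          rw [← hP]; exact Submodule.finrank_mono (le_inf hPL (hPS B' hB'))
        rw [h2] at h1
        have h6 := hS B' hB'
        omega
      have h1 := card_filter_le_sum_lines hP hPS hint L hB
      have h2 : ∀ M ∈ linesThrough P B, ¬ M ≤ X → (#{B ∈ S | L ⊔ M ≤ B} : ℝ) ≤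
          gauss q (e + 3) 1 * (2 * q ^ (e * (e + 3))) := by
        intro M hM hMX
        have hLM := finrank_sup_of_mem_linesThrough hP hPL hM hBL1
        obtain ⟨a1, a2, a3⟩ := mem_filter.1 hM
        apply card_filter_le_mul hP hS hPS hint (hPL.trans le_sup_left) hB'
        -- A line M' in B' ∩ (L ⊔ M) would give L ⊔ M' = L ⊔ M by rank, hence M ≤ L ⊔ B', against
        -- the choice of M.
        · by_contra hcon
          obtain ⟨M', b1, b2, b3⟩ := exists_between_finrank_succ
            (le_inf (hPS B' hB') (hPL.trans le_sup_left : P ≤ L ⊔ M)) (by omega)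
          apply hMX
          refine le_inf a3 ?_
          have hLM' : finrank K ↥(L ⊔ M') = finrank K L + 1 := by
            apply finrank_sup_of_mem_linesThrough hP hPL (B₀ := B')
            · exact mem_filter.2 ⟨mem_Gr.2 (by omega), b1, b2.trans inf_le_left⟩
            · exact hBL1'
          have : L ⊔ M' = L ⊔ M := Submodule.eq_of_le_of_finrank_le
            (sup_le le_sup_left (b2.trans inf_le_right)) (by omega)
          calc M ≤ L ⊔ M := le_sup_right
            _ = L ⊔ M' := this.symm
            _ ≤ L ⊔ B' := sup_le_sup_left (b2.trans inf_le_left) _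
        · intro E' _ hE'
          exact hD4 E' (by omega)
      have h3 : ∀ M ∈ linesThrough P B, (#{B ∈ S | L ⊔ M ≤ B} : ℝ) ≤
          2 * q ^ ((e + 1) * (e + 3)) := fun M hM =>
        hD3 _ (by rw [finrank_sup_of_mem_linesThrough hP hPL hM hBL1, hL2])
      have hsub : ({C ∈ S | C ⊓ U = L} : Finset _) ⊆ {C ∈ S | L ≤ C} := by
        intro C hC
        obtain ⟨a1, a2⟩ := mem_filter.1 hC
        exact mem_filter.2 ⟨a1, a2 ▸ inf_le_left⟩
      have h0 : (#{C ∈ S | C ⊓ U = L} : ℝ) ≤ #{C ∈ S | L ≤ C} := by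
        exact_mod_cast card_le_card hsub
      have hc1 : (#{M ∈ linesThrough P B | M ≤ X} : ℝ) ≤ 2 * q ^ 1 := by
        have : ({M ∈ linesThrough P B | M ≤ X} : Finset _) ⊆ linesThrough P X := by
          intro M hM
          obtain ⟨a1, a2⟩ := mem_filter.1 hM
          obtain ⟨b1, b2, b3⟩ := mem_filter.1 a1
          exact mem_filter.2 ⟨b1, b2, a2⟩
        calc _ ≤ (#(linesThrough P X) : ℝ) := by exact_mod_cast card_le_card this
          _ = _ := card_linesThrough hP hPX
          _ ≤ gauss q (1 + 1) 1 := gauss_one_mono hq1 (by omega)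
          _ ≤ _ := by simpa using gauss_le hq 1 1
      have hc2 : (#{M ∈ linesThrough P B | ¬ M ≤ X} : ℝ) ≤ 2 * q ^ (e + 2) := by
        calc _ ≤ (#(linesThrough P B) : ℝ) := by exact_mod_cast card_filter_le _ _
          _ = _ := card_linesThrough hP (hPS B hB)
          _ ≤ _ := by rw [hS B hB]; exact hg
      rw [← sum_filter_add_sum_filter_not _ (fun M => M ≤ X)] at h1
      calc (#{C ∈ S | C ⊓ U = L} : ℝ) ≤ _ := h0.trans h1
        _ ≤ (2 * q ^ 1) * (2 * q ^ ((e + 1) * (e + 3))) +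
            (2 * q ^ (e + 2)) * ((2 * q ^ (e + 2)) * (2 * q ^ (e * (e + 3)))) := by
          apply add_le_add
          · refine (sum_le_card_nsmul _ _ _ (fun M hM => h3 M (mem_filter.1 hM).1)).trans ?_
            rw [nsmul_eq_mul]
            exact mul_le_mul_of_nonneg_right hc1 (by positivity)
          · refine (sum_le_card_nsmul _ _ _ (fun M hM => h2 M (mem_filter.1 hM).1
              (mem_filter.1 hM).2)).trans ?_
            rw [nsmul_eq_mul]
            gcongr
        _ = 4 * q ^ (1 + (e + 1) * (e + 3)) +
            8 * q ^ ((e + 2) + (e + 2) + e * (e + 3)) := by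
          rw [pow_add, pow_add, pow_add]; ring
        _ ≤ 4 * q ^ (e ^ 2 + 5 * e + 4) + 8 * q ^ (e ^ 2 + 5 * e + 4) := by
          have a1 : q ^ (1 + (e + 1) * (e + 3)) ≤ q ^ (e ^ 2 + 5 * e + 4) :=
            pow_le_pow_right₀ hq1.le (by nlinarith)
          have a2 : q ^ ((e + 2) + (e + 2) + e * (e + 3)) ≤ q ^ (e ^ 2 + 5 * e + 4) :=
            pow_le_pow_right₀ hq1.le (by nlinarith)
          linarith
        _ = _ := by ring
    refine hsum.trans ?_
    rw [← Finset.add_sum_erase _ _ hL₁]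
    apply add_le_add (hlineD L₁ hL₁)
    refine (sum_le_card_nsmul _ _ (12 * q ^ (e ^ 2 + 5 * e + 4))
      (fun L hL => hother L (mem_of_mem_erase hL) (ne_of_mem_erase hL))).trans ?_
    rw [nsmul_eq_mul]
    have : (#(𝓛.erase L₁) : ℝ) ≤ #𝓛 := by exact_mod_cast card_le_card (erase_subset _ _)
    calc _ ≤ (#𝓛 : ℝ) * (12 * q ^ (e ^ 2 + 5 * e + 4)) :=
          mul_le_mul_of_nonneg_right this (by positivity)
      _ = _ := by ring
  -- Now all members on L share a subspace of rank 3 through L with one fixed member B₀ on L.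
  · push Not at hpair
    have hall : ∀ L ∈ 𝓛, (#{B ∈ S | B ⊓ U = L} : ℝ) ≤ 12 * q ^ (e ^ 2 + 5 * e + 4) := by
      intro L hL
      obtain ⟨hL2, hPL⟩ := h𝓛 L hL
      rcases ({B ∈ S | B ⊓ U = L} : Finset _).eq_empty_or_nonempty with h0 | ⟨B₀, hB₀⟩
      · rw [h0]; simp; positivity
      obtain ⟨hB₀S, hB₀L⟩ := mem_filter.1 hB₀
      have hLB₀ : L ≤ B₀ := hB₀L ▸ inf_le_left
      have hsub : ({B ∈ S | B ⊓ U = L} : Finset _) ⊆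
          ({E ∈ Gr K V 3 | L ≤ E ∧ E ≤ B₀} : Finset _).biUnion (fun E => {B ∈ S | E ≤ B}) := by
        intro B hB
        obtain ⟨hBS, hBL⟩ := mem_filter.1 hB
        have h3 := hpair L hL B hBS B₀ hB₀S hBL hB₀L
        obtain ⟨E, b1, b2, b3⟩ := exists_between_finrank_succ
          (le_inf (hBL ▸ inf_le_left : L ≤ B) hLB₀) (by omega)
        simp only [mem_biUnion, mem_filter, mem_Gr]
        exact ⟨E, ⟨by omega, b1, b2.trans inf_le_right⟩, hBS, b2.trans inf_le_left⟩
      have h1 : (#{B ∈ S | B ⊓ U = L} : ℝ) ≤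
          ∑ E ∈ Gr K V 3 with L ≤ E ∧ E ≤ B₀, (#{B ∈ S | E ≤ B} : ℝ) := by
        exact_mod_cast (card_le_card hsub).trans card_biUnion_le
      have h2 : (#{E ∈ Gr K V 3 | L ≤ E ∧ E ≤ B₀} : ℝ) ≤ 2 * q ^ (e + 1) := by
        rw [card_Gr_between hLB₀ (by omega), hL2, hS B₀ hB₀S]
        have := gauss_le hq (e + 1) 1
        simpa using this
      calc _ ≤ _ := h1
        _ ≤ (2 * q ^ (e + 1)) * (2 * q ^ ((e + 1) * (e + 3))) := by
          refine (sum_le_card_nsmul _ _ _ (fun E hE =>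
            hD3 E (mem_Gr.1 (mem_filter.1 hE).1))).trans ?_
          rw [nsmul_eq_mul]
          exact mul_le_mul_of_nonneg_right h2 (by positivity)
        _ = 4 * q ^ ((e + 1) + (e + 1) * (e + 3)) := by rw [pow_add]; ring
        _ = 4 * q ^ (e ^ 2 + 5 * e + 4) := by congr 2; ring
        _ ≤ _ := by
          have : 0 < q ^ (e ^ 2 + 5 * e + 4) := by positivity
          linarith
    refine hsum.trans ((sum_le_card_nsmul _ _ _ hall).trans ?_)
    rw [nsmul_eq_mul]
    have : 0 < q ^ (e ^ 2 + 5 * e + 5) := by positivity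
    have h9 : (#𝓛 : ℝ) * (12 * q ^ (e ^ 2 + 5 * e + 4)) = 12 * #𝓛 * q ^ (e ^ 2 + 5 * e + 4) := by
      ring
    linarith

end Intersecting

/-! ### Duality for flags. -/

section Dual

variable {K V : Type*} [Field K] [Finite K] [AddCommGroup V] [Module K V] [Module.Finite K V]

variable (K V) in
/-- An order-reversing bijection of the subspaces that complements ranks. -/
structure Duality where
  toEquiv : Submodule K V ≃ Submodule K V
  le_iff : ∀ A B, toEquiv A ≤ toEquiv B ↔ B ≤ A
  finrank_eq : ∀ A, finrank K (toEquiv A) = finrank K V - finrank K A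

namespace Duality

variable (D : Duality K V)

theorem finrank_symm (A : Submodule K V) :
    finrank K (D.toEquiv.symm A) = finrank K V - finrank K A := by
  have h := D.finrank_eq (D.toEquiv.symm A)
  rw [Equiv.apply_symm_apply] at h
  have := Submodule.finrank_le (D.toEquiv.symm A)
  omega

/-- By the rank condition the disjoint images are complementary; their join, which is the whole
space, lies below the image of A ⊓ B. -/
theorem disjoint_of_disjoint {A B : Submodule K V} (h : finrank K A + finrank K B = finrank K V)
    (hd : Disjoint (D.toEquiv A) (D.toEquiv B)) : Disjoint A B := by
  have hc : IsCompl (D.toEquiv A) (D.toEquiv B) := by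
    rw [Submodule.isCompl_iff_disjoint]
    · exact hd
    · rw [D.finrank_eq, D.finrank_eq]; omega
  rw [disjoint_iff_inf_le]
  have h1 : D.toEquiv A ⊔ D.toEquiv B ≤ D.toEquiv (A ⊓ B) :=
    sup_le ((D.le_iff _ _).2 inf_le_left) ((D.le_iff _ _).2 inf_le_right)
  rw [hc.sup_eq_top, top_le_iff] at h1
  have h2 := D.finrank_eq (A ⊓ B)
  rw [h1, finrank_top] at h2
  have h3 := Submodule.finrank_le A
  have h4 : finrank K ↥(A ⊓ B) ≤ finrank K A := Submodule.finrank_mono inf_le_left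
  rcases Nat.eq_zero_or_pos (finrank K V) with h0 | h0
  · have : finrank K ↥(A ⊓ B) = 0 := by omega
    exact (Submodule.finrank_eq_zero.1 this).le
  · have : finrank K ↥(A ⊓ B) = 0 := by omega
    exact (Submodule.finrank_eq_zero.1 this).le

/-- The dual of a flag. -/
def flag (f : Submodule K V × Submodule K V) : Submodule K V × Submodule K V :=
  (D.toEquiv f.2, D.toEquiv f.1)

/-- The inverse of `Duality.flag`. -/
def flagSymm (f : Submodule K V × Submodule K V) : Submodule K V × Submodule K V :=
  (D.toEquiv.symm f.2, D.toEquiv.symm f.1)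

@[simp] theorem flag_flagSymm (f : Submodule K V × Submodule K V) : D.flag (D.flagSymm f) = f := by
  simp [flag, flagSymm]

@[simp] theorem flagSymm_flag (f : Submodule K V × Submodule K V) : D.flagSymm (D.flag f) = f := by
  simp [flag, flagSymm]

theorem flag_injective : Function.Injective D.flag :=
  Function.LeftInverse.injective D.flagSymm_flag

variable {d : ℕ}

theorem flag_mem (hV : finrank K V = 2 * d + 1) {f : Submodule K V × Submodule K V}
    (hf : f ∈ flags K V d) : D.flag f ∈ flags K V d := by
  obtain ⟨h1, h2, h3⟩ := mem_flags.1 hf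
  exact mem_flags.2 ⟨(D.finrank_eq f.2).trans (by omega), (D.finrank_eq f.1).trans (by omega),
    (D.le_iff _ _).2 h3⟩

theorem flagSymm_mem (hV : finrank K V = 2 * d + 1) {f : Submodule K V × Submodule K V}
    (hf : f ∈ flags K V d) : D.flagSymm f ∈ flags K V d := by
  obtain ⟨h1, h2, h3⟩ := mem_flags.1 hf
  exact mem_flags.2 ⟨(D.finrank_symm f.2).trans (by omega), (D.finrank_symm f.1).trans (by omega),
    (D.le_iff _ _).1 (by simpa [flagSymm] using h3)⟩

theorem numAbove_eq (M : Finset (Submodule K V)) (B : Submodule K V) :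
    numAbove M B = numBelow (M.image D.toEquiv) (D.toEquiv B) := by
  rw [numAbove, numBelow, filter_image, card_image_of_injective _ D.toEquiv.injective]
  simp_rw [D.le_iff]

theorem sum_Gr (hV : finrank K V = 2 * d + 1) (φ : Submodule K V → ℝ) :
    ∑ B ∈ Gr K V (d + 1), φ (D.toEquiv B) = ∑ A ∈ Gr K V d, φ A := by
  apply Finset.sum_bij (fun B _ => D.toEquiv B)
  · intro B hB
    rw [mem_Gr] at hB ⊢
    rw [D.finrank_eq]; omega
  · intro B _ B' _ h
    exact D.toEquiv.injective h
  · intro A hA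
    refine ⟨D.toEquiv.symm A, ?_, by simp⟩
    rw [mem_Gr] at hA ⊢
    rw [D.finrank_symm]; omega
  · simp

theorem image_subset_Gr (hV : finrank K V = 2 * d + 1) {M : Finset (Submodule K V)}
    (hM : M ⊆ Gr K V (2 * d)) : M.image D.toEquiv ⊆ Gr K V 1 := by
  intro A hA
  obtain ⟨H, hH, rfl⟩ := mem_image.1 hA
  have := mem_Gr.1 (hM hH)
  rw [mem_Gr, D.finrank_eq]; omega

end Duality

variable (K V) in
theorem nonempty_duality : Nonempty (Duality K V) := by
  obtain ⟨e, h1, h2⟩ := exists_duality K V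
  exact ⟨⟨e, h1, h2⟩⟩

/-- Two flags of type `{d, d + 1}` in rank `2 * d + 1` are opposite if they are in general
position. -/
def OppositeFlags (f g : Submodule K V × Submodule K V) : Prop :=
  Disjoint f.1 g.2 ∧ Disjoint g.1 f.2

theorem Duality.opposite_of_opposite (D : Duality K V) {d : ℕ} (hV : finrank K V = 2 * d + 1)
    {f g : Submodule K V × Submodule K V} (hf : f ∈ flags K V d) (hg : g ∈ flags K V d)
    (h : OppositeFlags (D.flag f) (D.flag g)) : OppositeFlags f g := by
  obtain ⟨a1, a2, -⟩ := mem_flags.1 hf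
  obtain ⟨b1, b2, -⟩ := mem_flags.1 hg
  exact ⟨D.disjoint_of_disjoint (by omega) h.2.symm,
    D.disjoint_of_disjoint (by omega) h.1.symm⟩

end Dual

/-! ### Covers of the flags and the flags outside their pencils. -/

section Cover

variable {K V : Type*} [Field K] [Finite K] [AddCommGroup V] [Module K V] [Module.Finite K V]

/-- A cover of the flags by independent sets that contain a point-pencil, independent sets that
contain a dual point-pencil, and small sets. -/
structure FlagCover (K V : Type*) [Field K] [Finite K] [AddCommGroup V] [Module K V]
    [Module.Finite K V] (d : ℕ) (α : ℝ) (ι₁ ι₂ ι₃ : Type*) where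
  C₁ : ι₁ → Finset (Submodule K V × Submodule K V)
  C₂ : ι₂ → Finset (Submodule K V × Submodule K V)
  C₃ : ι₃ → Finset (Submodule K V × Submodule K V)
  P : ι₁ → Submodule K V
  H : ι₂ → Submodule K V
  finrank_P : ∀ i, finrank K (P i) = 1
  finrank_H : ∀ i, finrank K (H i) = 2 * d
  subset₁ : ∀ i, C₁ i ⊆ flags K V d
  subset₂ : ∀ i, C₂ i ⊆ flags K V d
  indep₁ : ∀ i, ∀ f ∈ C₁ i, ∀ g ∈ C₁ i, ¬ OppositeFlags f g
  indep₂ : ∀ i, ∀ f ∈ C₂ i, ∀ g ∈ C₂ i, ¬ OppositeFlags f g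
  pencil_mem : ∀ i, ∀ f ∈ flags K V d, P i ≤ f.1 → f ∈ C₁ i
  dual_mem : ∀ i, ∀ f ∈ flags K V d, f.2 ≤ H i → f ∈ C₂ i
  card_le : ∀ i, (#(C₃ i) : ℝ) ≤ α * (Nat.card K : ℝ) ^ (d ^ 2 + d - 2)
  cover : ∀ f ∈ flags K V d, (∃ i, f ∈ C₁ i) ∨ (∃ i, f ∈ C₂ i) ∨ ∃ i, f ∈ C₃ i

namespace FlagCover

variable {d : ℕ} {α : ℝ} {ι₁ ι₂ ι₃ : Type*}

/-- The dual cover. -/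
noncomputable def dual (c : FlagCover K V d α ι₁ ι₂ ι₃) (D : Duality K V)
    (hV : finrank K V = 2 * d + 1) : FlagCover K V d α ι₂ ι₁ ι₃ where
  C₁ i := (c.C₂ i).image D.flag
  C₂ i := (c.C₁ i).image D.flag
  C₃ i := (c.C₃ i).image D.flag
  P i := D.toEquiv (c.H i)
  H i := D.toEquiv (c.P i)
  finrank_P i := by rw [D.finrank_eq, c.finrank_H]; omega
  finrank_H i := by rw [D.finrank_eq, c.finrank_P]; omega
  subset₁ i := by
    intro f hf
    obtain ⟨g, hg, rfl⟩ := mem_image.1 hf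
    exact D.flag_mem hV (c.subset₂ i hg)
  subset₂ i := by
    intro f hf
    obtain ⟨g, hg, rfl⟩ := mem_image.1 hf
    exact D.flag_mem hV (c.subset₁ i hg)
  indep₁ i := by
    intro f hf g hg h
    obtain ⟨f, hf', rfl⟩ := mem_image.1 hf
    obtain ⟨g, hg', rfl⟩ := mem_image.1 hg
    exact c.indep₂ i f hf' g hg'
      (D.opposite_of_opposite hV (c.subset₂ i hf') (c.subset₂ i hg') h)
  indep₂ i := by
    intro f hf g hg h
    obtain ⟨f, hf', rfl⟩ := mem_image.1 hf
    obtain ⟨g, hg', rfl⟩ := mem_image.1 hg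
    exact c.indep₁ i f hf' g hg'
      (D.opposite_of_opposite hV (c.subset₁ i hf') (c.subset₁ i hg') h)
  pencil_mem i f hf h := by
    refine mem_image.2 ⟨D.flagSymm f, c.dual_mem i _ (D.flagSymm_mem hV hf) ?_, by simp⟩
    rw [← D.le_iff]
    simpa [Duality.flagSymm] using h
  dual_mem i f hf h := by
    refine mem_image.2 ⟨D.flagSymm f, c.pencil_mem i _ (D.flagSymm_mem hV hf) ?_, by simp⟩
    rw [← D.le_iff]
    simpa [Duality.flagSymm] using h
  card_le i := by
    rw [card_image_of_injective _ D.flag_injective]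
    exact c.card_le i
  cover f hf := by
    have key : ∀ S : Finset (Submodule K V × Submodule K V), D.flagSymm f ∈ S →
        f ∈ S.image D.flag := fun S h => mem_image.2 ⟨_, h, by simp⟩
    rcases c.cover _ (D.flagSymm_mem hV hf) with ⟨i, hi⟩ | ⟨i, hi⟩ | ⟨i, hi⟩
    · exact Or.inr (Or.inl ⟨i, key _ hi⟩)
    · exact Or.inl ⟨i, key _ hi⟩
    · exact Or.inr (Or.inr ⟨i, key _ hi⟩)

variable (c : FlagCover K V d α ι₁ ι₂ ι₃)

/-- If P were not in B, one could choose a complement A' of B through P and a complement B' of A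
above A'. The flag (A', B') is in the pencil of P and opposite to (A, B). -/
theorem P_le_snd (hV : finrank K V = 2 * d + 1) {i : ι₁} {f : Submodule K V × Submodule K V}
    (hf : f ∈ c.C₁ i) : c.P i ≤ f.2 := by
  by_contra hcon
  obtain ⟨h1, h2, h3⟩ := mem_flags.1 (c.subset₁ i hf)
  have hdis : Disjoint (c.P i) f.2 := by
    rw [disjoint_iff, ← Submodule.finrank_eq_zero (R := K)]
    have h4 := finrank_sup_point (c.finrank_P i) hcon
    have h5 := Submodule.finrank_sup_add_finrank_inf_eq f.2 (c.P i)
    have h6 := c.finrank_P i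
    rw [inf_comm]
    omega
  obtain ⟨A', hA', hc⟩ := hdis.exists_isCompl
  have hdis2 : Disjoint A' f.1 := hc.disjoint.mono_right h3
  obtain ⟨B', hB', hc'⟩ := hdis2.exists_isCompl
  have r1 := Submodule.finrank_add_eq_of_isCompl hc
  have r2 := Submodule.finrank_add_eq_of_isCompl hc'
  have hfl : (A', B') ∈ flags K V d := mem_flags.2 ⟨by simp only; omega, by simp only; omega, hB'⟩
  exact c.indep₁ i f hf _ (c.pencil_mem i _ hfl hA') ⟨hc'.disjoint.symm, hc.disjoint⟩

/-- The flags of a member of the cover that are not in the point-pencil. -/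
noncomputable def extra (i : ι₁) : Finset (Submodule K V × Submodule K V) :=
  {f ∈ c.C₁ i | ¬ c.P i ≤ f.1}

/-- Both members of rank d+1 contain P. If they met only in P, then the intersections with the
members of rank d, which avoid P, would be trivial and the flags opposite. -/
theorem two_le_finrank_inf (hV : finrank K V = 2 * d + 1) {i : ι₁}
    {f g : Submodule K V × Submodule K V} (hf : f ∈ c.extra i) (hg : g ∈ c.extra i) :
    2 ≤ finrank K ↥(f.2 ⊓ g.2) := by
  obtain ⟨f1, f2⟩ := mem_filter.1 hf
  obtain ⟨g1, g2⟩ := mem_filter.1 hg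
  by_contra hcon
  have hP := c.finrank_P i
  have heq := eq_inf_of_finrank_le_one hP (c.P_le_snd hV f1) (c.P_le_snd hV g1) (by omega)
  have key : ∀ A X : Submodule K V, A ⊓ X ≤ c.P i → ¬ c.P i ≤ A → Disjoint A X := by
    intro A X h h'
    rw [disjoint_iff, ← Submodule.finrank_eq_zero (R := K)]
    by_contra h0
    have : A ⊓ X = c.P i := Submodule.eq_of_le_of_finrank_le h (by omega)
    exact h' (this ▸ inf_le_left)
  have hf3 := (mem_flags.1 (c.subset₁ i f1)).2.2
  have hg3 := (mem_flags.1 (c.subset₁ i g1)).2.2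
  apply c.indep₁ i f f1 g g1
  refine ⟨key _ _ ?_ f2, key _ _ ?_ g2⟩
  · rw [← heq]; exact inf_le_inf_right _ hf3
  · rw [← heq, inf_comm f.2]; exact inf_le_inf_right _ hg3

/-- The members of rank d+1 form an intersecting family through P, and each belongs to at most
`gauss q (d + 1) 1` flags. -/
theorem card_extra_le (hd : 3 ≤ d) (hV : finrank K V = 2 * d + 1) (hq : 3 ≤ (Nat.card K : ℝ))
    (i : ι₁) : (#(c.extra i) : ℝ) ≤
      16 * (Nat.card K : ℝ) ^ (d ^ 2 - 3) * gauss (Nat.card K) (d + 1) 1 := by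
  have hsub : c.extra i ⊆ flags K V d := fun f hf => c.subset₁ i (mem_filter.1 hf).1
  set S := (c.extra i).image Prod.snd with hS
  have h1 : (#S : ℝ) ≤ 16 * (Nat.card K : ℝ) ^ (d ^ 2 - 3) := by
    apply card_intersecting_le hd hV hq (c.finrank_P i)
    · intro B hB
      obtain ⟨f, hf, rfl⟩ := mem_image.1 hB
      exact (mem_flags.1 (hsub hf)).2.1
    · intro B hB
      obtain ⟨f, hf, rfl⟩ := mem_image.1 hB
      exact c.P_le_snd hV (mem_filter.1 hf).1
    · intro B hB B' hB'
      obtain ⟨f, hf, rfl⟩ := mem_image.1 hB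
      obtain ⟨g, hg, rfl⟩ := mem_image.1 hB'
      exact c.two_le_finrank_inf hV hf hg
  have h2 : (#(c.extra i) : ℝ) = ∑ B ∈ S, (#{f ∈ c.extra i | f.2 = B} : ℝ) := by
    have := Finset.card_eq_sum_card_fiberwise (f := Prod.snd) (s := c.extra i) (t := S)
      (fun f hf => mem_image_of_mem _ hf)
    exact_mod_cast this
  rw [h2]
  refine (sum_le_card_nsmul _ _ (gauss (Nat.card K) (d + 1) 1) ?_).trans ?_
  · intro B hB
    have hBr : finrank K B = d + 1 := by
      obtain ⟨f, hf, rfl⟩ := mem_image.1 hB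
      exact (mem_flags.1 (hsub hf)).2.1
    rw [← card_flags_filter_snd (V := V) hBr]
    exact_mod_cast card_le_card (filter_subset_filter _ hsub)
  · rw [nsmul_eq_mul]
    exact mul_le_mul_of_nonneg_right h1 (gauss_nonneg one_lt_natCard_real _ _)

/-- The flags of a member of the cover that are not in the dual point-pencil. -/
noncomputable def dualExtra (i : ι₂) : Finset (Submodule K V × Submodule K V) :=
  {f ∈ c.C₂ i | ¬ f.2 ≤ c.H i}

theorem card_dualExtra_le (hd : 3 ≤ d) (hV : finrank K V = 2 * d + 1)
    (hq : 3 ≤ (Nat.card K : ℝ)) (i : ι₂) : (#(c.dualExtra i) : ℝ) ≤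
      16 * (Nat.card K : ℝ) ^ (d ^ 2 - 3) * gauss (Nat.card K) (d + 1) 1 := by
  obtain ⟨D⟩ := nonempty_duality K V
  have h := (c.dual D hV).card_extra_le hd hV hq i
  have : (c.dual D hV).extra i = (c.dualExtra i).image D.flag := by
    rw [extra, dualExtra]
    change ({f ∈ (c.C₂ i).image D.flag | ¬ D.toEquiv (c.H i) ≤ f.1} : Finset _) = _
    rw [filter_image]
    congr 2
    ext f
    simp only [Duality.flag, D.le_iff]
  rwa [this, card_image_of_injective _ D.flag_injective] at h

section Budget

variable [Fintype ι₁] [Fintype ι₂] [Fintype ι₃]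

/-- The points of the point-pencils of the cover. -/
noncomputable def points : Finset (Submodule K V) := univ.image c.P

/-- The hyperplanes of the dual point-pencils of the cover. -/
noncomputable def hyperplanes : Finset (Submodule K V) := univ.image c.H

theorem points_subset : c.points ⊆ Gr K V 1 := by
  intro P hP
  obtain ⟨i, -, rfl⟩ := mem_image.1 hP
  exact mem_Gr.2 (c.finrank_P i)

theorem hyperplanes_subset : c.hyperplanes ⊆ Gr K V (2 * d) := by
  intro P hP
  obtain ⟨i, -, rfl⟩ := mem_image.1 hP
  exact mem_Gr.2 (c.finrank_H i)

theorem card_points_le : #c.points ≤ Fintype.card ι₁ := card_image_le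

theorem card_hyperplanes_le : #c.hyperplanes ≤ Fintype.card ι₂ := card_image_le

/-- Every flag is in a point-pencil or in a dual point-pencil or exceptional. -/
theorem mem_cases {f : Submodule K V × Submodule K V} (hf : f ∈ flags K V d) :
    (∃ P ∈ c.points, P ≤ f.1) ∨ (∃ H ∈ c.hyperplanes, f.2 ≤ H) ∨ (∃ i, f ∈ c.extra i) ∨
      (∃ i, f ∈ c.dualExtra i) ∨ ∃ i, f ∈ c.C₃ i := by
  rcases c.cover f hf with ⟨i, hi⟩ | ⟨i, hi⟩ | ⟨i, hi⟩
  · by_cases h : c.P i ≤ f.1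
    · exact Or.inl ⟨_, mem_image_of_mem _ (mem_univ i), h⟩
    · exact Or.inr (Or.inr (Or.inl ⟨i, mem_filter.2 ⟨hi, h⟩⟩))
  · by_cases h : f.2 ≤ c.H i
    · exact Or.inr (Or.inl ⟨_, mem_image_of_mem _ (mem_univ i), h⟩)
    · exact Or.inr (Or.inr (Or.inr (Or.inl ⟨i, mem_filter.2 ⟨hi, h⟩⟩)))
  · exact Or.inr (Or.inr (Or.inr (Or.inr ⟨i, hi⟩)))

/-- A flag with no pencil point and no pencil hyperplane can only be covered as an extra flag or by
a small set. This bounds the term z of the budget. -/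
theorem card_uncovered_le (hd : 3 ≤ d) (hV : finrank K V = 2 * d + 1)
    (hq : 3 ≤ (Nat.card K : ℝ)) :
    (#{f ∈ flags K V d | numBelow c.points f.1 = 0 ∧ numAbove c.hyperplanes f.2 = 0} : ℝ) ≤
      ((Fintype.card ι₁ : ℝ) + Fintype.card ι₂) *
        (16 * (Nat.card K : ℝ) ^ (d ^ 2 - 3) * gauss (Nat.card K) (d + 1) 1) +
      Fintype.card ι₃ * (α * (Nat.card K : ℝ) ^ (d ^ 2 + d - 2)) := by
  have hsub : ({f ∈ flags K V d | numBelow c.points f.1 = 0 ∧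
      numAbove c.hyperplanes f.2 = 0} : Finset _) ⊆
      (univ.biUnion c.extra ∪ univ.biUnion c.dualExtra) ∪ univ.biUnion c.C₃ := by
    intro f hf
    obtain ⟨h1, h2, h3⟩ := mem_filter.1 hf
    simp only [mem_union, mem_biUnion, mem_univ, true_and]
    rcases c.mem_cases h1 with ⟨P, hP, h⟩ | ⟨H, hH, h⟩ | h | h | h
    · rw [numBelow, card_eq_zero] at h2
      exact absurd (mem_filter.2 ⟨hP, h⟩ : P ∈ filter (fun P => P ≤ f.1) c.points)
        (by rw [h2]; simp)
    · rw [numAbove, card_eq_zero] at h3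
      exact absurd (mem_filter.2 ⟨hH, h⟩ : H ∈ filter (fun H => f.2 ≤ H) c.hyperplanes)
        (by rw [h3]; simp)
    · exact Or.inl (Or.inl h)
    · exact Or.inl (Or.inr h)
    · exact Or.inr h
  have h1 := (card_le_card hsub).trans ((card_union_le _ _).trans (add_le_add
    ((card_union_le _ _).trans (add_le_add card_biUnion_le card_biUnion_le)) card_biUnion_le))
  have h2 : (#{f ∈ flags K V d | numBelow c.points f.1 = 0 ∧
      numAbove c.hyperplanes f.2 = 0} : ℝ) ≤ ∑ i, (#(c.extra i) : ℝ) +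
      ∑ i, (#(c.dualExtra i) : ℝ) + ∑ i, (#(c.C₃ i) : ℝ) := by exact_mod_cast h1
  refine h2.trans ?_
  rw [add_mul]
  refine add_le_add (add_le_add ?_ ?_) ?_
  · refine (sum_le_card_nsmul _ _ _ (fun i _ => c.card_extra_le hd hV hq i)).trans ?_
    rw [nsmul_eq_mul, card_univ]
  · refine (sum_le_card_nsmul _ _ _ (fun i _ => c.card_dualExtra_le hd hV hq i)).trans ?_
    rw [nsmul_eq_mul, card_univ]
  · refine (sum_le_card_nsmul _ _ _ (fun i _ => c.card_le i)).trans ?_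
    rw [nsmul_eq_mul, card_univ]

end Budget

end FlagCover

end Cover

/-! ### The budget inequalities: one of the two sides is negligible. -/

section RealEstimates

/-- The consequences of the counting inequalities for a cover, with normalized quantities: `m` and
`h` are the expected numbers of points in and of hyperplanes through a flag. -/
theorem cover_estimates {D α u n m h σ j z τ₁ τ₂ : ℝ} (hD : 3 ≤ D) (hα : 5 ≤ α) (hu : 0 < u)
    (hsmall : D * α * u ≤ 1 / 10 ^ 6) (hn : n ≤ 1 + u + 2 * u ^ 2)
    (hh0 : 0 ≤ h) (hσ0 : 0 ≤ σ) (hj0 : 0 ≤ j) (hτ₁0 : 0 ≤ τ₁)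
    (hτ₂0 : 0 ≤ τ₂) (h1 : j + τ₁ + τ₂ + 1 = m + h + z) (h2 : z ≤ 16 * u ^ 2 * n + σ * (α * u))
    (h3 : m + h + σ ≤ n) (h4 : u * (m ^ 2 - 3 * u ^ 2) ≤ τ₁ * (1 + 3 * u))
    (h5 : u * (h ^ 2 - 3 * u ^ 2) ≤ τ₂ * (1 + 3 * u))
    (h6 : (h - τ₂) * (m - τ₁ - 2 * u) ≤ (2 * D + 1) * (j + z)) (hmh : h ≤ m) :
    h ≤ 100 * (D * α) * u ^ 2 ∧ 1 - u ≤ m ∧ τ₁ ≤ u + 20 * u ^ 2 := by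
  have hDα : 15 ≤ D * α := by
    have := mul_le_mul hD hα (by norm_num) (by linarith)
    linarith
  have hu7 : u ≤ 1 / 10 ^ 7 := by
    have := mul_le_mul_of_nonneg_right hDα hu.le
    linarith
  have hαu : α * u ≤ 1 / 10 ^ 6 := by
    have := mul_le_mul_of_nonneg_right hD (mul_nonneg (show 0 ≤ α by linarith) hu.le)
    have h0 := mul_nonneg (show 0 ≤ α by linarith) hu.le
    linarith
  have hDu : D * u ≤ 1 / 10 ^ 6 := by
    have := mul_le_mul_of_nonneg_right hα (mul_nonneg (show 0 ≤ D by linarith) hu.le)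
    have h0 := mul_nonneg (show 0 ≤ D by linarith) hu.le
    linarith
  have hαu0 : 0 < α * u := mul_pos (by linarith) hu
  have hu2 : 0 < u ^ 2 := by positivity
  have huu : u ^ 2 ≤ u / 10 ^ 7 := by
    have := mul_le_mul_of_nonneg_right hu7 hu.le
    linarith
  have hn' : n ≤ 11 / 10 := by linarith
  have hun : u ^ 2 * n ≤ u ^ 2 * (11 / 10) := mul_le_mul_of_nonneg_left hn' hu2.le
  have hσα : σ * (α * u) ≤ σ * (1 / 10 ^ 6) := mul_le_mul_of_nonneg_left hαu hσ0
  -- The covered proportion is at least 1 - z, while m + h ≤ n - σ; so σ is at most the surplus of n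
  -- over 1, up to z.
  have hσ : σ ≤ 2 * u := by linarith
  have hσα' : σ * (α * u) ≤ 2 * u * (α * u) := mul_le_mul_of_nonneg_right hσ hαu0.le
  have hαu2 : 5 * u ^ 2 ≤ α * u ^ 2 := mul_le_mul_of_nonneg_right hα hu2.le
  have hz : z ≤ 6 * (α * u ^ 2) := by linarith
  -- The whole waste is bounded by the surplus of n over 1, to first order u.
  have hB : j + τ₁ + τ₂ ≤ u + 20 * u ^ 2 := by linarith
  have hm1 : m ≤ 11 / 10 := by linarith
  -- lower bounds for the superfluous incidences
  have hu3 : u * u ^ 2 ≤ u ^ 2 / 10 ^ 7 := by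
    have := mul_le_mul_of_nonneg_right hu7 hu2.le
    linarith
  have aux : ∀ x τ : ℝ, 0 ≤ τ → τ ≤ 2 * u → u * (x ^ 2 - 3 * u ^ 2) ≤ τ * (1 + 3 * u) →
      u * x ^ 2 - 7 * u ^ 2 ≤ τ := by
    intro x τ h0 h1 h2
    have a1 : τ * (3 * u) ≤ 2 * u * (3 * u) := mul_le_mul_of_nonneg_right h1 (by positivity)
    linarith
  have hτ₁ := aux m τ₁ hτ₁0 (by linarith) h4
  have hτ₂ := aux h τ₂ hτ₂0 (by linarith) h5
  have hαu2' : α * u ^ 2 = (α * u) * u := by ring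
  have hαu2s : α * u ^ 2 ≤ u / 10 ^ 6 := by
    have := mul_le_mul_of_nonneg_right hαu hu.le
    linarith
  have hmh1 : 1 - 6 * (α * u ^ 2) ≤ m + h := by linarith
  have hsq : 1 - 12 * (α * u ^ 2) ≤ (m + h) ^ 2 := by
    have := sq_nonneg (m + h - 1)
    linarith
  -- The waste on each side is at least about u·m² and u·h². Since (m + h)² is nearly 1, what
  -- remains for j is about 2u·m·h.
  have hj : j ≤ 3 * u * h + 35 * u ^ 2 := by
    have e : m ^ 2 + h ^ 2 = (m + h) ^ 2 - 2 * m * h := by ring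
    have h7 : j ≤ u + 20 * u ^ 2 - u * (m ^ 2 + h ^ 2) + 14 * u ^ 2 := by linarith
    rw [e] at h7
    have h8 : u * (1 - 12 * (α * u ^ 2)) ≤ u * (m + h) ^ 2 := mul_le_mul_of_nonneg_left hsq hu.le
    have h9 : u * (α * u ^ 2) ≤ u * (u / 10 ^ 6) := mul_le_mul_of_nonneg_left hαu2s hu.le
    have h10 : u * h * m ≤ u * h * (11 / 10) := mul_le_mul_of_nonneg_left hm1 (by positivity)
    have h11 := mul_nonneg hu.le hh0
    linarith
  have hma : 48 / 100 ≤ m - τ₁ - 2 * u := by linarith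
  -- The mixing inequality. As h ≤ m and m + h is nearly 1, the factor of m is at least 0.48, so h
  -- is bounded by a small multiple of itself plus a term of order D·α·u².
  have hb : (h - τ₂) * (48 / 100) ≤ (2 * D + 1) * (3 * u * h + 13 * (α * u ^ 2)) := by
    by_cases hneg : h - τ₂ ≤ 0
    · have : 0 ≤ (2 * D + 1) * (3 * u * h + 13 * (α * u ^ 2)) := by positivity
      linarith
    · push Not at hneg
      calc (h - τ₂) * (48 / 100) ≤ (h - τ₂) * (m - τ₁ - 2 * u) :=
            mul_le_mul_of_nonneg_left hma hneg.le
        _ ≤ _ := h6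
        _ ≤ _ := mul_le_mul_of_nonneg_left (by linarith) (by linarith)
  have hmsq : 1 - 12 * (α * u ^ 2) - 2 * h ≤ m ^ 2 := by
    have := sq_nonneg (m - 1)
    linarith
  have hτ₂' : τ₂ ≤ 3 * u * h + 28 * u ^ 2 := by
    have h8 : u * (1 - 12 * (α * u ^ 2) - 2 * h) ≤ u * m ^ 2 :=
      mul_le_mul_of_nonneg_left hmsq hu.le
    have h9 : u * (α * u ^ 2) ≤ u * (u / 10 ^ 6) := mul_le_mul_of_nonneg_left hαu2s hu.le
    have h11 := mul_nonneg hu.le hh0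
    linarith
  have hh : h ≤ 100 * (D * α) * u ^ 2 := by
    have e1 : (2 * D + 1) * (3 * u * h + 13 * (α * u ^ 2)) ≤
        (7 / 3 * D) * (3 * u * h + 13 * (α * u ^ 2)) :=
      mul_le_mul_of_nonneg_right (by linarith) (by positivity)
    have e2 : D * u * h ≤ 1 / 10 ^ 6 * h := mul_le_mul_of_nonneg_right hDu hh0
    have e3 : u * h ≤ 1 / 10 ^ 7 * h := mul_le_mul_of_nonneg_right hu7 hh0
    have e4 : 15 * u ^ 2 ≤ D * α * u ^ 2 := mul_le_mul_of_nonneg_right hDα hu2.le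
    linarith
  refine ⟨hh, ?_, by linarith⟩
  have e5 : D * α * u ^ 2 ≤ u / 10 ^ 6 := by
    have : D * α * u ^ 2 = D * α * u * u := by ring
    have h0 := mul_le_mul_of_nonneg_right hsmall hu.le
    linarith
  linarith

end RealEstimates

/-! ### Quotients of consecutive Gaussian coefficients. -/

section GaussRatio

theorem gauss_ratio {q : ℝ} (hq : 1 < q) (n r : ℕ) :
    gauss q n r = (q ^ (r + 1) - 1) / (q ^ (n + 1) - 1) * gauss q (n + 1) (r + 1) := by
  have h1 : q ^ (n + 1) - 1 ≠ 0 := (sub_pos.2 (one_lt_pow₀ hq (by omega))).ne'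
  have h2 : q ^ (r + 1) - 1 ≠ 0 := (sub_pos.2 (one_lt_pow₀ hq (by omega))).ne'
  rw [gauss_succ_succ]
  field_simp

theorem ratio_le {q : ℝ} (hq : 1 < q) (a b : ℕ) :
    (q ^ (a + 1) - 1) / (q ^ (a + 1 + b) - 1) * q ^ b ≤ 1 := by
  have h1 : 0 < q ^ (a + 1 + b) - 1 := sub_pos.2 (one_lt_pow₀ hq (by omega))
  rw [div_mul_eq_mul_div, div_le_one h1, sub_mul, ← pow_add]
  have := one_le_pow₀ (n := b) hq.le
  linarith

theorem le_ratio {q : ℝ} (hq : 1 < q) (a b : ℕ) :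
    1 - q⁻¹ ^ 2 ≤ (q ^ (a + 2) - 1) / (q ^ (a + 2 + b) - 1) * q ^ b := by
  have h1 : 0 < q ^ (a + 2 + b) - 1 := sub_pos.2 (one_lt_pow₀ hq (by omega))
  rw [div_mul_eq_mul_div, le_div_iff₀ h1, sub_mul, sub_mul, one_mul, one_mul, ← pow_add, mul_sub]
  have h0 : 0 < q := by linarith
  have h2 : q⁻¹ ^ 2 * q ^ (a + 2 + b) = q ^ (a + b) := by
    rw [show a + 2 + b = 2 + (a + b) by omega, pow_add, ← mul_assoc, ← mul_pow,
      inv_mul_cancel₀ h0.ne', one_pow, one_mul]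
  have h3 : q ^ b ≤ q ^ (a + b) := pow_le_pow_right₀ hq.le (by omega)
  have h4 : q⁻¹ ^ 2 ≤ 1 := pow_le_one₀ (by positivity) (inv_le_one_of_one_le₀ hq.le)
  rw [h2]
  linarith

end GaussRatio

/-! ### Normalized lower bound for superfluous incidences. -/

section Superfluous

variable {K V : Type*} [Field K] [Finite K] [AddCommGroup V] [Module K V] [Module.Finite K V]

/-- The probability that a random subspace of rank `d` contains a given point. -/
noncomputable def pointProb (q : ℝ) (d : ℕ) : ℝ := (q ^ d - 1) / (q ^ (2 * d + 1) - 1)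

variable {q : ℝ} {d : ℕ}

theorem pointProb_pos (hq : 1 < q) (hd : 1 ≤ d) : 0 < pointProb q d :=
  div_pos (sub_pos.2 (one_lt_pow₀ hq (by omega))) (sub_pos.2 (one_lt_pow₀ hq (by omega)))

theorem pointProb_mul_le (hq : 1 < q) (hd : 1 ≤ d) : pointProb q d * q ^ (d + 1) ≤ 1 := by
  obtain ⟨e, rfl⟩ : ∃ e, d = e + 1 := ⟨d - 1, by omega⟩
  have := ratio_le hq e (e + 1 + 1)
  rwa [show e + 1 + (e + 1 + 1) = 2 * (e + 1) + 1 by omega] at this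

theorem le_pointProb_mul (hq : 1 < q) (hd : 2 ≤ d) :
    1 - q⁻¹ ^ 2 ≤ pointProb q d * q ^ (d + 1) := by
  obtain ⟨e, rfl⟩ : ∃ e, d = e + 2 := ⟨d - 2, by omega⟩
  have := le_ratio hq e (e + 2 + 1)
  rwa [show e + 2 + (e + 2 + 1) = 2 * (e + 2) + 1 by omega] at this

theorem gauss_eq_pointProb_mul (hq : 1 < q) (hd : 1 ≤ d) :
    gauss q (2 * d) (d - 1) = pointProb q d * gauss q (2 * d + 1) d := by
  obtain ⟨e, rfl⟩ : ∃ e, d = e + 1 := ⟨d - 1, by omega⟩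
  exact gauss_ratio hq _ _

theorem gauss_two_pos (hq : 1 < q) (hd : 2 ≤ d) : 0 < gauss q (2 * d - 1) (d - 2) := by
  have := pow_le_gauss hq (d + 1) (d - 2)
  rw [show d + 1 + (d - 2) = 2 * d - 1 by omega] at this
  exact lt_of_lt_of_le (pow_pos (by linarith) _) this

theorem gauss_two_bounds (hq : 1 < q) (hd : 3 ≤ d) :
    (1 - q⁻¹ ^ 2) * gauss q (2 * d) (d - 1) ≤ gauss q (2 * d - 1) (d - 2) * q ^ (d + 1) ∧
      gauss q (2 * d - 1) (d - 2) * q ^ (d + 1) ≤ gauss q (2 * d) (d - 1) := by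
  obtain ⟨e, rfl⟩ : ∃ e, d = e + 3 := ⟨d - 3, by omega⟩
  have h0 := gauss_nonneg hq (2 * (e + 3)) (e + 2)
  have h1 : gauss q (2 * (e + 3) - 1) (e + 1) =
    (q ^ (e + 2) - 1) / (q ^ (2 * (e + 3)) - 1) * gauss q (2 * (e + 3)) (e + 2) :=
    gauss_ratio hq (2 * e + 5) (e + 1)
  have h2 := ratio_le hq (e + 1) (e + 4)
  have h3 := le_ratio hq e (e + 4)
  rw [show e + 1 + 1 + (e + 4) = 2 * (e + 3) by omega, show e + 1 + 1 = e + 2 by omega] at h2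
  rw [show e + 2 + (e + 4) = 2 * (e + 3) by omega] at h3
  change _ * gauss q (2 * (e + 3)) (e + 2) ≤ gauss q (2 * (e + 3) - 1) (e + 1) * q ^ (e + 4) ∧
    gauss q (2 * (e + 3) - 1) (e + 1) * q ^ (e + 4) ≤ gauss q (2 * (e + 3)) (e + 2)
  rw [h1, mul_right_comm]
  exact ⟨mul_le_mul_of_nonneg_right h3 h0, mul_le_of_le_one_left h0 h2⟩

theorem gauss_three_le (hq : 1 < q) (hd : 3 ≤ d) :
    gauss q (2 * d - 2) (d - 3) * q ^ (d + 1) ≤ gauss q (2 * d - 1) (d - 2) := by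
  obtain ⟨e, rfl⟩ : ∃ e, d = e + 3 := ⟨d - 3, by omega⟩
  have h0 := gauss_nonneg hq (2 * (e + 3) - 1) (e + 1)
  have h1 : gauss q (2 * (e + 3) - 2) e =
    (q ^ (e + 1) - 1) / (q ^ (2 * (e + 3) - 1) - 1) * gauss q (2 * (e + 3) - 1) (e + 1) :=
    gauss_ratio hq (2 * e + 4) e
  have h2 := ratio_le hq e (e + 4)
  rw [show e + 1 + (e + 4) = 2 * (e + 3) - 1 by omega] at h2
  change gauss q (2 * (e + 3) - 2) e * q ^ (e + 4) ≤ gauss q (2 * (e + 3) - 1) (e + 1)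
  rw [h1, mul_right_comm]
  exact mul_le_of_le_one_left h0 h2

/-- The number of points in terms of the expected number of points, bounded above. -/
theorem card_le_of_mul_pointProb_le (hq : 2 ≤ q) (hd : 2 ≤ d) {x t : ℝ} (hx : 0 ≤ x)
    (h : x * pointProb q d ≤ t) : x * (1 - q⁻¹ ^ 2) ≤ t * q ^ (d + 1) := by
  have h1 := le_pointProb_mul (show 1 < q by linarith) hd
  calc x * (1 - q⁻¹ ^ 2) ≤ x * (pointProb q d * q ^ (d + 1)) := mul_le_mul_of_nonneg_left h1 hx
    _ = x * pointProb q d * q ^ (d + 1) := by ring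
    _ ≤ _ := mul_le_mul_of_nonneg_right h (by positivity)

/-- The number of superfluous incidences is at least that of a subspace of the same size. -/
theorem superfluous_ge (hd : 3 ≤ d) (hV : finrank K V = 2 * d + 1)
    (hq : 100 ≤ (Nat.card K : ℝ)) {M : Finset (Submodule K V)} (hM : M ⊆ Gr K V 1)
    (hx : #M * pointProb (Nat.card K) d ≤ 11 / 10) :
    (Nat.card K : ℝ)⁻¹ * ((#M * pointProb (Nat.card K) d) ^ 2 - 3 * (Nat.card K : ℝ)⁻¹ ^ 2) ≤
      (∑ A ∈ Gr K V d, ((numBelow M A - 1 : ℕ) : ℝ)) / gauss (Nat.card K) (2 * d + 1) d *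
        (1 + 3 * (Nat.card K : ℝ)⁻¹) := by
  set q : ℝ := (Nat.card K : ℝ) with hqdef
  have hq1 : 1 < q := by linarith
  have hq0 : 0 < q := by linarith
  set T := ∑ A ∈ Gr K V d, ((numBelow M A - 1 : ℕ) : ℝ) with hT
  set u := q⁻¹ with hu
  have hu0 : 0 < u := by positivity
  have huq : u * q = 1 := inv_mul_cancel₀ hq0.ne'
  have hu1 : u ≤ 1 / 100 := by
    rw [hu, inv_eq_one_div]; exact one_div_le_one_div_of_le (by norm_num) hq
  set p := pointProb q d with hp
  have hp0 : 0 < p := pointProb_pos hq1 (by omega)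
  set g0 := gauss q (2 * d + 1) d with hg0
  have hg0pos : 0 < g0 := by
    have := pow_le_gauss hq1 (d + 1) d
    rw [show d + 1 + d = 2 * d + 1 by omega] at this
    exact lt_of_lt_of_le (by positivity) this
  set g1 := gauss q (2 * d) (d - 1) with hg1
  set g2 := gauss q (2 * d - 1) (d - 2) with hg2
  set g3 := gauss q (2 * d - 2) (d - 3) with hg3
  have e1 : g1 = p * g0 := gauss_eq_pointProb_mul hq1 (by omega)
  obtain ⟨e2, e2'⟩ := gauss_two_bounds hq1 hd
  have e3 := gauss_three_le hq1 hd
  rw [← hg2, ← hg1] at e2 e2'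
  rw [← hg2, ← hg3] at e3
  have hg2pos : 0 < g2 := gauss_two_pos hq1 (by omega)
  set x : ℝ := (#M : ℝ) with hxdef
  have hx0 : 0 ≤ x := Nat.cast_nonneg _
  have hu2 : u ^ 2 ≤ 1 / 10000 := by
    calc u ^ 2 ≤ (1 / 100) ^ 2 := pow_le_pow_left₀ hu0.le hu1 2
      _ = _ := by norm_num
  have hxq : x ≤ 2 * q ^ (d + 1) := by
    have h1 := card_le_of_mul_pointProb_le (show 2 ≤ q by linarith) (by omega) hx0 hx
    have h2 : x * u ^ 2 ≤ x * (1 / 10000) := mul_le_mul_of_nonneg_left hu2 hx0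
    have : 0 < q ^ (d + 1) := by positivity
    rw [mul_sub] at h1
    linarith
  have hqd : 0 < q ^ (d + 1) := by positivity
  -- Here t = 2 works because M has at most 2q^(d+1) points, and requiring a third independent point
  -- costs a factor q^(d+1).
  have hmain := le_sum_numBelow_sub_one hM hd (t := 2) (by norm_num) (by
    rw [hV, show 2 * d + 1 - 3 = 2 * d - 2 by omega, show 2 * d + 1 - 2 = 2 * d - 1 by omega]
    change x * g3 ≤ 2 * g2
    have hg30 : 0 ≤ g3 := gauss_nonneg hq1 _ _
    have h1 : x * g3 ≤ 2 * q ^ (d + 1) * g3 := mul_le_mul_of_nonneg_right hxq hg30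
    linarith)
  rw [hV, show 2 * d + 1 - 2 = 2 * d - 1 by omega] at hmain
  change x * (x - 1) * g2 ≤ T * (q + 1 + 2) at hmain
  have hxx : 0 ≤ x * (x - 1) := by
    rw [hxdef, ← card_offDiag_real]; positivity
  have hpq : p * q ^ (d + 1) ≤ 1 := pointProb_mul_le hq1 (by omega)
  have h1u : 0 ≤ 1 - u ^ 2 := by linarith
  have hge : (1 - u ^ 2) * (p * (p * g0)) ≤ g2 := by
    rw [← e1]
    calc (1 - u ^ 2) * (p * g1) = p * ((1 - u ^ 2) * g1) := by ring
      _ ≤ p * (g2 * q ^ (d + 1)) := mul_le_mul_of_nonneg_left e2 hp0.le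
      _ = (p * q ^ (d + 1)) * g2 := by ring
      _ ≤ g2 := mul_le_of_le_one_left hg2pos.le hpq
  have hlow : (x * p) ^ 2 - 3 * u ^ 2 ≤ x * (x - 1) * ((1 - u ^ 2) * (p * p)) := by
    have hpu : p ≤ u ^ 2 := by
      have h2 : q ^ 2 ≤ q ^ (d + 1) := pow_le_pow_right₀ hq1.le (by omega)
      have h3 : p * q ^ 2 ≤ 1 := (mul_le_mul_of_nonneg_left h2 hp0.le).trans hpq
      calc p = p * q ^ 2 * u ^ 2 := by
            rw [mul_assoc, ← mul_pow, mul_comm q u, huq, one_pow, mul_one]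
        _ ≤ 1 * u ^ 2 := mul_le_mul_of_nonneg_right h3 (by positivity)
        _ = _ := one_mul _
    have hxp0 : 0 ≤ x * p := mul_nonneg hx0 hp0.le
    have e : x * (x - 1) * ((1 - u ^ 2) * (p * p)) =
      (x * p) ^ 2 - (x * p) * p - u ^ 2 * (x * p) ^ 2 + u ^ 2 * ((x * p) * p) := by ring
    rw [e]
    have a1 : (x * p) * p ≤ (11 / 10) * u ^ 2 := mul_le_mul hx hpu hp0.le (by norm_num)
    have a2 : u ^ 2 * (x * p) ^ 2 ≤ u ^ 2 * (11 / 10) ^ 2 :=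
      mul_le_mul_of_nonneg_left (pow_le_pow_left₀ hxp0 hx 2) (by positivity)
    have a3 : 0 ≤ u ^ 2 * ((x * p) * p) := by positivity
    have a4 : 0 ≤ u ^ 2 := by positivity
    linarith
  have h5 : ((x * p) ^ 2 - 3 * u ^ 2) * g0 ≤ T * (q + 1 + 2) := by
    calc ((x * p) ^ 2 - 3 * u ^ 2) * g0 ≤ x * (x - 1) * ((1 - u ^ 2) * (p * p)) * g0 :=
          mul_le_mul_of_nonneg_right hlow hg0pos.le
      _ = x * (x - 1) * ((1 - u ^ 2) * (p * (p * g0))) := by ring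
      _ ≤ x * (x - 1) * g2 := mul_le_mul_of_nonneg_left hge hxx
      _ ≤ _ := hmain
  rw [div_mul_eq_mul_div, le_div_iff₀ hg0pos]
  calc u * ((x * p) ^ 2 - 3 * u ^ 2) * g0 = u * (((x * p) ^ 2 - 3 * u ^ 2) * g0) := by ring
    _ ≤ u * (T * (q + 1 + 2)) := mul_le_mul_of_nonneg_left h5 hu0.le
    _ = T * (u * q + 3 * u) := by ring
    _ = _ := by rw [huq]

end Superfluous

/-! ### Application of the budget to a cover. -/

section Estimates

variable {K V : Type*} [Field K] [Finite K] [AddCommGroup V] [Module K V] [Module.Finite K V]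

theorem natCast_sub_one_add_ite (n : ℕ) :
    ((n - 1 : ℕ) : ℝ) + (if n = 0 then 0 else 1) = n := by
  cases n with
  | zero => simp
  | succ n => simp

theorem card_ne_zero_eq {α : Type*} (S : Finset α) (φ : α → ℕ) :
    (#{a ∈ S | φ a ≠ 0} : ℝ) = ∑ a ∈ S, (φ a : ℝ) - ∑ a ∈ S, ((φ a - 1 : ℕ) : ℝ) := by
  rw [← sum_sub_distrib, Finset.card_filter]
  push_cast
  apply sum_congr rfl
  intro a _
  have := natCast_sub_one_add_ite (φ a)
  split_ifs at this ⊢ <;> first | linarith | simp_all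

/-- For a pencil points below and b pencil hyperplanes above a flag: the number of incidences
exceeds the indicator of being covered exactly by the superfluous ones on either side and the
indicator of double coverage. Summed over the flags, this is the budget. -/
theorem budget_pointwise (a b : ℕ) :
    (if a ≠ 0 ∧ b ≠ 0 then (1 : ℝ) else 0) + ((a - 1 : ℕ) : ℝ) + ((b - 1 : ℕ) : ℝ) + 1 =
      a + b + if a = 0 ∧ b = 0 then (1 : ℝ) else 0 := by
  rcases a with _ | a <;> rcases b with _ | b <;> simp
  ring

/-- The mean number of points of a rank d+2 subspace in a random subspace of rank d is at most q/(q
- 1); hence the surplus of about 1/q. -/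
theorem gauss_mul_pointProb_le {q : ℝ} (hq : 2 ≤ q) {d : ℕ} (hd : 1 ≤ d) :
    gauss q (d + 2) 1 * pointProb q d ≤ 1 + q⁻¹ + 2 * q⁻¹ ^ 2 := by
  have hq0 : 0 < q := by linarith
  have hq1 : 1 < q := by linarith
  have h1 : 0 < q ^ (2 * d + 1) - 1 := sub_pos.2 (one_lt_pow₀ hq1 (by omega))
  have h2 : 0 < q - 1 := by linarith
  have h3 : gauss q (d + 2) 1 * pointProb q d ≤ q / (q - 1) := by
    rw [gauss_one_right, pointProb, div_mul_div_comm, div_le_div_iff₀ (mul_pos h2 h1) h2]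
    have h4 : (q ^ (d + 2) - 1) * (q ^ d - 1) ≤ q * (q ^ (2 * d + 1) - 1) := by
      have e1 : (q ^ (d + 2) - 1) * (q ^ d - 1) = q ^ (2 * d + 2) - q ^ (d + 2) - q ^ d + 1 := by
        ring
      have e2 : q * (q ^ (2 * d + 1) - 1) = q ^ (2 * d + 2) - q := by ring
      have h5 := one_le_pow₀ (n := d) hq1.le
      have h6 : q ≤ q ^ (d + 2) := le_self_pow₀ hq1.le (by omega)
      rw [e1, e2]; linarith
    calc _ ≤ (q * (q ^ (2 * d + 1) - 1)) * (q - 1) := mul_le_mul_of_nonneg_right h4 h2.le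
      _ = _ := by ring
  refine h3.trans ?_
  rw [div_le_iff₀ h2]
  have h7 : q⁻¹ * q = 1 := inv_mul_cancel₀ hq0.ne'
  have h8 : q⁻¹ ≤ 1 / 2 := by
    rw [inv_eq_one_div]; exact one_div_le_one_div_of_le (by norm_num) hq
  have e : (1 + q⁻¹ + 2 * q⁻¹ ^ 2) * (q - 1) =
      q - 1 + q⁻¹ * q - q⁻¹ + 2 * q⁻¹ * (q⁻¹ * q) - 2 * q⁻¹ ^ 2 := by ring
  rw [e, h7]
  have h9 : 0 < q⁻¹ := by positivity
  nlinarith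

namespace FlagCover

variable {d : ℕ} {α : ℝ} {ι₁ ι₂ ι₃ : Type*} [Fintype ι₁] [Fintype ι₂] [Fintype ι₃]

-- All counts are divided by the number of flags (or of subspaces of rank d) and fed to
-- `cover_estimates`; the hyperplane side is treated as points under a duality.
set_option maxHeartbeats 1600000 in
theorem estimates (c : FlagCover K V d α ι₁ ι₂ ι₃) (hd : 3 ≤ d) (hV : finrank K V = 2 * d + 1)
    (hα : 5 ≤ α) (hq : 100 ≤ (Nat.card K : ℝ))
    (hsmall : d * α * (Nat.card K : ℝ)⁻¹ ≤ 1 / 10 ^ 6)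
    (hcard : (Fintype.card ι₁ : ℝ) + Fintype.card ι₂ + Fintype.card ι₃ ≤
      gauss (Nat.card K) (d + 2) 1)
    (hle : #c.hyperplanes ≤ #c.points) :
    #c.hyperplanes * pointProb (Nat.card K) d ≤ 100 * (d * α) * (Nat.card K : ℝ)⁻¹ ^ 2 ∧
      1 - (Nat.card K : ℝ)⁻¹ ≤ #c.points * pointProb (Nat.card K) d ∧
      #c.points * pointProb (Nat.card K) d ≤ 11 / 10 ∧
      (∑ A ∈ Gr K V d, ((numBelow c.points A - 1 : ℕ) : ℝ)) / gauss (Nat.card K) (2 * d + 1) d ≤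
        (Nat.card K : ℝ)⁻¹ + 20 * (Nat.card K : ℝ)⁻¹ ^ 2 := by
  obtain ⟨D⟩ := nonempty_duality K V
  have hnp := gauss_mul_pointProb_le (show 2 ≤ (Nat.card K : ℝ) by linarith)
    (show 1 ≤ d by omega)
  obtain ⟨q, hqdef⟩ : ∃ q : ℝ, q = (Nat.card K : ℝ) := ⟨_, rfl⟩
  rw [← hqdef] at hq hsmall hcard hnp ⊢
  have hq1 : 1 < q := by linarith
  have hq0 : 0 < q := by linarith
  have hu0 : 0 < q⁻¹ := by positivity
  have hu1 : q⁻¹ ≤ 1 / 100 := by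
    rw [inv_eq_one_div]; exact one_div_le_one_div_of_le (by norm_num) hq
  have huq : q⁻¹ * q = 1 := inv_mul_cancel₀ hq0.ne'
  set M := c.points with hM
  set N := c.hyperplanes with hN
  set p := pointProb q d with hp
  have hp0 : 0 < p := pointProb_pos hq1 (by omega)
  set g0 := gauss q (2 * d + 1) d with hg0
  have hg0pos : 0 < g0 := by
    have := pow_le_gauss hq1 (d + 1) d
    rw [show d + 1 + d = 2 * d + 1 by omega] at this
    exact lt_of_lt_of_le (by positivity) this
  set g1 := gauss q (2 * d) (d - 1) with hg1
  have e1 : g1 = p * g0 := gauss_eq_pointProb_mul hq1 (by omega)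
  have hg1low : q ^ (d ^ 2 - 1) ≤ g1 := by
    have := pow_le_gauss hq1 (d + 1) (d - 1)
    rw [show d + 1 + (d - 1) = 2 * d by omega] at this
    refine le_trans (le_of_eq ?_) this
    congr 1
    have : d ^ 2 - 1 = (d + 1) * (d - 1) := by
      simpa using Nat.sq_sub_sq d 1
    rw [this, mul_comm]
  set w := gauss q (d + 1) 1 with hw
  have hwlow : q ^ d ≤ w := by
    have := pow_le_gauss hq1 d 1
    rwa [one_mul] at this
  have hwup : w ≤ 2 * q ^ d := by
    have := gauss_le (show 3 ≤ q by linarith) d 1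
    rwa [one_mul] at this
  have hw0 : 0 < w := lt_of_lt_of_le (by positivity) hwlow
  set NN := gauss q (d + 2) 1 with hNN
  have hNN0 : 0 ≤ NN := gauss_nonneg hq1 _ _
  have hg10 : 0 ≤ g1 := gauss_nonneg hq1 _ _
  have hsum1 : ∑ A ∈ Gr K V d, (numBelow M A : ℝ) = #M * g1 := by
    have := sum_numBelow (V := V) c.points_subset (r := d) (by omega)
    rw [hV, Nat.add_sub_cancel, ← hqdef] at this
    exact this
  set N' := N.image D.toEquiv with hN'
  have hN'c : #N' = #N := card_image_of_injective _ D.toEquiv.injective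
  have hN's : N' ⊆ Gr K V 1 := D.image_subset_Gr hV c.hyperplanes_subset
  have hsum2 : ∑ B ∈ Gr K V (d + 1), (numAbove N B : ℝ) = #N * g1 := by
    simp_rw [D.numAbove_eq]
    rw [D.sum_Gr hV (fun A => (numBelow N' A : ℝ)), ← hN'c]
    have := sum_numBelow (V := V) hN's (r := d) (by omega)
    rw [hV, Nat.add_sub_cancel, ← hqdef] at this
    exact this
  set T1 := ∑ A ∈ Gr K V d, ((numBelow M A - 1 : ℕ) : ℝ) with hT1
  set T2 := ∑ B ∈ Gr K V (d + 1), ((numAbove N B - 1 : ℕ) : ℝ) with hT2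
  have hT2' : T2 = ∑ A ∈ Gr K V d, ((numBelow N' A - 1 : ℕ) : ℝ) := by
    rw [hT2]
    simp_rw [D.numAbove_eq]
    exact D.sum_Gr hV (fun A => ((numBelow N' A - 1 : ℕ) : ℝ))
  set J : ℝ := (#{f ∈ flags K V d | numBelow M f.1 ≠ 0 ∧ numAbove N f.2 ≠ 0} : ℝ) with hJ
  set Z : ℝ := (#{f ∈ flags K V d | numBelow M f.1 = 0 ∧ numAbove N f.2 = 0} : ℝ) with hZ
  have hbudget : J + w * T1 + w * T2 + w * g0 = w * (#M * g1) + w * (#N * g1) + Z := by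
    have h := Finset.sum_congr (rfl : flags K V d = flags K V d)
      (fun f _ => budget_pointwise (numBelow M f.1) (numAbove N f.2))
    simp only [sum_add_distrib] at h
    rw [sum_flags_fst hV (fun A => ((numBelow M A - 1 : ℕ) : ℝ)),
      sum_flags_snd (fun A => ((numAbove N A - 1 : ℕ) : ℝ)),
      sum_flags_fst hV (fun A => (numBelow M A : ℝ)),
      sum_flags_snd (fun A => (numAbove N A : ℝ)), hsum1, hsum2, ← hqdef] at h
    simp only [sum_boole, sum_const, nsmul_eq_mul, mul_one] at h
    rw [card_flags hV, ← hqdef] at h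
    exact h
  have hZle : Z ≤ ((Fintype.card ι₁ : ℝ) + Fintype.card ι₂) *
      (16 * q ^ (d ^ 2 - 3) * w) + Fintype.card ι₃ * (α * q ^ (d ^ 2 + d - 2)) := by
    have := c.card_uncovered_le hd hV (by rw [← hqdef]; linarith)
    rw [← hqdef] at this
    exact this
  have hmix := mixing (K := K) (V := V) (by omega : 1 ≤ d) hV
    (fun A => numBelow M A ≠ 0) (fun B => numAbove N B ≠ 0)
  rw [← hqdef] at hmix
  have hbad : (#{f ∈ flags K V d | numBelow M f.1 ≠ 0 ↔ numAbove N f.2 ≠ 0} : ℝ) ≤ J + Z := by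
    have : ({f ∈ flags K V d | numBelow M f.1 ≠ 0 ↔ numAbove N f.2 ≠ 0} : Finset _) ⊆
      ({f ∈ flags K V d | numBelow M f.1 ≠ 0 ∧ numAbove N f.2 ≠ 0} : Finset _) ∪
      ({f ∈ flags K V d | numBelow M f.1 = 0 ∧ numAbove N f.2 = 0} : Finset _) := by
      intro f hf
      simp only [mem_filter, mem_union] at hf ⊢
      tauto
    have h := (card_le_card this).trans (card_union_le _ _)
    rw [hJ, hZ]
    exact_mod_cast h
  have hcA : (#{A ∈ Gr K V d | numBelow M A ≠ 0} : ℝ) = #M * g1 - T1 := by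
    rw [← hsum1, hT1]
    convert card_ne_zero_eq (Gr K V d) (numBelow M)
  have hcB : (#{B ∈ Gr K V (d + 1) | numAbove N B ≠ 0} : ℝ) = #N * g1 - T2 := by
    rw [← hsum2, hT2]
    convert card_ne_zero_eq (Gr K V (d + 1)) (numAbove N)
  replace hmix : (#N * g1 - T2) * (#M * g1 - T1 - w * g1) * w ≤
      (2 * d + 1) * (#{f ∈ flags K V d | numBelow M f.1 ≠ 0 ↔ numAbove N f.2 ≠ 0} : ℝ) * g0 := by
    rw [← hcA, ← hcB]
    convert hmix
  -- normalization
  have hs1 : (#M : ℝ) ≤ Fintype.card ι₁ := by exact_mod_cast c.card_points_le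
  have hs2 : (#N : ℝ) ≤ Fintype.card ι₂ := by exact_mod_cast c.card_hyperplanes_le
  have hm : (#M : ℝ) * g1 / g0 = #M * p := by rw [e1]; field_simp
  have hh : (#N : ℝ) * g1 / g0 = #N * p := by rw [e1]; field_simp
  have hn3 : #M * p + #N * p + Fintype.card ι₃ * p ≤ NN * p := by
    rw [← add_mul, ← add_mul]
    exact mul_le_mul_of_nonneg_right (by linarith) hp0.le
  have hu2 : q⁻¹ ^ 2 ≤ 1 / 100 * q⁻¹ := by
    rw [sq]; exact mul_le_mul_of_nonneg_right hu1 hu0.le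
  have hMp : #M * p ≤ 11 / 10 := by
    have h1 : 0 ≤ (#N : ℝ) * p := by positivity
    have h2 : 0 ≤ (Fintype.card ι₃ : ℝ) * p := by positivity
    linarith
  have hNp : #N * p ≤ 11 / 10 := by
    have h1 : 0 ≤ (#M : ℝ) * p := by positivity
    have h2 : 0 ≤ (Fintype.card ι₃ : ℝ) * p := by positivity
    linarith
  have hτ1 := superfluous_ge hd hV (by rw [← hqdef]; exact hq) c.points_subset
    (by rw [← hqdef]; exact hMp)
  have hτ2 := superfluous_ge hd hV (by rw [← hqdef]; exact hq) hN's
    (by rw [← hqdef, hN'c]; exact hNp)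
  rw [← hqdef] at hτ1
  rw [← hqdef, ← hT2', hN'c] at hτ2
  have hT10 : 0 ≤ T1 := sum_nonneg fun _ _ => Nat.cast_nonneg _
  have hT20 : 0 ≤ T2 := sum_nonneg fun _ _ => Nat.cast_nonneg _
  have hgw : 0 < g0 * w := mul_pos hg0pos hw0
  have hJ0 : 0 ≤ J := Nat.cast_nonneg _
  have hpq : p * q ^ (d + 1) ≤ 1 := pointProb_mul_le hq1 (by omega)
  have hres := cover_estimates (D := (d : ℝ)) (α := α) (u := q⁻¹) (n := NN * p) (m := #M * p)
    (h := #N * p) (σ := Fintype.card ι₃ * p) (j := J / (g0 * w)) (z := Z / (g0 * w))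
    (τ₁ := T1 / g0) (τ₂ := T2 / g0) (by exact_mod_cast hd) hα hu0 hsmall hnp (by positivity)
    (by positivity) (by positivity) (by positivity) (by positivity) ?_ ?_ hn3 hτ1 hτ2 ?_ ?_
  · exact ⟨hres.1, hres.2.1, hMp, hres.2.2⟩
  · rw [← hm, ← hh]
    field_simp
    linarith
  · rw [div_le_iff₀ hgw]
    refine hZle.trans (add_le_add ?_ ?_ |>.trans (le_of_eq (add_mul _ _ _).symm))
    · have h1 : (Fintype.card ι₁ : ℝ) + Fintype.card ι₂ ≤ NN := by
        have : (0 : ℝ) ≤ Fintype.card ι₃ := Nat.cast_nonneg _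
        linarith
      have h2 : q ^ (d ^ 2 - 3) ≤ q⁻¹ ^ 2 * (p * g0) := by
        rw [← e1]
        have h3 : q⁻¹ ^ 2 * q ^ (d ^ 2 - 1) = q ^ (d ^ 2 - 3) := by
          have h4 : 9 ≤ d ^ 2 := by nlinarith
          rw [show d ^ 2 - 1 = 2 + (d ^ 2 - 3) by omega, pow_add, ← mul_assoc, ← mul_pow, huq,
            one_pow, one_mul]
        rw [← h3]
        exact mul_le_mul_of_nonneg_left hg1low (by positivity)
      calc ((Fintype.card ι₁ : ℝ) + Fintype.card ι₂) * (16 * q ^ (d ^ 2 - 3) * w)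
          ≤ NN * (16 * (q⁻¹ ^ 2 * (p * g0)) * w) := by gcongr
        _ = _ := by ring
    · have h2 : q ^ (d ^ 2 + d - 2) ≤ q⁻¹ * (p * g0 * w) := by
        rw [← e1]
        have h3 : q⁻¹ * (q ^ (d ^ 2 - 1) * q ^ d) = q ^ (d ^ 2 + d - 2) := by
          have h4 : 9 ≤ d ^ 2 := by nlinarith
          rw [← pow_add, show d ^ 2 - 1 + d = (d ^ 2 + d - 2) + 1 by omega, pow_succ,
            mul_comm (q ^ _) q, ← mul_assoc, huq, one_mul]
        rw [← h3]
        gcongr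
      calc (Fintype.card ι₃ : ℝ) * (α * q ^ (d ^ 2 + d - 2))
          ≤ Fintype.card ι₃ * (α * (q⁻¹ * (p * g0 * w))) := by gcongr
        _ = _ := by ring
  -- The term 2u is the proportion of subspaces of rank d that meet a given B nontrivially, at most
  -- w·p.
  · have hwp : w * p ≤ 2 * q⁻¹ := by
      have h1 : p * q ^ d ≤ q⁻¹ := by
        calc p * q ^ d = q⁻¹ * (p * q ^ (d + 1)) := by
              rw [pow_succ]
              calc p * q ^ d = (q⁻¹ * q) * (p * q ^ d) := by rw [huq, one_mul]
                _ = _ := by ring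
          _ ≤ q⁻¹ * 1 := mul_le_mul_of_nonneg_left hpq hu0.le
          _ = _ := mul_one _
      calc w * p ≤ 2 * q ^ d * p := mul_le_mul_of_nonneg_right hwup hp0.le
        _ = 2 * (p * q ^ d) := by ring
        _ ≤ _ := by linarith
    have hb0 : 0 ≤ (#N : ℝ) * p - T2 / g0 := by
      have : 0 ≤ (#N : ℝ) * g1 - T2 := by
        rw [← hcB]; positivity
      rw [← hh, ← sub_div]; positivity
    calc _ ≤ (#N * p - T2 / g0) * (#M * p - T1 / g0 - w * p) :=
          mul_le_mul_of_nonneg_left (by linarith) hb0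
      _ = (#N * g1 - T2) * (#M * g1 - T1 - w * g1) * w / (g0 * g0 * w) := by
          rw [e1]; field_simp
      _ ≤ ((2 * d + 1) * (J + Z) * g0) / (g0 * g0 * w) := by
          apply div_le_div_of_nonneg_right _ (by positivity)
          refine hmix.trans ?_
          exact mul_le_mul_of_nonneg_right (mul_le_mul_of_nonneg_left hbad (by positivity))
            hg0pos.le
      _ = _ := by field_simp
  · have : (#N : ℝ) ≤ #M := by exact_mod_cast hle
    exact mul_le_mul_of_nonneg_right this hp0.le

end FlagCover

end Estimates

/-! ### From sets of points to sets of vectors. -/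

section PointVectors

variable {K V : Type*} [Field K] [Finite K] [AddCommGroup V] [Module K V] [Module.Finite K V]

theorem span_singleton_eq_of_mem {P : Submodule K V} (hP : finrank K P = 1) {v : V} (hv : v ∈ P)
    (h0 : v ≠ 0) : K ∙ v = P :=
  Submodule.eq_of_le_of_finrank_le ((Submodule.span_singleton_le_iff_mem v P).2 hv)
    (by rw [hP, finrank_span_singleton h0])

/-- The nonzero vectors that span a member of `M`. -/
noncomputable def pointVectors [Fintype V] (M : Finset (Submodule K V)) : Finset V :=
  {v | v ≠ 0 ∧ K ∙ v ∈ M}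

variable [Fintype V] {M : Finset (Submodule K V)}

theorem mem_pointVectors {v : V} : v ∈ pointVectors M ↔ v ≠ 0 ∧ K ∙ v ∈ M := by
  simp [pointVectors]

theorem smul_mem_pointVectors {c : K} (hc : c ≠ 0) {v : V} (hv : v ∈ pointVectors M) :
    c • v ∈ pointVectors M := by
  rw [mem_pointVectors] at hv ⊢
  refine ⟨smul_ne_zero hc hv.1, ?_⟩
  rw [Submodule.span_singleton_smul_eq (IsUnit.mk0 c hc)]
  exact hv.2

theorem card_pointVectors_filter (hM : M ⊆ Gr K V 1) (p : Submodule K V → Prop) :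
    (#{v ∈ pointVectors M | p (K ∙ v)} : ℝ) = ((Nat.card K : ℝ) - 1) * #{P ∈ M | p P} := by
  have h := Finset.card_eq_sum_card_fiberwise (f := fun v : V => K ∙ v)
    (s := ({v ∈ pointVectors M | p (K ∙ v)} : Finset V)) (t := ({P ∈ M | p P} : Finset _)) (by
      intro v hv
      obtain ⟨h1, h2⟩ := mem_filter.1 hv
      exact mem_filter.2 ⟨(mem_pointVectors.1 h1).2, h2⟩)
  rw [h]
  push_cast
  rw [mul_comm, ← nsmul_eq_mul, ← sum_const]
  apply sum_congr rfl
  intro P hP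
  obtain ⟨hPM, hp⟩ := mem_filter.1 hP
  have hP1 := mem_Gr.1 (hM hPM)
  have h2 := card_ne_zero_vectors (K := K) P
  rw [hP1, pow_one] at h2
  rw [← h2]
  congr 2
  ext v
  simp only [mem_filter, mem_pointVectors, mem_univ, true_and]
  constructor
  · rintro ⟨⟨⟨h0, -⟩, -⟩, h⟩
    exact ⟨by rw [← h]; exact Submodule.mem_span_singleton_self v, h0⟩
  · rintro ⟨hv, h0⟩
    have := span_singleton_eq_of_mem hP1 hv h0
    exact ⟨⟨⟨h0, this ▸ hPM⟩, this.symm ▸ hp⟩, this⟩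

theorem card_pointVectors (hM : M ⊆ Gr K V 1) :
    (#(pointVectors M) : ℝ) = ((Nat.card K : ℝ) - 1) * #M := by
  simpa using card_pointVectors_filter hM (fun _ => True)

theorem card_missing_line (hM : M ⊆ Gr K V 1) {L : Submodule K V} (hL : finrank K L = 2) :
    (#{R ∈ Gr K V 1 | R ≤ L ∧ R ∉ M} : ℝ) = (Nat.card K : ℝ) + 1 - numBelow M L := by
  have hq := one_lt_natCard_real (K := K)
  have h1 := card_Gr_le L 1
  rw [hL, gauss_one_right] at h1
  have h2 : ((Nat.card K : ℝ) ^ 2 - 1) / (Nat.card K - 1) = Nat.card K + 1 := by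
    have : (Nat.card K : ℝ) - 1 ≠ 0 := by linarith
    field_simp; ring
  rw [h2] at h1
  have h3 := card_filter_add_card_filter_not (s := ({R ∈ Gr K V 1 | R ≤ L} : Finset _))
    (fun R => R ∈ M)
  rw [filter_filter, filter_filter] at h3
  have h4 : ({R ∈ Gr K V 1 | R ≤ L ∧ R ∈ M} : Finset _) = ({R ∈ M | R ≤ L} : Finset _) := by
    ext R
    simp only [mem_filter]
    exact ⟨fun h => ⟨h.2.2, h.2.1⟩, fun h => ⟨hM h.1, h.2, h.1⟩⟩
  rw [h4] at h3
  rw [← h1, ← h3, numBelow]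
  push_cast
  ring

/-- The pairs of vectors of `M` whose sum is not in `M` come from the points off `M` of the lines
that join points of `M`. -/
theorem card_add_notMem_le (hM : M ⊆ Gr K V 1) :
    (#{p ∈ pointVectors M ×ˢ pointVectors M | p.1 + p.2 ∉ pointVectors M} : ℝ) ≤
      ((Nat.card K : ℝ) - 1) * #M + ((Nat.card K : ℝ) - 1) *
        ∑ p ∈ M.offDiag, ((Nat.card K : ℝ) + 1 - numBelow M (p.1 ⊔ p.2)) := by
  have hq := one_lt_natCard_real (K := K)
  set E : Finset (V × V) :=
    {p ∈ pointVectors M ×ˢ pointVectors M | p.1 + p.2 ∉ pointVectors M} with hE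
  set E₀ : Finset (V × V) := {p ∈ E | p.1 + p.2 = 0}
  set E₁ : Finset (V × V) := {p ∈ E | ¬ p.1 + p.2 = 0}
  have hsplit : #E₀ + #E₁ = #E := card_filter_add_card_filter_not _
  -- Pairs with sum zero are determined by their first vector.
  have h0 : (#E₀ : ℝ) ≤ ((Nat.card K : ℝ) - 1) * #M := by
    rw [← card_pointVectors hM]
    norm_cast
    apply Finset.card_le_card_of_injOn Prod.fst
    · intro p hp
      have h1 := (mem_filter.1 (mem_filter.1 hp).1).1
      exact (mem_product.1 h1).1
    · rintro ⟨u, v⟩ hp ⟨u', v'⟩ hp' h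
      have h1 : u + v = 0 := (mem_filter.1 hp).2
      have h2 : u' + v' = 0 := (mem_filter.1 hp').2
      have h3 : u = u' := h
      subst h3
      rw [add_left_cancel (h1.trans h2.symm)]
  set 𝒯 := M.offDiag.sigma (fun p => ({R ∈ Gr K V 1 | R ≤ p.1 ⊔ p.2 ∧ R ∉ M} : Finset _)) with h𝒯
  have hT : (#𝒯 : ℝ) = ∑ p ∈ M.offDiag, ((Nat.card K : ℝ) + 1 - numBelow M (p.1 ⊔ p.2)) := by
    rw [h𝒯, card_sigma]
    push_cast
    apply sum_congr rfl
    rintro ⟨P, Q⟩ hp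
    obtain ⟨hP, hQ, hne⟩ := mem_offDiag.1 hp
    exact card_missing_line hM (finrank_sup_points (mem_Gr.1 (hM hP)) (mem_Gr.1 (hM hQ)) hne)
  -- For a missing point R on the line PQ, a vector u of P admits at most one v in Q with u + v in
  -- R, since Q and R are distinct points. So each triple (P, Q, R) carries at most q - 1 pairs.
  have h1 : (#E₁ : ℝ) ≤ #𝒯 * ((Nat.card K : ℝ) - 1) := by
    have h := Finset.card_eq_sum_card_fiberwise (s := E₁) (t := 𝒯)
      (f := fun p => (⟨(K ∙ p.1, K ∙ p.2), K ∙ (p.1 + p.2)⟩ :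
        (_ : Submodule K V × Submodule K V) × Submodule K V)) (by
        rintro ⟨u, v⟩ hp
        obtain ⟨hp1, hsum⟩ := mem_filter.1 hp
        obtain ⟨hp2, hnot⟩ := mem_filter.1 hp1
        obtain ⟨hu, hv⟩ := mem_product.1 hp2
        simp only at hsum hnot hu hv
        rw [mem_pointVectors] at hnot hu hv
        have hR : K ∙ (u + v) ∉ M := fun h => hnot ⟨hsum, h⟩
        have hle : K ∙ (u + v) ≤ (K ∙ u) ⊔ (K ∙ v) := by
          rw [Submodule.span_singleton_le_iff_mem]
          exact Submodule.add_mem_sup (Submodule.mem_span_singleton_self u)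
            (Submodule.mem_span_singleton_self v)
        refine mem_sigma.2 ⟨mem_offDiag.2 ⟨hu.2, hv.2, ?_⟩, mem_filter.2
          ⟨mem_Gr.2 (finrank_span_singleton hsum), hle, hR⟩⟩
        intro heq
        simp only at heq
        apply hR
        have : K ∙ (u + v) = K ∙ u := by
          apply Submodule.eq_of_le_of_finrank_le
          · rw [← heq, sup_idem] at hle; exact hle
          · rw [finrank_span_singleton hsum, finrank_span_singleton hu.1]
        rw [this]; exact hu.2)
    rw [h]
    push_cast
    rw [← nsmul_eq_mul, ← sum_const]
    apply sum_le_sum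
    rintro ⟨⟨P, Q⟩, R⟩ ht
    obtain ⟨ht1, ht2⟩ := mem_sigma.1 ht
    obtain ⟨hP, hQ, hne⟩ := mem_offDiag.1 ht1
    obtain ⟨hR1, -, hRM⟩ := mem_filter.1 ht2
    simp only at hP hQ hR1 hRM
    have h2 := card_ne_zero_vectors (K := K) P
    rw [mem_Gr.1 (hM hP), pow_one] at h2
    rw [← h2]
    norm_cast
    apply Finset.card_le_card_of_injOn Prod.fst
    · rintro ⟨u, v⟩ hp
      obtain ⟨hp1, hp2⟩ := mem_filter.1 hp
      have hu := (mem_product.1 (mem_filter.1 (mem_filter.1 hp1).1).1).1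
      simp only [Sigma.mk.injEq, Prod.mk.injEq, heq_eq_eq] at hp2
      simp only [coe_filter, mem_univ, true_and, Set.mem_ofPred_eq]
      exact ⟨hp2.1.1 ▸ Submodule.mem_span_singleton_self u, (mem_pointVectors.1 hu).1⟩
    · rintro ⟨u, v⟩ hp ⟨u', v'⟩ hp' h
      have h3 : u = u' := h
      subst h3
      have hp2 := (mem_filter.1 hp).2
      have hp2' := (mem_filter.1 hp').2
      simp only [Sigma.mk.injEq, Prod.mk.injEq, heq_eq_eq] at hp2 hp2'
      have hv : v ∈ Q := hp2.1.2 ▸ Submodule.mem_span_singleton_self v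
      have hv' : v' ∈ Q := hp2'.1.2 ▸ Submodule.mem_span_singleton_self v'
      have hr : u + v ∈ R := hp2.2 ▸ Submodule.mem_span_singleton_self _
      have hr' : u + v' ∈ R := hp2'.2 ▸ Submodule.mem_span_singleton_self _
      have hd1 : v - v' ∈ Q := Q.sub_mem hv hv'
      have hd2 : v - v' ∈ R := by
        have := R.sub_mem hr hr'
        rwa [add_sub_add_left_eq_sub] at this
      by_cases h0 : v - v' = 0
      · rw [sub_eq_zero.1 h0]
      · exfalso
        apply hRM
        rw [← span_singleton_eq_of_mem (mem_Gr.1 hR1) hd2 h0,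
          span_singleton_eq_of_mem (mem_Gr.1 (hM hQ)) hd1 h0]
        exact hQ
  rw [← hsplit]
  push_cast
  rw [hT] at h1
  linarith

end PointVectors

/-! ### Nearly minimal waste forces a subspace of rank d+2. -/

section Structure

/-- The Cauchy-Schwarz bound in reverse. Here S counts ordered pairs of points, Λ adds up the
numbers of points on their joining lines, and Q is q^(d+1). If T hardly exceeds its minimum, the
average joining line must have at least q - 26 of its q + 1 points in the set. -/
theorem le_of_variance_estimates {q u Q p x S Λ T g0 g1 g2 g3 : ℝ} (hq : 10000 ≤ q)
    (huq : u * q = 1) (hu0 : 0 < u) (hQ : q ≤ Q) (hp : 0 < p) (hpQ : p * Q ≤ 1)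
    (hx0 : 1 ≤ x) (hxp : 1 - u ≤ x * p) (hxQ : x ≤ 2 * Q) (hS : S = x * (x - 1))
    (hΛ : 0 ≤ Λ) (hg2 : 0 < g2) (hg3 : 0 ≤ g3) (e1 : g1 = p * g0)
    (e2 : (1 - u ^ 2) * g1 ≤ g2 * Q) (e3 : g3 * Q ≤ g2) (hT : T ≤ (u + 20 * u ^ 2) * g0)
    (hT0 : 0 ≤ T) (hcs : (S * g2) ^ 2 ≤ T * (Λ * g2 + S * x * g3)) :
    S * (q - 26) ≤ Λ := by
  have hq0 : 0 < q := by linarith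
  have hQ0 : 0 < Q := by linarith
  have hu1 : u ≤ 1 / 10000 := by
    have : u * 10000 ≤ u * q := mul_le_mul_of_nonneg_left hq hu0.le
    linarith
  have hu2 : u ^ 2 ≤ u * (1 / 10000) := by
    rw [sq]; exact mul_le_mul_of_nonneg_left hu1 hu0.le
  have hS0 : 0 ≤ S := by rw [hS]; exact mul_nonneg (by linarith) (by linarith)
  set B := Λ + 2 * S with hB
  have hB0 : 0 ≤ B := by positivity
  have h1 : Λ * g2 + S * x * g3 ≤ B * g2 := by
    have : x * g3 ≤ 2 * g2 := by
      calc x * g3 ≤ 2 * Q * g3 := mul_le_mul_of_nonneg_right hxQ hg3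
        _ = 2 * (g3 * Q) := by ring
        _ ≤ _ := by linarith
    have h := mul_le_mul_of_nonneg_left this hS0
    rw [hB]; linarith
  have h2 : S ^ 2 * g2 ≤ T * B := by
    have h := hcs.trans (mul_le_mul_of_nonneg_left h1 hT0)
    have : (S ^ 2 * g2) * g2 ≤ (T * B) * g2 := by linarith
    exact le_of_mul_le_mul_right this hg2
  have h1u : 0 ≤ 1 - u ^ 2 := by linarith
  have h3 : S ^ 2 * p * (1 - u ^ 2) ≤ (u + 20 * u ^ 2) * Q * B := by
    have h4 : S ^ 2 * g2 ≤ (u + 20 * u ^ 2) * g0 * B :=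
      h2.trans (mul_le_mul_of_nonneg_right hT hB0)
    have h5 := mul_le_mul_of_nonneg_right h4 (mul_nonneg hp.le h1u)
    have h6 : (u + 20 * u ^ 2) * B * ((1 - u ^ 2) * g1) ≤ (u + 20 * u ^ 2) * B * (g2 * Q) :=
      mul_le_mul_of_nonneg_left e2 (by positivity)
    rw [e1] at h6
    have : (S ^ 2 * p * (1 - u ^ 2)) * g2 ≤ ((u + 20 * u ^ 2) * Q * B) * g2 := by linarith
    exact le_of_mul_le_mul_right this hg2
  have hSp : (1 - 3 * u) * Q ≤ S * p := by
    have h4 : (1 - u) * Q ≤ x := by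
      calc (1 - u) * Q ≤ x * p * Q := mul_le_mul_of_nonneg_right hxp hQ0.le
        _ = x * (p * Q) := by ring
        _ ≤ x := mul_le_of_le_one_right (by linarith) hpQ
    have h5 : 1 ≤ u * Q := by
      rw [← huq]; exact mul_le_mul_of_nonneg_left hQ hu0.le
    have h6 : (1 - 2 * u) * Q ≤ x - 1 := by linarith
    have h7 : (1 - u) * ((1 - 2 * u) * Q) ≤ (x * p) * (x - 1) :=
      mul_le_mul hxp h6 (mul_nonneg (by linarith) hQ0.le) (by
        exact mul_nonneg (by linarith) hp.le)
    have h8 : 0 ≤ u ^ 2 * Q := by positivity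
    rw [hS]; linarith
  have h4 : S * ((1 - 3 * u) * (1 - u ^ 2)) ≤ (u + 20 * u ^ 2) * B := by
    have h5 := mul_le_mul_of_nonneg_left hSp (mul_nonneg hS0 h1u)
    have : (S * ((1 - 3 * u) * (1 - u ^ 2))) * Q ≤ ((u + 20 * u ^ 2) * B) * Q := by linarith
    exact le_of_mul_le_mul_right this hQ0
  have h5 : S * (1 - 4 * u) ≤ (u + 20 * u ^ 2) * B := by
    refine le_trans (mul_le_mul_of_nonneg_left ?_ hS0) h4
    have : 0 ≤ u ^ 3 := by positivity
    linarith
  have h6 : S * (q - 4) ≤ (1 + 20 * u) * B := by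
    have h := mul_le_mul_of_nonneg_right h5 hq0.le
    have e : S * (1 - 4 * u) * q = S * (q - 4 * (u * q)) := by ring
    have e' : (u + 20 * u ^ 2) * B * q = (u * q + 20 * u * (u * q)) * B := by ring
    rw [e, e', huq] at h
    linarith
  have h7 : S * (q - 4) * (1 - 20 * u) ≤ B := by
    have h := mul_le_mul_of_nonneg_right h6 (show 0 ≤ 1 - 20 * u by linarith)
    have : 0 ≤ u ^ 2 * B := by positivity
    linarith
  have e : S * (q - 4) * (1 - 20 * u) = S * (q - 24) - 20 * S * (u * q - 1) + 80 * S * u := by ring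
  rw [e, huq] at h7
  have : 0 ≤ S * u := by positivity
  linarith

variable {K V : Type*} [Field K] [Finite K] [AddCommGroup V] [Module K V] [Module.Finite K V]

/-- A set of points with few superfluous incidences almost is a subspace of rank `d + 2`. -/
theorem exists_subspace_of_superfluous_le {d : ℕ} (hd : 3 ≤ d) (hV : finrank K V = 2 * d + 1)
    (hq : 10000 ≤ (Nat.card K : ℝ)) {M : Finset (Submodule K V)} (hM : M ⊆ Gr K V 1)
    (hlow : 1 - (Nat.card K : ℝ)⁻¹ ≤ #M * pointProb (Nat.card K) d)
    (hupp : #M * pointProb (Nat.card K) d ≤ 11 / 10)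
    (hT : (∑ A ∈ Gr K V d, ((numBelow M A - 1 : ℕ) : ℝ)) / gauss (Nat.card K) (2 * d + 1) d ≤
        (Nat.card K : ℝ)⁻¹ + 20 * (Nat.card K : ℝ)⁻¹ ^ 2) :
    ∃ U : Submodule K V, finrank K U = d + 2 ∧
      (#{P ∈ M | ¬ P ≤ U} : ℝ) ≤ 300 * (Nat.card K : ℝ) ^ d ∧
      (#{P ∈ Gr K V 1 | P ≤ U ∧ P ∉ M} : ℝ) ≤ 300 * (Nat.card K : ℝ) ^ d := by
  have : Finite V := Module.finite_of_finite K
  have := Fintype.ofFinite V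
  have hbad := card_add_notMem_le hM
  have hMt := card_pointVectors hM
  have hcs := sq_sum_numBelow_mul_le M (Gr K V d)
  rw [sum_numBelow_mul hM (by omega)] at hcs
  have hcs2 := sum_numBelow_sq_mul_le hM hd
  have hpv : ∀ W : Submodule K V, (#{v ∈ pointVectors M | v ∉ W} : ℝ) =
      ((Nat.card K : ℝ) - 1) * #{P ∈ M | ¬ P ≤ W} := by
    intro W
    have h := card_pointVectors_filter hM (fun P => ¬ P ≤ W)
    simp only [Submodule.span_singleton_le_iff_mem] at h
    convert h
  have hUcard : ∀ U : Submodule K V, (Nat.card U : ℝ) = (Nat.card K : ℝ) ^ finrank K U := by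
    intro U
    exact_mod_cast (Module.natCard_eq_pow_finrank (K := K) (V := U))
  have hUpts : ∀ U : Submodule K V, (#{P ∈ Gr K V 1 | P ≤ U} : ℝ) =
      gauss (Nat.card K) (finrank K U) 1 := fun U => card_Gr_le U 1
  obtain ⟨q, hqdef⟩ : ∃ q : ℝ, q = (Nat.card K : ℝ) := ⟨_, rfl⟩
  rw [← hqdef] at hq hlow hupp hT hbad hMt hcs2 hcs ⊢
  simp_rw [← hqdef] at hpv hUcard hUpts
  rw [hV, show 2 * d + 1 - 2 = 2 * d - 1 by omega] at hcs hcs2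
  rw [show 2 * d + 1 - 3 = 2 * d - 2 by omega] at hcs2
  have hq1 : 1 < q := by linarith
  have hq0 : 0 < q := by linarith
  obtain ⟨u, hu⟩ : ∃ u : ℝ, u = q⁻¹ := ⟨_, rfl⟩
  rw [← hu] at hlow hT
  have hu0 : 0 < u := by rw [hu]; positivity
  have huq : u * q = 1 := by rw [hu]; exact inv_mul_cancel₀ hq0.ne'
  have hu1 : u ≤ 1 / 10000 := by
    rw [hu, inv_eq_one_div]; exact one_div_le_one_div_of_le (by norm_num) hq
  have hu2 : u ^ 2 ≤ 1 / 10000 := by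
    calc u ^ 2 ≤ (1 / 10000) ^ 2 := pow_le_pow_left₀ hu0.le hu1 2
      _ ≤ _ := by norm_num
  set p := pointProb q d with hp
  have hp0 : 0 < p := pointProb_pos hq1 (by omega)
  have hpQ : p * q ^ (d + 1) ≤ 1 := pointProb_mul_le hq1 (by omega)
  obtain ⟨e2, e2'⟩ := gauss_two_bounds hq1 hd
  rw [← hu] at e2
  have e3 := gauss_three_le hq1 hd
  have hg0pos : 0 < gauss q (2 * d + 1) d := by
    have := pow_le_gauss hq1 (d + 1) d
    rw [show d + 1 + d = 2 * d + 1 by omega] at this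
    exact lt_of_lt_of_le (by positivity) this
  have hg2pos : 0 < gauss q (2 * d - 1) (d - 2) := gauss_two_pos hq1 (by omega)
  obtain ⟨x, hx⟩ : ∃ x : ℝ, x = (#M : ℝ) := ⟨_, rfl⟩
  rw [← hx] at hlow hupp hbad hMt hcs hcs2
  have hQ0 : 0 < q ^ (d + 1) := by positivity
  have hQq : q ≤ q ^ (d + 1) := le_self_pow₀ hq1.le (by omega)
  have huQ : u * q ^ (d + 1) = q ^ d := by rw [pow_succ']; rw [← mul_assoc, huq, one_mul]
  have hx00 : 0 ≤ x := by rw [hx]; positivity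
  have hxlow : (1 - u) * q ^ (d + 1) ≤ x := by
    calc (1 - u) * q ^ (d + 1) ≤ x * p * q ^ (d + 1) := mul_le_mul_of_nonneg_right hlow hQ0.le
      _ = x * (p * q ^ (d + 1)) := by ring
      _ ≤ x := mul_le_of_le_one_right hx00 hpQ
  have hx1 : 1 ≤ x := by
    refine le_trans ?_ hxlow
    have : (1 - u) * q ≤ (1 - u) * q ^ (d + 1) := mul_le_mul_of_nonneg_left hQq (by linarith)
    refine le_trans ?_ this
    rw [sub_mul, huq]; linarith
  have hxupp : x ≤ 6 / 5 * q ^ (d + 1) := by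
    have h := card_le_of_mul_pointProb_le (show 2 ≤ q by linarith) (by omega) hx00 hupp
    rw [← hu, mul_sub] at h
    have h2 : x * u ^ 2 ≤ x * (1 / 10000) := mul_le_mul_of_nonneg_left hu2 hx00
    linarith
  obtain ⟨T, hTdef⟩ : ∃ T : ℝ, T = ∑ A ∈ Gr K V d, ((numBelow M A - 1 : ℕ) : ℝ) := ⟨_, rfl⟩
  obtain ⟨Λ, hΛdef⟩ : ∃ Λ : ℝ, Λ = ∑ p ∈ M.offDiag, (numBelow M (p.1 ⊔ p.2) : ℝ) := ⟨_, rfl⟩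
  rw [← hTdef] at hcs hT
  rw [← hΛdef] at hcs2
  rw [div_le_iff₀ hg0pos] at hT
  have hT0 : 0 ≤ T := by rw [hTdef]; exact sum_nonneg fun _ _ => Nat.cast_nonneg _
  have hΛ0 : 0 ≤ Λ := by rw [hΛdef]; exact sum_nonneg fun _ _ => Nat.cast_nonneg _
  have hΛ := le_of_variance_estimates hq huq hu0 hQq hp0 hpQ hx1 hlow (by linarith) rfl hΛ0
    hg2pos (gauss_nonneg hq1 _ _) (gauss_eq_pointProb_mul hq1 (by omega)) e2 e3 hT hT0
    (hcs.trans (mul_le_mul_of_nonneg_left hcs2 hT0))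
  -- On average at most 27 points of a joining line are not in M.
  have hmiss : ∑ p ∈ M.offDiag, (q + 1 - (numBelow M (p.1 ⊔ p.2) : ℝ)) ≤ 27 * x ^ 2 := by
    rw [sum_sub_distrib, ← hΛdef, sum_const, nsmul_eq_mul, card_offDiag_real, ← hx]
    have e : x * (x - 1) * (q + 1) - x * (x - 1) * (q - 26) = 27 * x ^ 2 - 27 * x := by ring
    linarith
  -- The proportion of bad sums is at most (27 + 1)/(q - 1), the 1 being for pairs with sum zero;
  -- this is at most 29u.
  have hbad2 : (#{p ∈ pointVectors M ×ˢ pointVectors M | p.1 + p.2 ∉ pointVectors M} : ℝ) ≤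
      29 * u * (#(pointVectors M) : ℝ) ^ 2 := by
    rw [hMt]
    refine hbad.trans ?_
    have h1 := mul_le_mul_of_nonneg_left hmiss (show 0 ≤ q - 1 by linarith)
    have h2 : x ≤ x ^ 2 := le_self_pow₀ hx1 (by norm_num)
    have h3 := mul_le_mul_of_nonneg_left h2 (show 0 ≤ q - 1 by linarith)
    have h4 : 28 ≤ 29 * u * (q - 1) := by
      have : 29 * u * (q - 1) = 29 * (u * q) - 29 * u := by ring
      rw [this, huq]; linarith
    have h5 : 28 * ((q - 1) * x ^ 2) ≤ 29 * u * (q - 1) * ((q - 1) * x ^ 2) :=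
      mul_le_mul_of_nonneg_right h4 (mul_nonneg (by linarith) (sq_nonneg x))
    calc _ ≤ 28 * ((q - 1) * x ^ 2) := by linarith
      _ ≤ _ := h5
      _ = _ := by ring
  have hne : (pointVectors M).Nonempty := by
    rw [← card_pos]
    have : (0 : ℝ) < #(pointVectors M) := by
      rw [hMt]; exact mul_pos (by linarith) (by linarith)
    exact_mod_cast this
  obtain ⟨U, hU1, hU2⟩ := exists_submodule_of_almost_closed (K := K) hne
    (fun c hc v hv => smul_mem_pointVectors hc hv) (η := 29 * u) (by linarith) hbad2
  rw [hpv, hMt] at hU1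
  rw [hUcard, hMt] at hU2
  have hout : (#{P ∈ M | ¬ P ≤ U} : ℝ) ≤ 232 * u * x := by
    have : (q - 1) * (#{P ∈ M | ¬ P ≤ U} : ℝ) ≤ (q - 1) * (232 * u * x) := by linarith
    exact le_of_mul_le_mul_left this (by linarith)
  have hout2 : 232 * u * x ≤ 280 * q ^ d := by
    have := mul_le_mul_of_nonneg_left hxupp hu0.le
    have e : u * (6 / 5 * q ^ (d + 1)) = 6 / 5 * q ^ d := by rw [← huQ]; ring
    have h0 : 0 < q ^ d := by positivity
    linarith
  have hpart : (#{P ∈ M | P ≤ U} : ℝ) + #{P ∈ M | ¬ P ≤ U} = x := by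
    rw [hx]
    exact_mod_cast card_filter_add_card_filter_not (s := M) (fun P => P ≤ U)
  have hpartU : (#{P ∈ Gr K V 1 | P ≤ U ∧ P ∉ M} : ℝ) + #{P ∈ M | P ≤ U} =
      gauss q (finrank K U) 1 := by
    have h3 := card_filter_add_card_filter_not (s := ({R ∈ Gr K V 1 | R ≤ U} : Finset _))
      (fun R => R ∈ M)
    rw [filter_filter, filter_filter] at h3
    have h4 : ({R ∈ Gr K V 1 | R ≤ U ∧ R ∈ M} : Finset _) = ({R ∈ M | R ≤ U} : Finset _) := by
      ext R
      simp only [mem_filter]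
      exact ⟨fun h => ⟨h.2.2, h.2.1⟩, fun h => ⟨hM h.1, h.2, h.1⟩⟩
    rw [h4] at h3
    rw [← hUpts, ← h3]
    push_cast
    ring
  -- A larger rank contradicts that U has at most 4/3 as many vectors as M provides; a smaller one,
  -- that most points of M lie in U.
  have hrank : finrank K U = d + 2 := by
    apply le_antisymm
    · by_contra hcon
      have h1 : q ^ (d + 3) ≤ q ^ finrank K U := pow_le_pow_right₀ hq1.le (by omega)
      have h2 : (q - 1) * x ≤ q * (6 / 5 * q ^ (d + 1)) :=
        mul_le_mul (by linarith) hxupp hx00 hq0.le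
      have e : q ^ (d + 3) = q * (q * q ^ (d + 1)) := by ring
      have h3 : 10000 * (q * q ^ (d + 1)) ≤ q * (q * q ^ (d + 1)) :=
        mul_le_mul_of_nonneg_right hq (by positivity)
      have h4 : 0 < q * q ^ (d + 1) := by positivity
      linarith
    · by_contra hcon
      have h1 : gauss q (finrank K U) 1 * (q - 1) ≤ q ^ (d + 1) - 1 := by
        rw [gauss_one_right, div_mul_cancel₀ _ (by linarith)]
        have : q ^ finrank K U ≤ q ^ (d + 1) := pow_le_pow_right₀ hq1.le (by omega)
        linarith
      have h2 : (0 : ℝ) ≤ #{P ∈ Gr K V 1 | P ≤ U ∧ P ∉ M} := Nat.cast_nonneg _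
      have h3 : (1 - 232 * u) * x ≤ gauss q (finrank K U) 1 := by linarith
      have h4 : 1 / 2 * q ^ (d + 1) ≤ gauss q (finrank K U) 1 := by
        refine le_trans ?_ h3
        have := mul_le_mul_of_nonneg_left hxlow (show 0 ≤ 1 - 232 * u by linarith)
        refine le_trans ?_ this
        rw [← mul_assoc]
        apply mul_le_mul_of_nonneg_right _ hQ0.le
        have : 0 ≤ u ^ 2 := sq_nonneg u
        linarith
      have h5 := mul_le_mul_of_nonneg_right h4 (show 0 ≤ q - 1 by linarith)
      have h6 : 1 / 2 * q ^ (d + 1) * 9999 ≤ 1 / 2 * q ^ (d + 1) * (q - 1) :=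
        mul_le_mul_of_nonneg_left (by linarith) (by positivity)
      linarith
  refine ⟨U, hrank, by have : 0 < q ^ d := by positivity
                       linarith, ?_⟩
  have hN : gauss q (d + 2) 1 ≤ (1 + 2 * u) * q ^ (d + 1) := by
    rw [gauss_one_right, div_le_iff₀ (by linarith)]
    have e : (1 + 2 * u) * q ^ (d + 1) * (q - 1) =
      q ^ (d + 2) + (2 * (u * q) - 1 - 2 * u) * q ^ (d + 1) := by ring
    rw [e, huq]
    have : 0 ≤ (2 * 1 - 1 - 2 * u) * q ^ (d + 1) := mul_nonneg (by linarith) hQ0.le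
    linarith
  rw [hrank] at hpartU
  have h0 : 0 < q ^ d := by positivity
  have e1 : (1 + 2 * u) * q ^ (d + 1) = q ^ (d + 1) + 2 * q ^ d := by rw [← huQ]; ring
  have e4 : (1 - u) * q ^ (d + 1) = q ^ (d + 1) - q ^ d := by rw [← huQ]; ring
  linarith

end Structure

/-! ### Subspaces with prescribed intersection with U, and tangent lines. -/

section Tangents

variable {K V : Type*} [Field K] [Finite K] [AddCommGroup V] [Module K V] [Module.Finite K V]

/-- Among the subspaces through Z, those that meet U in more than Z contain some E with Z < E ≤ U of
rank one more; these are removed by a union bound. -/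
theorem le_card_inf_eq {Z U : Submodule K V} (hZU : Z ≤ U) {s : ℕ} (hs : finrank K Z < s) :
    gauss (Nat.card K) (finrank K V - finrank K Z) (s - finrank K Z) ≤
      #{A ∈ Gr K V s | A ⊓ U = Z} + gauss (Nat.card K) (finrank K U - finrank K Z) 1 *
        gauss (Nat.card K) (finrank K V - (finrank K Z + 1)) (s - (finrank K Z + 1)) := by
  have hsub : ({A ∈ Gr K V s | Z ≤ A} : Finset _) ⊆ ({A ∈ Gr K V s | A ⊓ U = Z} : Finset _) ∪
      ({E ∈ Gr K V (finrank K Z + 1) | Z ≤ E ∧ E ≤ U} : Finset _).biUnion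
        (fun E => {A ∈ Gr K V s | E ≤ A}) := by
    intro A hA
    obtain ⟨h1, h2⟩ := mem_filter.1 hA
    rw [mem_union]
    by_cases h : A ⊓ U = Z
    · exact Or.inl (mem_filter.2 ⟨h1, h⟩)
    · right
      have hle : Z ≤ A ⊓ U := le_inf h2 hZU
      obtain ⟨E, e1, e2, e3⟩ := exists_between_finrank_succ hle (by
        by_contra hcon
        exact h (Submodule.eq_of_le_of_finrank_le hle (by omega)).symm)
      exact mem_biUnion.2 ⟨E, mem_filter.2 ⟨mem_Gr.2 e3, e1, e2.trans inf_le_right⟩,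
        mem_filter.2 ⟨h1, e2.trans inf_le_left⟩⟩
  rw [← card_Gr_ge Z hs.le]
  have h1 : (#({A ∈ Gr K V s | Z ≤ A} : Finset _) : ℝ) ≤ #{A ∈ Gr K V s | A ⊓ U = Z} +
      ∑ E ∈ Gr K V (finrank K Z + 1) with Z ≤ E ∧ E ≤ U, (#{A ∈ Gr K V s | E ≤ A} : ℝ) := by
    exact_mod_cast (card_le_card hsub).trans
      ((card_union_le _ _).trans (add_le_add le_rfl card_biUnion_le))
  refine h1.trans (add_le_add le_rfl (le_of_eq ?_))
  have h2 := card_Gr_between hZU (r := finrank K Z + 1) (by omega)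
  rw [Nat.add_sub_cancel_left] at h2
  rw [← h2, ← nsmul_eq_mul, ← sum_const]
  apply sum_congr rfl
  intro E hE
  have hE1 := mem_Gr.1 (mem_filter.1 hE).1
  rw [card_Gr_ge E (by omega), hE1]

theorem card_inf_eq_le {L L' U : Submodule K V} (hL : L ≤ U) (hL' : L' ≤ U)
    (h : finrank K L = finrank K L') (s : ℕ) :
    #{B ∈ Gr K V s | B ⊓ U = L} ≤ #{B ∈ Gr K V s | B ⊓ U = L'} := by
  obtain ⟨g, hg1, hg2⟩ := exists_linearEquiv_flag hL hL' h rfl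
  have hinj : Function.Injective (g : V →ₗ[K] V) := g.injective
  apply Finset.card_le_card_of_injOn (fun B => B.map (g : V →ₗ[K] V))
  · intro B hB
    obtain ⟨h1, h2⟩ := mem_filter.1 hB
    refine mem_filter.2 ⟨mem_Gr.2 ?_, ?_⟩
    · rw [← mem_Gr.1 h1]
      exact LinearEquiv.finrank_map_eq g B
    · nth_rw 1 [← hg2]
      rw [← Submodule.map_inf _ hinj, h2, hg1]
  · exact (Submodule.map_injective_of_injective hinj).injOn

theorem card_inf_eq_congr {L L' U : Submodule K V} (hL : L ≤ U) (hL' : L' ≤ U)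
    (h : finrank K L = finrank K L') (s : ℕ) :
    #{B ∈ Gr K V s | B ⊓ U = L} = #{B ∈ Gr K V s | B ⊓ U = L'} :=
  le_antisymm (card_inf_eq_le hL hL' h s) (card_inf_eq_le hL' hL h.symm s)

/-- The lines of `U` that contain exactly one point of `T`. -/
noncomputable def tangents (T : Finset (Submodule K V)) (U : Submodule K V) :
    Finset (Submodule K V) :=
  {L ∈ Gr K V 2 | L ≤ U ∧ numBelow T L = 1}

variable {T : Finset (Submodule K V)} {U : Submodule K V}

theorem mem_tangents {L : Submodule K V} :
    L ∈ tangents T U ↔ finrank K L = 2 ∧ L ≤ U ∧ numBelow T L = 1 := by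
  simp [tangents]

theorem exists_of_mem_tangents {L : Submodule K V} (hL : L ∈ tangents T U) :
    ∃ Q ∈ T, Q ≤ L ∧ ∀ R ∈ T, R ≤ L → R = Q := by
  obtain ⟨-, -, h⟩ := mem_tangents.1 hL
  obtain ⟨Q, hQ⟩ := card_eq_one.1 h
  have hQ' : Q ∈ ({P ∈ T | P ≤ L} : Finset _) := by rw [hQ]; exact mem_singleton_self Q
  obtain ⟨h1, h2⟩ := mem_filter.1 hQ'
  refine ⟨Q, h1, h2, fun R hR hRL => ?_⟩
  have : R ∈ ({P ∈ T | P ≤ L} : Finset _) := mem_filter.2 ⟨hR, hRL⟩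
  rw [hQ] at this
  exact mem_singleton.1 this

theorem card_tangents : #(tangents T U) = ∑ P ∈ T, #{L ∈ tangents T U | P ≤ L} := by
  have h : ∑ L ∈ tangents T U, #{P ∈ T | P ≤ L} = ∑ P ∈ T, #{L ∈ tangents T U | P ≤ L} :=
    Finset.sum_card_bipartiteAbove_eq_sum_card_bipartiteBelow (fun L P => P ≤ L)
  rw [← h, card_eq_sum_ones]
  apply sum_congr rfl
  intro L hL
  exact (mem_tangents.1 hL).2.2.symm

theorem eq_sup_of_le {P Q L : Submodule K V} (hP : finrank K P = 1) (hQ : finrank K Q = 1)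
    (hne : P ≠ Q) (hL : finrank K L = 2) (hPL : P ≤ L) (hQL : Q ≤ L) : P ⊔ Q = L :=
  Submodule.eq_of_le_of_finrank_le (sup_le hPL hQL) (by
    rw [finrank_sup_points hP hQ hne, hL])

/-- A line of U through P that is not tangent contains another point Q of T and equals P ⊔ Q, so at
most #T - 1 lines are lost. -/
theorem le_card_tangents_through (hT : T ⊆ Gr K V 1) {P : Submodule K V} (hPT : P ∈ T)
    (hPU : P ≤ U) :
    gauss (Nat.card K) (finrank K U - 1) 1 ≤ #{L ∈ tangents T U | P ≤ L} + ((#T : ℝ) - 1) := by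
  have hP := mem_Gr.1 (hT hPT)
  rw [← card_linesThrough hP hPU]
  have hsub : linesThrough P U ⊆ ({L ∈ tangents T U | P ≤ L} : Finset _) ∪
      (T.erase P).image (fun Q => P ⊔ Q) := by
    intro L hL
    obtain ⟨h1, h2, h3⟩ := mem_filter.1 hL
    rw [mem_union]
    by_cases h : ∃ Q ∈ T.erase P, Q ≤ L
    · obtain ⟨Q, hQ, hQL⟩ := h
      obtain ⟨hne, hQT⟩ := mem_erase.1 hQ
      exact Or.inr (mem_image.2 ⟨Q, hQ,
        eq_sup_of_le hP (mem_Gr.1 (hT hQT)) hne.symm (mem_Gr.1 h1) h2 hQL⟩)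
    · push Not at h
      refine Or.inl (mem_filter.2 ⟨mem_tangents.2 ⟨mem_Gr.1 h1, h3, ?_⟩, h2⟩)
      rw [numBelow, card_eq_one]
      refine ⟨P, ?_⟩
      ext Q
      rw [mem_filter, mem_singleton]
      constructor
      · rintro ⟨hQ, hQL⟩
        by_contra hne
        exact h Q (mem_erase.2 ⟨hne, hQ⟩) hQL
      · rintro rfl
        exact ⟨hPT, h2⟩
  have h1 := (card_le_card hsub).trans ((card_union_le _ _).trans
    (add_le_add le_rfl card_image_le))
  rw [card_erase_of_mem hPT] at h1
  have h2 : 1 ≤ #T := card_pos.2 ⟨P, hPT⟩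
  have h3 : (#(linesThrough P U) : ℝ) ≤ #{L ∈ tangents T U | P ≤ L} + ((#T - 1 : ℕ) : ℝ) := by
    exact_mod_cast h1
  rwa [Nat.cast_sub h2, Nat.cast_one] at h3

theorem le_card_tangents (hT : T ⊆ Gr K V 1) (hTU : ∀ P ∈ T, P ≤ U) :
    #T * (gauss (Nat.card K) (finrank K U - 1) 1 - ((#T : ℝ) - 1)) ≤ #(tangents T U) := by
  rw [card_tangents]
  push_cast
  rw [← nsmul_eq_mul, ← sum_const]
  apply sum_le_sum
  intro P hP
  have := le_card_tangents_through hT hP (hTU P hP)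
  linarith

theorem card_tangents_le (hT : T ⊆ Gr K V 1) {H : Submodule K V} {m : ℕ}
    (hm : finrank K ↥(U ⊓ H) ≤ m + 1) :
    (#{L ∈ tangents T U | L ≤ H} : ℝ) ≤ #T * gauss (Nat.card K) m 1 := by
  have hq := one_lt_natCard_real (K := K)
  have hsub : ({L ∈ tangents T U | L ≤ H} : Finset _) ⊆
      ({Q ∈ T | Q ≤ U ⊓ H} : Finset _).biUnion (fun Q => linesThrough Q (U ⊓ H)) := by
    intro L hL
    obtain ⟨h1, h2⟩ := mem_filter.1 hL
    obtain ⟨Q, hQT, hQL, -⟩ := exists_of_mem_tangents h1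
    obtain ⟨h3, h4, -⟩ := mem_tangents.1 h1
    have h5 : L ≤ U ⊓ H := le_inf h4 h2
    exact mem_biUnion.2 ⟨Q, mem_filter.2 ⟨hQT, hQL.trans h5⟩,
      mem_filter.2 ⟨mem_Gr.2 h3, hQL, h5⟩⟩
  have h1 : (#({L ∈ tangents T U | L ≤ H} : Finset _) : ℝ) ≤
      ∑ Q ∈ T with Q ≤ U ⊓ H, (#(linesThrough Q (U ⊓ H)) : ℝ) := by
    exact_mod_cast (card_le_card hsub).trans card_biUnion_le
  refine h1.trans ((sum_le_card_nsmul _ _ (gauss (Nat.card K) m 1) ?_).trans ?_)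
  · intro Q hQ
    obtain ⟨hQT, hQ'⟩ := mem_filter.1 hQ
    rw [card_linesThrough (mem_Gr.1 (hT hQT)) hQ']
    exact gauss_one_mono hq (by omega)
  · rw [nsmul_eq_mul]
    apply mul_le_mul_of_nonneg_right _ (gauss_nonneg hq _ _)
    exact_mod_cast card_filter_le _ _

/-- A tangent through P outside T is the join of P with its point of T. This keeps the set of lines
available to one pencil member small. -/
theorem card_tangents_through_le (hT : T ⊆ Gr K V 1) {P : Submodule K V} (hP : finrank K P = 1)
    (hPT : P ∉ T) : #{L ∈ tangents T U | P ≤ L} ≤ #T := by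
  have hsub : ({L ∈ tangents T U | P ≤ L} : Finset _) ⊆ T.image (fun Q => P ⊔ Q) := by
    intro L hL
    obtain ⟨h1, h2⟩ := mem_filter.1 hL
    obtain ⟨Q, hQT, hQL, -⟩ := exists_of_mem_tangents h1
    obtain ⟨h3, h4, -⟩ := mem_tangents.1 h1
    exact mem_image.2 ⟨Q, hQT, eq_sup_of_le hP (mem_Gr.1 (hT hQT))
      (by rintro rfl; exact hPT hQT) h3 h2 hQL⟩
  exact (card_le_card hsub).trans card_image_le

/-- Let Q be the point of T on the line B ∩ U. The hyperplanes of B through Q that do not contain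
this line meet U exactly in Q, and there are q^(d-1) of them. -/
theorem pow_le_card_inf_mem {d : ℕ} (hd : 2 ≤ d) (hT : T ⊆ Gr K V 1) {B : Submodule K V}
    (hB : finrank K B = d + 1) (hBU : B ⊓ U ∈ tangents T U) :
    (Nat.card K : ℝ) ^ (d - 1) ≤ #{A ∈ Gr K V d | A ≤ B ∧ A ⊓ U ∈ T} := by
  have hq := one_lt_natCard_real (K := K)
  obtain ⟨Q, hQT, hQL, -⟩ := exists_of_mem_tangents hBU
  obtain ⟨hL, -, -⟩ := mem_tangents.1 hBU
  have hQ := mem_Gr.1 (hT hQT)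
  have h1 := card_Gr_between (hQL.trans inf_le_left) (r := d) (by omega)
  have h2 := card_Gr_between (inf_le_left : B ⊓ U ≤ B) (r := d) (by omega)
  rw [hB, hQ, Nat.add_sub_cancel] at h1
  rw [hB, hL] at h2
  obtain ⟨e, rfl⟩ : ∃ e, d = e + 2 := ⟨d - 2, by omega⟩
  rw [show e + 2 - 1 = e + 1 by omega, gauss_succ_self hq] at h1
  rw [show e + 2 + 1 - 2 = e + 1 by omega, show e + 2 - 2 = e by omega, gauss_succ_self hq] at h2
  have hsub : ({A ∈ Gr K V (e + 2) | Q ≤ A ∧ A ≤ B} : Finset _) ⊆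
      ({A ∈ Gr K V (e + 2) | A ≤ B ∧ A ⊓ U ∈ T} : Finset _) ∪
      ({A ∈ Gr K V (e + 2) | B ⊓ U ≤ A ∧ A ≤ B} : Finset _) := by
    intro A hA
    obtain ⟨a1, a2, a3⟩ := mem_filter.1 hA
    rw [mem_union, mem_filter, mem_filter]
    by_cases h : B ⊓ U ≤ A
    · exact Or.inr ⟨a1, h, a3⟩
    · refine Or.inl ⟨a1, a3, ?_⟩
      have h3 : A ⊓ U ≤ B ⊓ U := inf_le_inf_right U a3
      have h4 : finrank K ↥(A ⊓ U) < 2 := by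
        by_contra hcon
        have h5 := Submodule.eq_of_le_of_finrank_le h3 (by omega)
        exact h (h5 ▸ inf_le_left)
      have h5 : Q = A ⊓ U :=
        Submodule.eq_of_le_of_finrank_le (le_inf a2 (hQL.trans inf_le_right)) (by omega)
      exact h5 ▸ hQT
  have h3 : (#({A ∈ Gr K V (e + 2) | Q ≤ A ∧ A ≤ B} : Finset _) : ℝ) ≤
      #({A ∈ Gr K V (e + 2) | A ≤ B ∧ A ⊓ U ∈ T} : Finset _) +
      #({A ∈ Gr K V (e + 2) | B ⊓ U ≤ A ∧ A ≤ B} : Finset _) := by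
    exact_mod_cast (card_le_card hsub).trans (card_union_le _ _)
  rw [h1, h2] at h3
  have h4 : ((Nat.card K : ℝ) ^ (e + 2) - 1) / (Nat.card K - 1) -
      ((Nat.card K : ℝ) ^ (e + 1) - 1) / (Nat.card K - 1) = (Nat.card K : ℝ) ^ (e + 1) := by
    have : (Nat.card K : ℝ) - 1 ≠ 0 := by linarith
    field_simp
    ring
  rw [show e + 2 - 1 = e + 1 by omega, ← h4]
  have h5 : e + 1 + 1 = e + 2 := rfl
  rw [h5] at h3
  linarith

end Tangents

/-! ### Missing points: the first count. -/

namespace FlagCover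

variable {K V : Type*} [Field K] [Finite K] [AddCommGroup V] [Module K V] [Module.Finite K V]
variable {d : ℕ} {α : ℝ} {ι₁ ι₂ ι₃ : Type*} [Fintype ι₁] [Fintype ι₂] [Fintype ι₃]
variable (c : FlagCover K V d α ι₁ ι₂ ι₃)

/-- The points of `U` whose point-pencil is not in the cover. -/
noncomputable def missing (U : Submodule K V) : Finset (Submodule K V) :=
  {P ∈ Gr K V 1 | P ≤ U ∧ P ∉ c.points}

theorem missing_subset (U : Submodule K V) : c.missing U ⊆ Gr K V 1 := filter_subset _ _

variable {c} {U : Submodule K V}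

theorem le_of_mem_missing {P : Submodule K V} (hP : P ∈ c.missing U) : P ≤ U :=
  (mem_filter.1 hP).2.1

theorem notMem_of_mem_missing {P : Submodule K V} (hP : P ∈ c.missing U) : P ∉ c.points :=
  (mem_filter.1 hP).2.2

/-- If A meets U only in a missing point, then no pencil point of U covers A; so the few pencil
points off U, and other members of the cover, are needed. -/
theorem not_le_of_inf_mem_missing {A P : Submodule K V} (hA : A ⊓ U ∈ c.missing U)
    (hP : P ∈ c.points) (hPA : P ≤ A) : ¬ P ≤ U := by
  intro hPU
  have h1 := mem_Gr.1 (c.points_subset hP)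
  have h2 := mem_Gr.1 (c.missing_subset U hA)
  have : P = A ⊓ U := Submodule.eq_of_le_of_finrank_le (le_inf hPA hPU) (by omega)
  exact notMem_of_mem_missing hA (this ▸ hP)

theorem sum_card_extra_le (hd : 3 ≤ d) (hV : finrank K V = 2 * d + 1)
    (hq : 3 ≤ (Nat.card K : ℝ)) : (#(univ.biUnion c.extra) : ℝ) ≤ Fintype.card ι₁ *
      (16 * (Nat.card K : ℝ) ^ (d ^ 2 - 3) * gauss (Nat.card K) (d + 1) 1) := by
  have h : (#(univ.biUnion c.extra) : ℝ) ≤ ∑ i, (#(c.extra i) : ℝ) := by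
    exact_mod_cast card_biUnion_le
  refine h.trans ((sum_le_card_nsmul _ _ _ (fun i _ => c.card_extra_le hd hV hq i)).trans ?_)
  rw [nsmul_eq_mul, card_univ]

theorem sum_card_dualExtra_le (hd : 3 ≤ d) (hV : finrank K V = 2 * d + 1)
    (hq : 3 ≤ (Nat.card K : ℝ)) : (#(univ.biUnion c.dualExtra) : ℝ) ≤ Fintype.card ι₂ *
      (16 * (Nat.card K : ℝ) ^ (d ^ 2 - 3) * gauss (Nat.card K) (d + 1) 1) := by
  have h : (#(univ.biUnion c.dualExtra) : ℝ) ≤ ∑ i, (#(c.dualExtra i) : ℝ) := by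
    exact_mod_cast card_biUnion_le
  refine h.trans ((sum_le_card_nsmul _ _ _ (fun i _ => c.card_dualExtra_le hd hV hq i)).trans ?_)
  rw [nsmul_eq_mul, card_univ]

theorem sum_card_small_le : (#(univ.biUnion c.C₃) : ℝ) ≤ Fintype.card ι₃ *
      (α * (Nat.card K : ℝ) ^ (d ^ 2 + d - 2)) := by
  have h : (#(univ.biUnion c.C₃) : ℝ) ≤ ∑ i, (#(c.C₃ i) : ℝ) := by
    exact_mod_cast card_biUnion_le
  refine h.trans ((sum_le_card_nsmul _ _ _ (fun i _ => c.card_le i)).trans ?_)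
  rw [nsmul_eq_mul, card_univ]

/-- Such a flag is covered by a pencil point P off U, and then A contains P ⊔ Q with Q missing, or
by a hyperplane, as an extra flag, or by a small set. -/
theorem card_flags_inf_mem_missing_le (hd : 3 ≤ d) (hV : finrank K V = 2 * d + 1)
    (hq : 3 ≤ (Nat.card K : ℝ)) :
    (#{f ∈ flags K V d | f.1 ⊓ U ∈ c.missing U} : ℝ) ≤
      #{P ∈ c.points | ¬ P ≤ U} * (#(c.missing U) *
        (gauss (Nat.card K) (d + 1) 1 * gauss (Nat.card K) (2 * d - 1) (d - 2))) +
      #c.hyperplanes * (gauss (Nat.card K) (d + 1) 1 * gauss (Nat.card K) (2 * d) (d + 1)) +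
      Fintype.card ι₁ *
        (16 * (Nat.card K : ℝ) ^ (d ^ 2 - 3) * gauss (Nat.card K) (d + 1) 1) +
      Fintype.card ι₂ *
        (16 * (Nat.card K : ℝ) ^ (d ^ 2 - 3) * gauss (Nat.card K) (d + 1) 1) +
      Fintype.card ι₃ * (α * (Nat.card K : ℝ) ^ (d ^ 2 + d - 2)) := by
  set S₁ := ({P ∈ c.points | ¬ P ≤ U} : Finset _).biUnion
    (fun P => (c.missing U).biUnion (fun Q => {f ∈ flags K V d | P ⊔ Q ≤ f.1})) with hS₁
  set S₂ := c.hyperplanes.biUnion (fun H => {f ∈ flags K V d | f.2 ≤ H}) with hS₂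
  have hsub : ({f ∈ flags K V d | f.1 ⊓ U ∈ c.missing U} : Finset _) ⊆
      (((S₁ ∪ S₂) ∪ univ.biUnion c.extra) ∪ univ.biUnion c.dualExtra) ∪ univ.biUnion c.C₃ := by
    intro f hf
    obtain ⟨h1, h2⟩ := mem_filter.1 hf
    rcases c.mem_cases h1 with ⟨P, hP, h⟩ | ⟨H, hH, h⟩ | ⟨i, h⟩ | ⟨i, h⟩ | ⟨i, h⟩
    · refine mem_union_left _ (mem_union_left _ (mem_union_left _ (mem_union_left _ ?_)))
      exact mem_biUnion.2 ⟨P, mem_filter.2 ⟨hP, not_le_of_inf_mem_missing h2 hP h⟩,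
        mem_biUnion.2 ⟨_, h2, mem_filter.2 ⟨h1, sup_le h inf_le_left⟩⟩⟩
    · refine mem_union_left _ (mem_union_left _ (mem_union_left _ (mem_union_right _ ?_)))
      exact mem_biUnion.2 ⟨H, hH, mem_filter.2 ⟨h1, h⟩⟩
    · refine mem_union_left _ (mem_union_left _ (mem_union_right _ ?_))
      exact mem_biUnion.2 ⟨i, mem_univ _, h⟩
    · exact mem_union_left _ (mem_union_right _ (mem_biUnion.2 ⟨i, mem_univ _, h⟩))
    · exact mem_union_right _ (mem_biUnion.2 ⟨i, mem_univ _, h⟩)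
  have h1 : (#({f ∈ flags K V d | f.1 ⊓ U ∈ c.missing U} : Finset _) : ℝ) ≤
      #S₁ + #S₂ + #(univ.biUnion c.extra) + #(univ.biUnion c.dualExtra) +
      #(univ.biUnion c.C₃) := by
    exact_mod_cast (card_le_card hsub).trans ((card_union_le _ _).trans (add_le_add
      ((card_union_le _ _).trans (add_le_add ((card_union_le _ _).trans (add_le_add
      (card_union_le _ _) le_rfl)) le_rfl)) le_rfl))
  refine h1.trans (add_le_add (add_le_add (add_le_add (add_le_add ?_ ?_)
    (sum_card_extra_le hd hV hq)) (sum_card_dualExtra_le hd hV hq)) sum_card_small_le)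
  · have h2 : (#S₁ : ℝ) ≤ ∑ P ∈ c.points with ¬ P ≤ U, ∑ Q ∈ c.missing U,
        (#{f ∈ flags K V d | P ⊔ Q ≤ f.1} : ℝ) := by
      exact_mod_cast card_biUnion_le.trans (sum_le_sum fun P _ => card_biUnion_le)
    refine h2.trans (le_of_eq ?_)
    rw [← nsmul_eq_mul, ← sum_const, ← nsmul_eq_mul, ← sum_const]
    refine sum_congr rfl fun P hP => sum_congr rfl fun Q hQ => ?_
    obtain ⟨hP1, hP2⟩ := mem_filter.1 hP
    have h3 : finrank K ↥(P ⊔ Q) = 2 :=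
      finrank_sup_points (mem_Gr.1 (c.points_subset hP1)) (mem_Gr.1 (c.missing_subset U hQ))
        (by rintro rfl; exact hP2 (le_of_mem_missing hQ))
    have h4 := card_flags_filter_fst_le (K := K) hV (fun A => P ⊔ Q ≤ A)
    rw [card_Gr_ge (P ⊔ Q) (by omega), h3, hV, show 2 * d + 1 - 2 = 2 * d - 1 by omega] at h4
    exact h4
  · have h2 : (#S₂ : ℝ) ≤ ∑ H ∈ c.hyperplanes, (#{f ∈ flags K V d | f.2 ≤ H} : ℝ) := by
      exact_mod_cast card_biUnion_le
    refine h2.trans (le_of_eq ?_)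
    rw [← nsmul_eq_mul, ← sum_const]
    refine sum_congr rfl fun H hH => ?_
    have h4 := card_flags_filter_snd_le (K := K) (V := V) (d := d) (fun B => B ≤ H)
    rw [card_Gr_le H, mem_Gr.1 (c.hyperplanes_subset hH)] at h4
    exact h4

/-- There are few missing points. -/
theorem card_missing_mul_le (hd : 3 ≤ d) (hV : finrank K V = 2 * d + 1)
    (hq : 3 ≤ (Nat.card K : ℝ)) (hα : 0 ≤ α) (hU : finrank K U = d + 2) :
    #(c.missing U) * (((Nat.card K : ℝ) - 4) * (Nat.card K : ℝ) ^ d) ≤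
      2 * (#{P ∈ c.points | ¬ P ≤ U} * #(c.missing U)) +
      2 * (#c.hyperplanes * (Nat.card K : ℝ) ^ (d + 1)) +
      16 * (((Fintype.card ι₁ : ℝ) + Fintype.card ι₂) * (Nat.card K : ℝ) ^ (d - 1)) +
      Fintype.card ι₃ * α * (Nat.card K : ℝ) ^ d := by
  have hup := card_flags_inf_mem_missing_le (c := c) (U := U) hd hV hq
  have hlow : (#{f ∈ flags K V d | f.1 ⊓ U ∈ c.missing U} : ℝ) =
      gauss (Nat.card K) (d + 1) 1 * #{A ∈ Gr K V d | A ⊓ U ∈ c.missing U} := by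
    convert card_flags_filter_fst_le (K := K) hV (fun A => A ⊓ U ∈ c.missing U)
  have hlow2 : #{A ∈ Gr K V d | A ⊓ U ∈ c.missing U} =
      ∑ P ∈ c.missing U, #{A ∈ Gr K V d | A ⊓ U = P} := by
    rw [Finset.card_eq_sum_card_fiberwise (f := fun A => A ⊓ U)
      (s := ({A ∈ Gr K V d | A ⊓ U ∈ c.missing U} : Finset _)) (t := c.missing U)
      (fun A hA => (mem_filter.1 hA).2)]
    refine sum_congr rfl fun P hP => ?_
    rw [filter_filter]
    congr 1
    ext A
    simp only [mem_filter]
    exact ⟨fun h => ⟨h.1, h.2.2⟩, fun h => ⟨h.1, h.2.symm ▸ hP, h.2⟩⟩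
  have hlow3 : ∀ P ∈ c.missing U, gauss (Nat.card K) (2 * d) (d - 1) ≤
      #{A ∈ Gr K V d | A ⊓ U = P} + gauss (Nat.card K) (d + 1) 1 *
        gauss (Nat.card K) (2 * d - 1) (d - 2) := by
    intro P hP
    have h1 := mem_Gr.1 (c.missing_subset U hP)
    have := le_card_inf_eq (le_of_mem_missing hP) (s := d) (by omega)
    rwa [h1, hU, hV, Nat.add_sub_cancel, show d + 2 - 1 = d + 1 by omega,
      show 2 * d + 1 - (1 + 1) = 2 * d - 1 by omega] at this
  obtain ⟨q, hqdef⟩ : ∃ q : ℝ, q = (Nat.card K : ℝ) := ⟨_, rfl⟩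
  simp_rw [← hqdef] at hq hup hlow hlow3 ⊢
  have hq1 : 1 < q := by linarith
  have hq0 : 0 < q := by linarith
  obtain ⟨e, rfl⟩ : ∃ e, d = e + 2 := ⟨d - 2, by omega⟩
  simp only [show e + 2 - 2 = e by omega, show e + 2 - 1 = e + 1 by omega,
    show 2 * (e + 2) - 1 = 2 * e + 3 by omega] at hup hlow3 ⊢
  -- With e = d - 2, this is q^((d-2)(d+1)), the order of the number of subspaces of rank d through
  -- a line; it is cancelled at the end.
  set Y := q ^ (e * (e + 3)) with hY
  have hY0 : 0 < Y := by positivity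
  have g1 : q ^ (e + 3) * Y ≤ gauss q (2 * (e + 2)) (e + 1) := by
    have := pow_le_gauss hq1 (e + 3) (e + 1)
    rw [show e + 3 + (e + 1) = 2 * (e + 2) by ring] at this
    rw [hY, ← pow_add]
    convert this using 2
    ring
  have g1' : gauss q (2 * (e + 2)) (e + 2 + 1) ≤ 2 * (q ^ (e + 3) * Y) := by
    have := gauss_le hq (e + 1) (e + 3)
    rw [show e + 1 + (e + 3) = 2 * (e + 2) by ring] at this
    rw [hY, ← pow_add]
    convert this using 3
    ring
  have g2 : gauss q (2 * e + 3) e ≤ 2 * Y := by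
    have := gauss_le hq (e + 3) e
    rwa [show e + 3 + e = 2 * e + 3 by ring] at this
  have g20 : 0 ≤ gauss q (2 * e + 3) e := gauss_nonneg hq1 _ _
  obtain ⟨w, hw⟩ : ∃ w, w = gauss q (e + 2 + 1) 1 := ⟨_, rfl⟩
  rw [← hw] at hup hlow hlow3
  have w1 : q ^ (e + 2) ≤ w := by
    have := pow_le_gauss hq1 (e + 2) 1
    rwa [one_mul, ← hw] at this
  have w2 : w ≤ 2 * q ^ (e + 2) := by
    have := gauss_le hq (e + 2) 1
    rwa [one_mul, ← hw] at this
  have hw0 : 0 < w := lt_of_lt_of_le (by positivity) w1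
  have p1 : q ^ ((e + 2) ^ 2 - 3) = q ^ (e + 1) * Y := by
    rw [hY, ← pow_add]
    congr 1
    have : (e + 2) ^ 2 = e + 1 + e * (e + 3) + 3 := by ring
    omega
  have p2 : q ^ ((e + 2) ^ 2 + (e + 2) - 2) = q ^ (e + 2) * q ^ (e + 2) * Y := by
    rw [hY, ← pow_add, ← pow_add]
    congr 1
    have : (e + 2) ^ 2 + (e + 2) = (e + 2) + (e + 2) + e * (e + 3) + 2 := by ring
    omega
  rw [p1, p2] at hup
  obtain ⟨k, hk⟩ : ∃ k : ℝ, k = #(c.missing U) := ⟨_, rfl⟩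
  obtain ⟨t, ht⟩ : ∃ t : ℝ, t = #{P ∈ c.points | ¬ P ≤ U} := ⟨_, rfl⟩
  obtain ⟨h, hh⟩ : ∃ h : ℝ, h = #c.hyperplanes := ⟨_, rfl⟩
  obtain ⟨n₁, hn₁⟩ : ∃ h : ℝ, h = Fintype.card ι₁ := ⟨_, rfl⟩
  obtain ⟨n₂, hn₂⟩ : ∃ h : ℝ, h = Fintype.card ι₂ := ⟨_, rfl⟩
  obtain ⟨n₃, hn₃⟩ : ∃ h : ℝ, h = Fintype.card ι₃ := ⟨_, rfl⟩
  have hk0 : 0 ≤ k := by rw [hk]; positivity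
  have ht0 : 0 ≤ t := by rw [ht]; positivity
  have hh0 : 0 ≤ h := by rw [hh]; positivity
  have hn0 : 0 ≤ n₃ := by rw [hn₃]; positivity
  have hlow4 : k * (q ^ (e + 3) * Y - w * (2 * Y)) ≤
      #{A ∈ Gr K V (e + 2) | A ⊓ U ∈ c.missing U} := by
    rw [hlow2, hk]
    push_cast
    rw [← nsmul_eq_mul, ← sum_const]
    apply sum_le_sum
    intro P hP
    have h1 := hlow3 P hP
    have h2 := mul_le_mul_of_nonneg_left g2 hw0.le
    linarith
  rw [hlow, ← hk, ← ht, ← hh, ← hn₁, ← hn₂, ← hn₃] at hup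
  rw [← hk, ← ht, ← hh, ← hn₁, ← hn₂, ← hn₃]
  have b1 : t * (k * (w * gauss q (2 * e + 3) e)) ≤ w * Y * (2 * (t * k)) := by
    have := mul_le_mul_of_nonneg_left g2 (mul_nonneg (mul_nonneg ht0 hk0) hw0.le)
    linarith
  have b2 : h * (w * gauss q (2 * (e + 2)) (e + 2 + 1)) ≤ w * Y * (2 * (h * q ^ (e + 3))) := by
    have := mul_le_mul_of_nonneg_left g1' (mul_nonneg hh0 hw0.le)
    linarith
  have b3 : n₃ * (α * (q ^ (e + 2) * q ^ (e + 2) * Y)) ≤ w * Y * (n₃ * α * q ^ (e + 2)) := by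
    have := mul_le_mul_of_nonneg_right w1 (show 0 ≤ n₃ * α * q ^ (e + 2) * Y by positivity)
    linarith
  -- The factor q - 4 is q minus 2·2: one 2 from the bound for `w`, one from the bound for `gauss q
  -- (2 * e + 3) e`.
  have b4 : w * Y * (k * ((q - 4) * q ^ (e + 2))) ≤ w * (k * (q ^ (e + 3) * Y - w * (2 * Y))) := by
    have h1 := mul_le_mul_of_nonneg_left w2 (show 0 ≤ w * k * (2 * Y) by positivity)
    have e1 : q ^ (e + 3) = q * q ^ (e + 2) := by ring
    rw [e1]
    linarith
  have b5 := mul_le_mul_of_nonneg_left hlow4 hw0.le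
  have hfin : w * Y * (k * ((q - 4) * q ^ (e + 2))) ≤ w * Y * (2 * (t * k) +
      2 * (h * q ^ (e + 2 + 1)) + 16 * ((n₁ + n₂) * q ^ (e + 1)) + n₃ * α * q ^ (e + 2)) := by
    rw [show e + 2 + 1 = e + 3 from rfl]
    linarith
  exact le_of_mul_le_mul_left hfin (mul_pos hw0 hY0)

end FlagCover

/-! ### Subspaces of rank d+1 that meet U in a tangent line. -/

section TangentSpaces

variable {K V : Type*} [Field K] [Finite K] [AddCommGroup V] [Module K V] [Module.Finite K V]
variable {d : ℕ} {T : Finset (Submodule K V)} {U : Submodule K V}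

/-- The subspaces of rank `d + 1` that meet `U` in a line with exactly one point in `T`. -/
noncomputable def tangentSpaces (d : ℕ) (T : Finset (Submodule K V)) (U : Submodule K V) :
    Finset (Submodule K V) :=
  {B ∈ Gr K V (d + 1) | B ⊓ U ∈ tangents T U}

theorem mem_tangentSpaces {B : Submodule K V} :
    B ∈ tangentSpaces d T U ↔ finrank K B = d + 1 ∧ B ⊓ U ∈ tangents T U := by
  simp [tangentSpaces]

/-- By transitivity the number of B with B ∩ U = L is the same for all lines L of U, so any
reference line L₀ serves. -/
theorem card_tangentSpaces {L₀ : Submodule K V} (hL₀ : L₀ ≤ U) (h2 : finrank K L₀ = 2) :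
    #(tangentSpaces d T U) = #(tangents T U) * #{B ∈ Gr K V (d + 1) | B ⊓ U = L₀} := by
  rw [Finset.card_eq_sum_card_fiberwise (f := fun B => B ⊓ U) (s := tangentSpaces d T U)
    (t := tangents T U) (fun B hB => (mem_tangentSpaces.1 hB).2), ← smul_eq_mul, ← sum_const]
  refine sum_congr rfl fun L hL => ?_
  obtain ⟨h3, h4, -⟩ := mem_tangents.1 hL
  rw [← card_inf_eq_congr h4 hL₀ (h3.trans h2.symm)]
  congr 1
  ext B
  simp only [mem_filter, mem_tangentSpaces, mem_Gr]
  exact ⟨fun h => ⟨h.1.1, h.2⟩, fun h => ⟨⟨h.1, h.2.symm ▸ hL⟩, h.2⟩⟩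

theorem card_tangentSpaces_ge_le (hd : 2 ≤ d) (hV : finrank K V = 2 * d + 1) {P : Submodule K V}
    (hP : finrank K P = 1) (hPU : ¬ P ≤ U) :
    (#{B ∈ tangentSpaces d T U | P ≤ B} : ℝ) ≤
      #(tangents T U) * gauss (Nat.card K) (2 * d - 2) (d - 2) := by
  have hsub : ({B ∈ tangentSpaces d T U | P ≤ B} : Finset _) ⊆
      (tangents T U).biUnion (fun L => {B ∈ Gr K V (d + 1) | L ⊔ P ≤ B}) := by
    intro B hB
    obtain ⟨h1, h2⟩ := mem_filter.1 hB
    obtain ⟨h3, h4⟩ := mem_tangentSpaces.1 h1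
    exact mem_biUnion.2 ⟨_, h4, mem_filter.2 ⟨mem_Gr.2 h3, sup_le inf_le_left h2⟩⟩
  have h1 : (#({B ∈ tangentSpaces d T U | P ≤ B} : Finset _) : ℝ) ≤
      ∑ L ∈ tangents T U, (#{B ∈ Gr K V (d + 1) | L ⊔ P ≤ B} : ℝ) := by
    exact_mod_cast (card_le_card hsub).trans card_biUnion_le
  refine h1.trans (le_of_eq ?_)
  rw [← nsmul_eq_mul, ← sum_const]
  refine sum_congr rfl fun L hL => ?_
  obtain ⟨h3, h4, -⟩ := mem_tangents.1 hL
  have h5 := finrank_sup_point hP (fun h => hPU (h.trans h4))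
  rw [h3] at h5
  rw [card_Gr_ge _ (by omega), h5, hV]
  congr 1

/-- If U ≤ H, then B and U meet inside H in rank at least 3, so no B is tangent. Otherwise the
tangent line lies in U ∩ H, of rank at most d+1, which has fewer tangents. -/
theorem card_tangentSpaces_le_le (hd : 2 ≤ d)
    (hT : T ⊆ Gr K V 1) (hU : finrank K U = d + 2) {H : Submodule K V}
    (hH : finrank K H = 2 * d) :
    (#{B ∈ tangentSpaces d T U | B ≤ H} : ℝ) ≤
      #T * gauss (Nat.card K) d 1 * gauss (Nat.card K) (2 * d - 2) (d - 1) := by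
  have hq := one_lt_natCard_real (K := K)
  by_cases hUH : U ≤ H
  · have : ({B ∈ tangentSpaces d T U | B ≤ H} : Finset _) = ∅ := by
      rw [eq_empty_iff_forall_notMem]
      intro B hB
      obtain ⟨h1, h2⟩ := mem_filter.1 hB
      obtain ⟨h3, h4⟩ := mem_tangentSpaces.1 h1
      have h5 := (mem_tangents.1 h4).1
      have h6 := Submodule.finrank_sup_add_finrank_inf_eq B U
      have h7 := Submodule.finrank_mono (sup_le h2 hUH)
      omega
    rw [this, card_empty, Nat.cast_zero]
    exact mul_nonneg (mul_nonneg (Nat.cast_nonneg _) (gauss_nonneg hq _ _)) (gauss_nonneg hq _ _)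
  have hinf : finrank K ↥(U ⊓ H) ≤ d + 1 := by
    by_contra hcon
    have := Submodule.eq_of_le_of_finrank_le (inf_le_left : U ⊓ H ≤ U) (by omega)
    exact hUH (inf_eq_left.1 this)
  have hsub : ({B ∈ tangentSpaces d T U | B ≤ H} : Finset _) ⊆
      ({L ∈ tangents T U | L ≤ H} : Finset _).biUnion
        (fun L => {B ∈ Gr K V (d + 1) | L ≤ B ∧ B ≤ H}) := by
    intro B hB
    obtain ⟨h1, h2⟩ := mem_filter.1 hB
    obtain ⟨h3, h4⟩ := mem_tangentSpaces.1 h1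
    exact mem_biUnion.2 ⟨_, mem_filter.2 ⟨h4, inf_le_left.trans h2⟩,
      mem_filter.2 ⟨mem_Gr.2 h3, inf_le_left, h2⟩⟩
  have h1 : (#({B ∈ tangentSpaces d T U | B ≤ H} : Finset _) : ℝ) ≤
      ∑ L ∈ tangents T U with L ≤ H, (#{B ∈ Gr K V (d + 1) | L ≤ B ∧ B ≤ H} : ℝ) := by
    exact_mod_cast (card_le_card hsub).trans card_biUnion_le
  refine h1.trans (le_trans (le_of_eq ?_) (mul_le_mul_of_nonneg_right
    (card_tangents_le (U := U) hT hinf) (gauss_nonneg hq _ _)))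
  rw [← nsmul_eq_mul, ← sum_const]
  refine sum_congr rfl fun L hL => ?_
  obtain ⟨h2, h3⟩ := mem_filter.1 hL
  obtain ⟨h4, -, -⟩ := mem_tangents.1 h2
  rw [card_Gr_between h3 (by omega), h4, hH]
  congr 1

/-- Each tangent space B supplies at least q^(d-1) flags (A, B) with A ∩ U in T. If all of these
must be in E, there are few such B. -/
theorem pow_mul_card_le (hd : 2 ≤ d) (hT : T ⊆ Gr K V 1) {R : Finset (Submodule K V)}
    (hR : R ⊆ tangentSpaces d T U) {E : Finset (Submodule K V × Submodule K V)}
    (hE : ∀ B ∈ R, ∀ A, (A, B) ∈ flags K V d → A ⊓ U ∈ T → (A, B) ∈ E) :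
    (Nat.card K : ℝ) ^ (d - 1) * #R ≤ #E := by
  have h1 : (∑ B ∈ R, (#{A ∈ Gr K V d | A ≤ B ∧ A ⊓ U ∈ T} : ℝ)) ≤ #E := by
    norm_cast
    rw [← card_sigma]
    apply Finset.card_le_card_of_injOn (fun x => (x.2, x.1))
    · rintro ⟨B, A⟩ hx
      obtain ⟨hB, hA⟩ := mem_sigma.1 hx
      obtain ⟨h1, h2, h3⟩ := mem_filter.1 hA
      exact hE B hB A (mem_flags.2 ⟨mem_Gr.1 h1, (mem_tangentSpaces.1 (hR hB)).1, h2⟩) h3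
    · rintro ⟨B, A⟩ - ⟨B', A'⟩ - h
      simp only [Prod.mk.injEq] at h
      obtain ⟨rfl, rfl⟩ := h
      rfl
  refine le_trans ?_ h1
  rw [mul_comm, ← nsmul_eq_mul, ← sum_const]
  refine sum_le_sum fun B hB => ?_
  obtain ⟨h2, h3⟩ := mem_tangentSpaces.1 (hR hB)
  exact pow_le_card_inf_mem hd hT h2 h3

end TangentSpaces

/-! ### Covering the tangent spaces. -/

namespace FlagCover

variable {K V : Type*} [Field K] [Finite K] [AddCommGroup V] [Module K V] [Module.Finite K V]
variable {d : ℕ} {α : ℝ} {ι₁ ι₂ ι₃ : Type*} [Fintype ι₁] [Fintype ι₂] [Fintype ι₃]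
variable {c : FlagCover K V d α ι₁ ι₂ ι₃} {U : Submodule K V}

/-- The point of the member lies in U but is not missing, so it is on at most as many tangents as
there are missing points. The tangent spaces in question are intersecting and meet U in these
tangents; hence they all lie on one tangent line, or they are few. -/
theorem card_extra_tangentSpaces_le (hd : 3 ≤ d) (hV : finrank K V = 2 * d + 1)
    (hq : 3 ≤ (Nat.card K : ℝ)) {L₀ : Submodule K V} (hL₀ : L₀ ≤ U) (h2 : finrank K L₀ = 2)
    {i : ι₁} (hi : c.P i ≤ U) :
    (#{B ∈ tangentSpaces d (c.missing U) U | ∃ A, (A, B) ∈ c.extra i} : ℝ) ≤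
      max (#{B ∈ Gr K V (d + 1) | B ⊓ U = L₀} : ℝ) (4 * (Nat.card K : ℝ) ^ (d ^ 2 - d - 1) +
      12 * #(c.missing U) * (Nat.card K : ℝ) ^ (d ^ 2 - d - 2)) := by
  set S : Finset (Submodule K V) :=
    {B ∈ tangentSpaces d (c.missing U) U | ∃ A, (A, B) ∈ c.extra i} with hS
  have hPi : c.P i ∉ c.missing U := fun h =>
    notMem_of_mem_missing h (mem_image_of_mem _ (mem_univ i))
  have hPS : ∀ B ∈ S, c.P i ≤ B := by
    intro B hB
    obtain ⟨-, A, hA⟩ := mem_filter.1 hB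
    exact c.P_le_snd hV (mem_filter.1 hA).1
  rcases card_intersecting_on_lines_le (S := S) hd hV hq (c.finrank_P i)
    (fun B hB => (mem_tangentSpaces.1 (mem_filter.1 hB).1).1) hPS (by
      intro B hB B' hB'
      obtain ⟨-, A, hA⟩ := mem_filter.1 hB
      obtain ⟨-, A', hA'⟩ := mem_filter.1 hB'
      exact c.two_le_finrank_inf hV hA hA') (U := U)
    (𝓛 := ({L ∈ tangents (c.missing U) U | c.P i ≤ L} : Finset _)) (by
      intro L hL
      obtain ⟨h3, h4⟩ := mem_filter.1 hL
      exact ⟨(mem_tangents.1 h3).1, h4⟩) (by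
      intro B hB
      exact mem_filter.2 ⟨(mem_tangentSpaces.1 (mem_filter.1 hB).1).2, le_inf (hPS B hB) hi⟩)
    with ⟨L, hL, h⟩ | h
  · refine le_trans ?_ (le_max_left _ _)
    obtain ⟨h3, h4, -⟩ := mem_tangents.1 (mem_filter.1 hL).1
    rw [← card_inf_eq_congr h4 hL₀ (h3.trans h2.symm)]
    norm_cast
    refine card_le_card fun B hB => mem_filter.2 ⟨mem_Gr.2 ?_, h B hB⟩
    exact (mem_tangentSpaces.1 (mem_filter.1 hB).1).1
  · refine (h.trans ?_).trans (le_max_right _ _)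
    have h3 : (#({L ∈ tangents (c.missing U) U | c.P i ≤ L} : Finset _) : ℝ) ≤
        #(c.missing U) := by
      exact_mod_cast card_tangents_through_le (c.missing_subset U) (c.finrank_P i) hPi
    gcongr

/-- No pencil point of U covers a flag (A, B) with A ∩ U missing. So a tangent space B lies on a
pencil point off U, or in a hyperplane, or occurs in an extra flag for a point of U, or else all its
flags of this kind are in dual extras and small sets. -/
theorem card_tangentSpaces_cover_le (hd : 3 ≤ d) (hV : finrank K V = 2 * d + 1)
    (hq : 3 ≤ (Nat.card K : ℝ)) (hU : finrank K U = d + 2) {b : ℝ} (hb : 0 ≤ b)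
    (hextra : ∀ i, c.P i ≤ U →
      (#{B ∈ tangentSpaces d (c.missing U) U | ∃ A, (A, B) ∈ c.extra i} : ℝ) ≤ b) :
    (#(tangentSpaces d (c.missing U) U) : ℝ) ≤ Fintype.card ι₁ * b +
      #{P ∈ c.points | ¬ P ≤ U} *
        (#(tangents (c.missing U) U) * gauss (Nat.card K) (2 * d - 2) (d - 2)) +
      Fintype.card ι₂ * (#(c.missing U) * gauss (Nat.card K) d 1 *
        gauss (Nat.card K) (2 * d - 2) (d - 1)) +
      (Fintype.card ι₂ *
        (16 * (Nat.card K : ℝ) ^ (d ^ 2 - 3) * gauss (Nat.card K) (d + 1) 1) +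
      Fintype.card ι₃ * (α * (Nat.card K : ℝ) ^ (d ^ 2 + d - 2))) /
        (Nat.card K : ℝ) ^ (d - 1) := by
  have hq1 := one_lt_natCard_real (K := K)
  set 𝓑 := tangentSpaces d (c.missing U) U with h𝓑
  set S₁ := ({i | c.P i ≤ U} : Finset ι₁).biUnion
    (fun i => {B ∈ 𝓑 | ∃ A, (A, B) ∈ c.extra i}) with hS₁
  set S₂ := ({P ∈ c.points | ¬ P ≤ U} : Finset _).biUnion (fun P => {B ∈ 𝓑 | P ≤ B}) with hS₂
  set S₃ := c.hyperplanes.biUnion (fun H => {B ∈ 𝓑 | B ≤ H}) with hS₃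
  set E := univ.biUnion c.dualExtra ∪ univ.biUnion c.C₃ with hE
  set R : Finset (Submodule K V) :=
    {B ∈ 𝓑 | ∀ A, (A, B) ∈ flags K V d → A ⊓ U ∈ c.missing U → (A, B) ∈ E} with hR
  have hsub : 𝓑 ⊆ ((S₁ ∪ S₂) ∪ S₃) ∪ R := by
    intro B hB
    by_contra hcon
    simp only [mem_union, not_or] at hcon
    obtain ⟨⟨⟨h1, h2⟩, h3⟩, h4⟩ := hcon
    apply h4
    refine mem_filter.2 ⟨hB, fun A hA hAU => ?_⟩
    rcases c.mem_cases hA with ⟨P, hP, h⟩ | ⟨H, hH, h⟩ | ⟨i, h⟩ | ⟨i, h⟩ | ⟨i, h⟩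
    · exact absurd (mem_biUnion.2 ⟨P, mem_filter.2 ⟨hP, not_le_of_inf_mem_missing hAU hP h⟩,
        mem_filter.2 ⟨hB, h.trans (mem_flags.1 hA).2.2⟩⟩) h2
    · exact absurd (mem_biUnion.2 ⟨H, hH, mem_filter.2 ⟨hB, h⟩⟩) h3
    · by_cases hi : c.P i ≤ U
      · exact absurd (mem_biUnion.2 ⟨i, mem_filter.2 ⟨mem_univ _, hi⟩,
          mem_filter.2 ⟨hB, A, h⟩⟩) h1
      · exact absurd (mem_biUnion.2 ⟨c.P i, mem_filter.2 ⟨mem_image_of_mem _ (mem_univ i), hi⟩,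
          mem_filter.2 ⟨hB, c.P_le_snd hV (mem_filter.1 h).1⟩⟩) h2
    · exact mem_union_left _ (mem_biUnion.2 ⟨i, mem_univ _, h⟩)
    · exact mem_union_right _ (mem_biUnion.2 ⟨i, mem_univ _, h⟩)
  have h0 : (#𝓑 : ℝ) ≤ #S₁ + #S₂ + #S₃ + #R := by
    exact_mod_cast (card_le_card hsub).trans ((card_union_le _ _).trans (add_le_add
      ((card_union_le _ _).trans (add_le_add (card_union_le _ _) le_rfl)) le_rfl))
  refine h0.trans (add_le_add (add_le_add (add_le_add ?_ ?_) ?_) ?_)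
  · have h1 : (#S₁ : ℝ) ≤ ∑ i with c.P i ≤ U, (#{B ∈ 𝓑 | ∃ A, (A, B) ∈ c.extra i} : ℝ) := by
      exact_mod_cast card_biUnion_le
    refine h1.trans ((sum_le_card_nsmul _ _ b fun i hi => hextra i (mem_filter.1 hi).2).trans ?_)
    rw [nsmul_eq_mul]
    apply mul_le_mul_of_nonneg_right _ hb
    exact_mod_cast card_filter_le _ _
  · have h1 : (#S₂ : ℝ) ≤ ∑ P ∈ c.points with ¬ P ≤ U, (#{B ∈ 𝓑 | P ≤ B} : ℝ) := by
      exact_mod_cast card_biUnion_le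
    refine h1.trans ((sum_le_card_nsmul _ _ _ fun P hP => ?_).trans (nsmul_eq_mul _ _).le)
    obtain ⟨hP1, hP2⟩ := mem_filter.1 hP
    exact card_tangentSpaces_ge_le (by omega) hV (mem_Gr.1 (c.points_subset hP1)) hP2
  · have h1 : (#S₃ : ℝ) ≤ ∑ H ∈ c.hyperplanes, (#{B ∈ 𝓑 | B ≤ H} : ℝ) := by
      exact_mod_cast card_biUnion_le
    refine h1.trans ((sum_le_card_nsmul _ _ _ fun H hH => card_tangentSpaces_le_le (by omega)
      (c.missing_subset U) hU (mem_Gr.1 (c.hyperplanes_subset hH))).trans ?_)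
    rw [nsmul_eq_mul]
    apply mul_le_mul_of_nonneg_right _ (mul_nonneg (mul_nonneg (Nat.cast_nonneg _)
      (gauss_nonneg hq1 _ _)) (gauss_nonneg hq1 _ _))
    exact_mod_cast c.card_hyperplanes_le
  · rw [le_div_iff₀ (by positivity), mul_comm]
    refine (pow_mul_card_le (by omega) (c.missing_subset U) (filter_subset _ _)
      (fun B hB => (mem_filter.1 hB).2)).trans ?_
    have h1 : (#E : ℝ) ≤ #(univ.biUnion c.dualExtra) + #(univ.biUnion c.C₃) := by
      exact_mod_cast card_union_le _ _
    exact h1.trans (add_le_add (sum_card_dualExtra_le hd hV hq) sum_card_small_le)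

end FlagCover

/-! ### Numerical consequences for the number of missing points. -/

section MissingEstimates

/-- With Q = q^d and Δ = dα, the first count improves k ≤ 300Q to k = O(ΔQ/q): its left side has
order kqQ, while the right side is dominated by a term of order ΔQ². -/
theorem missing_le_first {q u Q Δ α k t h n₁₂ n₃ : ℝ} (huq : u * q = 1) (hu0 : 0 < u)
    (hα : 5 ≤ α) (hΔ : 3 * α ≤ Δ) (hsmall : Δ * u ≤ 1 / 10 ^ 6) (hQ : 0 < Q)
    (hk0 : 0 ≤ k) (hk : k ≤ 300 * Q) (htk : t ≤ k) (hn : n₁₂ ≤ 2 * (q * Q)) (hn₃ : n₃ ≤ k)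
    (hh : h * (1 - u ^ 2) ≤ 100 * Δ * u ^ 2 * (q * Q)) (hh0 : 0 ≤ h)
    (hmain : k * ((q - 4) * Q) ≤ 2 * (t * k) + 2 * (h * (q * Q)) + 16 * (n₁₂ * (u * Q)) +
      n₃ * α * Q) :
    k ≤ 220 * Δ * u * Q := by
  have hq0 : 0 < q := by
    by_contra hcon
    have := mul_nonpos_of_nonneg_of_nonpos hu0.le (not_lt.1 hcon)
    linarith
  have hΔ15 : 15 ≤ Δ := by linarith
  have hu1 : u ≤ 1 / (15 * 10 ^ 6) := by
    have := mul_le_mul_of_nonneg_right hΔ15 hu0.le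
    linarith
  have hαu : α * u ≤ 1 / (3 * 10 ^ 6) := by
    have := mul_le_mul_of_nonneg_right hΔ hu0.le
    linarith
  have hu2 : u ^ 2 ≤ 1 / 1000 := by
    have : u * u ≤ 1 * (1 / 1000) := mul_le_mul (by linarith) (by linarith) hu0.le (by norm_num)
    rw [sq]; linarith
  have h1 : h ≤ 101 * (Δ * u * Q) := by
    have e : 100 * Δ * u ^ 2 * (q * Q) = 100 * (Δ * u * Q) * (u * q) := by ring
    rw [e, huq] at hh
    have := mul_le_mul_of_nonneg_left hu2 hh0
    have h0 : 0 ≤ Δ * u * Q := by positivity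
    linarith
  have h2 : h * (q * Q) ≤ 101 * Δ * Q * Q := by
    have := mul_le_mul_of_nonneg_right h1 (show 0 ≤ q * Q by positivity)
    have e : 101 * (Δ * u * Q) * (q * Q) = 101 * Δ * Q * Q * (u * q) := by ring
    rw [e, huq] at this
    linarith
  have h3 : n₁₂ * (u * Q) ≤ 2 * Q * Q := by
    have := mul_le_mul_of_nonneg_right hn (show 0 ≤ u * Q by positivity)
    have e : 2 * (q * Q) * (u * Q) = 2 * Q * Q * (u * q) := by ring
    rw [e, huq] at this
    linarith
  have h4 : t * k ≤ 300 * Q * k := mul_le_mul_of_nonneg_right (htk.trans hk) hk0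
  have h5 : n₃ * α * Q ≤ k * α * Q :=
    mul_le_mul_of_nonneg_right (mul_le_mul_of_nonneg_right hn₃ (by linarith)) hQ.le
  have h6 : (k * (q - 604 - α)) * Q ≤ ((202 * Δ + 32) * Q) * Q := by linarith
  have h7 := mul_le_mul_of_nonneg_right (le_of_mul_le_mul_right h6 hQ) hu0.le
  have e : k * (q - 604 - α) * u = k * (u * q - 604 * u - α * u) := by ring
  rw [e, huq] at h7
  have h8 : k * (999 / 1000) ≤ k * (1 - 604 * u - α * u) :=
    mul_le_mul_of_nonneg_left (by linarith) hk0
  have h9 : 15 * (u * Q) ≤ Δ * (u * Q) := mul_le_mul_of_nonneg_right hΔ15 (by positivity)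
  have h10 : 0 < u * Q := by positivity
  linarith

/-- There are at least k(w - k + 1) tangents, each with about β tangent spaces, whereas a pencil
member covers at most β of these, or a lower-order number. With n₁ ≤ N - q this falls short as soon
as k > q. -/
theorem missing_le_second {q u Q Δ α k t n₁ n₂ n₃ w N l β : ℝ} (huq : u * q = 1) (hu0 : 0 < u)
    (hα : 5 ≤ α) (hΔ : 3 * α ≤ Δ) (hsmall : Δ * u ≤ 1 / 10 ^ 6) (hQ : q ^ 3 ≤ Q)
    (hk : k ≤ 220 * Δ * u * Q) (ht0 : 0 ≤ t) (hn₁ : 0 ≤ n₁) (hn₂ : 0 ≤ n₂)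
    (hn₃ : 0 ≤ n₃) (hk1 : q + 1 ≤ k) (hothers : t + n₂ + n₃ ≤ k - q) (hn₁N : n₁ ≤ N - q)
    (hN : N = q * w + 1) (hwQ : Q ≤ w) (hNQ : N ≤ 2 * (q * Q))
    (hl : k * (w - (k - 1)) ≤ l) (hl2 : l ≤ 2 * (k * Q)) (hβ : Q * (1 - 4 * u) ≤ β)
    (hmain : l * β ≤ n₁ * max β (4 * u * Q + 12 * k * u ^ 2 * Q) + t * (l * 2) +
      n₂ * (4 * k * Q) + n₂ * (32 * u ^ 2 * Q ^ 2) + n₃ * (α * u * Q ^ 2)) : False := by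
  have hq0 : 0 < q := by
    by_contra hcon
    have := mul_nonpos_of_nonneg_of_nonpos hu0.le (not_lt.1 hcon)
    linarith
  have hQ0 : 0 < Q := lt_of_lt_of_le (by positivity) hQ
  have hΔ15 : 15 ≤ Δ := by linarith
  have hu1 : u ≤ 1 / (15 * 10 ^ 6) := by
    have := mul_le_mul_of_nonneg_right hΔ15 hu0.le
    linarith
  have hq1 : 15 * 10 ^ 6 ≤ q := by
    have := mul_le_mul_of_nonneg_right hu1 hq0.le
    rw [huq] at this
    linarith
  have hk0 : 0 < k := by linarith
  have hkQ : k ≤ 220 / 10 ^ 6 * Q := by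
    have := mul_le_mul_of_nonneg_right hsmall (show 0 ≤ 220 * Q by positivity)
    linarith
  have hβQ : Q ≤ 2 * β := by
    have := mul_le_mul_of_nonneg_left hu1 hQ0.le
    linarith
  have hβ0 : 0 < β := by linarith
  have hmax : max β (4 * u * Q + 12 * k * u ^ 2 * Q) ≤ β * max 1 (8 * u + 24 * k * u ^ 2) := by
    apply max_le
    · exact le_mul_of_one_le_right hβ0.le (le_max_left _ _)
    · refine le_trans ?_ (mul_le_mul_of_nonneg_left (le_max_right _ _) hβ0.le)
      have := mul_le_mul_of_nonneg_right hβQ (show 0 ≤ 4 * u + 12 * k * u ^ 2 by positivity)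
      linarith
  obtain ⟨μ, hμ⟩ : ∃ μ, μ = max 1 (8 * u + 24 * k * u ^ 2) := ⟨_, rfl⟩
  rw [← hμ] at hmax
  -- Divided by β: a pencil member accounts for at most μ tangents. Points off U, dual members and
  -- small sets, at most k - q in all, account for at most Q/500 each.
  have hred : l ≤ n₁ * μ + (k - q) * (Q / 500) := by
    have a1 : n₁ * max β (4 * u * Q + 12 * k * u ^ 2 * Q) ≤ n₁ * μ * β := by
      have := mul_le_mul_of_nonneg_left hmax hn₁
      linarith
    have a2 : t * (l * 2) ≤ t * (8 * k) * β := by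
      have h1 := mul_le_mul_of_nonneg_left hl2 ht0
      have h2 := mul_le_mul_of_nonneg_left hβQ (mul_nonneg ht0 hk0.le)
      linarith
    have a3 : n₂ * (4 * k * Q) ≤ n₂ * (8 * k) * β := by
      have h2 := mul_le_mul_of_nonneg_left hβQ (mul_nonneg hn₂ hk0.le)
      linarith
    have a4 : n₂ * (32 * u ^ 2 * Q ^ 2) ≤ n₂ * (64 * u ^ 2 * Q) * β := by
      have h2 := mul_le_mul_of_nonneg_left hβQ (show 0 ≤ n₂ * (32 * u ^ 2 * Q) by positivity)
      linarith
    have a5 : n₃ * (α * u * Q ^ 2) ≤ n₃ * (2 * α * u * Q) * β := by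
      have h2 := mul_le_mul_of_nonneg_left hβQ (show 0 ≤ n₃ * (α * u * Q) by positivity)
      linarith
    have h1 : l * β ≤ (n₁ * μ + t * (8 * k) + n₂ * (8 * k) + n₂ * (64 * u ^ 2 * Q) +
        n₃ * (2 * α * u * Q)) * β := by linarith
    have h2 := le_of_mul_le_mul_right h1 hβ0
    have b1 : 8 * k ≤ Q / 500 := by linarith
    have hu2 : u ^ 2 ≤ 1 / 10 ^ 6 := by
      have : u * u ≤ 1 * (1 / 10 ^ 6) :=
        mul_le_mul (by linarith) (by linarith) hu0.le (by norm_num)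
      rw [sq]; linarith
    have b2 : 8 * k + 64 * u ^ 2 * Q ≤ Q / 500 := by
      have := mul_le_mul_of_nonneg_right hu2 hQ0.le
      linarith
    have b3 : 2 * α * u * Q ≤ Q / 500 := by
      have h3 : α * u ≤ 1 / 10 ^ 6 := by
        have := mul_le_mul_of_nonneg_right hΔ hu0.le
        linarith
      have := mul_le_mul_of_nonneg_right h3 hQ0.le
      linarith
    have c1 := mul_le_mul_of_nonneg_left b1 ht0
    have c2 := mul_le_mul_of_nonneg_left b2 hn₂
    have c3 := mul_le_mul_of_nonneg_left b3 hn₃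
    have c4 := mul_le_mul_of_nonneg_right hothers (show 0 ≤ Q / 500 by positivity)
    linarith
  -- If μ = 1, then 24k ≤ q², and (k - q)w is bounded by k² plus a small fraction of (k - q)Q,
  -- impossible since w ≥ Q ≥ q³. Otherwise n₁μ is of order Q + kuQ, far below kw.
  rcases le_total (8 * u + 24 * k * u ^ 2) 1 with hA | hB
  · rw [max_eq_left hA] at hμ
    rw [hμ, mul_one] at hred
    obtain ⟨j, hj⟩ : ∃ j, j = k - q := ⟨_, rfl⟩
    have hj1 : 1 ≤ j := by linarith
    have hkq : 24 * k ≤ q ^ 2 := by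
      have h1 : 24 * k * u ^ 2 ≤ 1 := by linarith
      have h2 := mul_le_mul_of_nonneg_right h1 (show 0 ≤ q ^ 2 by positivity)
      have e : 24 * k * u ^ 2 * q ^ 2 = 24 * k * (u * q) ^ 2 := by ring
      rw [e, huq] at h2
      linarith
    have h1 : (k - q) * w ≤ k * k + (k - q) * (Q / 500) := by linarith
    rw [← hj] at h1
    have h2 : j * Q ≤ j * w := mul_le_mul_of_nonneg_left hwQ (by linarith)
    have h3 : j * q ^ 3 ≤ j * Q := mul_le_mul_of_nonneg_left hQ (by linarith)
    have h4 : k * j ≤ q ^ 2 * j := mul_le_mul_of_nonneg_right (by linarith) (by linarith)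
    have h5 : q * q ≤ j * (q * q) := le_mul_of_one_le_left (by positivity) hj1
    have h6 : j * q ≤ j * (q * q) :=
      mul_le_mul_of_nonneg_left (le_mul_of_one_le_left hq0.le (by linarith)) (by linarith)
    have h7 : j * (15 * 10 ^ 6) * (q * q) ≤ j * q * (q * q) :=
      mul_le_mul_of_nonneg_right (mul_le_mul_of_nonneg_left hq1 (by linarith)) (by positivity)
    have e1 : k * k = k * j + j * q + q * q := by rw [hj]; ring
    have h8 : j * (q * q) > 0 := mul_pos (by linarith) (by positivity)
    have h9 : q ^ 2 * j = j * (q * q) := by ring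
    have h10 : j * q ^ 3 = j * q * (q * q) := by ring
    nlinarith only [h1, h2, h3, h4, h5, h6, h7, h8, h9, h10, e1, hj1]
  · rw [max_eq_right hB] at hμ
    have h1 : n₁ * μ ≤ 16 * Q + 48 * k * u * Q := by
      have h2 : n₁ ≤ 2 * (q * Q) := by linarith
      have h3 : 0 ≤ 8 * u + 24 * k * u ^ 2 := by positivity
      have h4 := mul_le_mul_of_nonneg_right h2 h3
      have e : 2 * (q * Q) * (8 * u + 24 * k * u ^ 2) =
        16 * Q * (u * q) + 48 * k * u * Q * (u * q) := by ring
      rw [e, huq] at h4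
      rw [hμ]; linarith
    have hk2 : 10 ^ 6 ≤ k := by linarith
    have h5 : k * (k - 1) ≤ k * (220 / 10 ^ 6 * Q) :=
      mul_le_mul_of_nonneg_left (by linarith) hk0.le
    have h6 : k * Q ≤ k * w := mul_le_mul_of_nonneg_left hwQ hk0.le
    have h7 : k * u * Q ≤ 1 / (15 * 10 ^ 6) * (k * Q) := by
      have := mul_le_mul_of_nonneg_right hu1 (show 0 ≤ k * Q by positivity)
      linarith
    have h8 : 10 ^ 6 * Q ≤ k * Q := mul_le_mul_of_nonneg_right hk2 hQ0.le
    have h9 : 0 < q * Q := by positivity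
    linarith

end MissingEstimates

/-! ### At most q points are missing, and the structure of the cover. -/

namespace FlagCover

variable {K V : Type*} [Field K] [Finite K] [AddCommGroup V] [Module K V] [Module.Finite K V]
variable {d : ℕ} {α : ℝ} {ι₁ ι₂ ι₃ : Type*} [Fintype ι₁] [Fintype ι₂] [Fintype ι₃]
variable {c : FlagCover K V d α ι₁ ι₂ ι₃} {U : Submodule K V}

theorem card_missing_add_card (U : Submodule K V) :
    (#(c.missing U) : ℝ) + #c.points =
      gauss (Nat.card K) (finrank K U) 1 + #{P ∈ c.points | ¬ P ≤ U} := by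
  have h3 := card_filter_add_card_filter_not (s := ({R ∈ Gr K V 1 | R ≤ U} : Finset _))
    (fun R => R ∈ c.points)
  rw [filter_filter, filter_filter] at h3
  have h4 : ({R ∈ Gr K V 1 | R ≤ U ∧ R ∈ c.points} : Finset _) =
      ({R ∈ c.points | R ≤ U} : Finset _) := by
    ext R
    simp only [mem_filter]
    exact ⟨fun h => ⟨h.2.2, h.2.1⟩, fun h => ⟨c.points_subset h.1, h.2, h.1⟩⟩
  rw [h4] at h3
  have h5 := card_filter_add_card_filter_not (s := c.points) (fun R => R ≤ U)
  rw [← card_Gr_le U 1, ← h3, ← h5, missing]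
  push_cast
  ring

/-- Supposing more than q missing points, the two counts, for flags at missing points and for
tangent spaces, are combined. -/
theorem card_missing_le (hd : 3 ≤ d) (hV : finrank K V = 2 * d + 1)
    (hα : 5 ≤ α) (hsmall : d * α * (Nat.card K : ℝ)⁻¹ ≤ 1 / 10 ^ 6)
    (hcard : (Fintype.card ι₁ : ℝ) + Fintype.card ι₂ + Fintype.card ι₃ + Nat.card K ≤
      gauss (Nat.card K) (d + 2) 1)
    (hyp : #c.hyperplanes * pointProb (Nat.card K) d ≤ 100 * (d * α) * (Nat.card K : ℝ)⁻¹ ^ 2)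
    (hU : finrank K U = d + 2)
    (hmiss : (#(c.missing U) : ℝ) ≤ 300 * (Nat.card K : ℝ) ^ d) :
    #(c.missing U) ≤ Nat.card K := by
  by_contra hcon
  have hk1 : (Nat.card K : ℝ) + 1 ≤ #(c.missing U) := by
    exact_mod_cast Nat.succ_le_of_lt (not_le.1 hcon)
  have hd3 : (3 : ℝ) ≤ d := by exact_mod_cast hd
  have hq1 := one_lt_natCard_real (K := K)
  have hq : 15 * 10 ^ 6 ≤ (Nat.card K : ℝ) := by
    have h1 : 15 * (Nat.card K : ℝ)⁻¹ ≤ d * α * (Nat.card K : ℝ)⁻¹ :=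
      mul_le_mul_of_nonneg_right (by nlinarith) (by positivity)
    have h2 : (15 * 10 ^ 6) * (Nat.card K : ℝ)⁻¹ ≤ 1 := by linarith
    rwa [← div_eq_mul_inv, div_le_one (by linarith)] at h2
  obtain ⟨L₀, -, hL₀, hL₀2⟩ : ∃ E, (⊥ : Submodule K V) ≤ E ∧ E ≤ U ∧ finrank K E = 2 := by
    obtain ⟨E, e1, e2, e3⟩ := exists_between_finrank_succ (bot_le : (⊥ : Submodule K V) ≤ U)
      (by rw [finrank_bot]; omega)
    rw [finrank_bot] at e3
    obtain ⟨F, f1, f2, f3⟩ := exists_between_finrank_succ e2 (by omega)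
    exact ⟨F, bot_le, f2, by omega⟩
  have hfirst := card_missing_mul_le (c := c) (U := U) hd hV (by linarith) (by linarith) hU
  have hpart := card_missing_add_card (c := c) U
  rw [hU] at hpart
  have hpts : (#c.points : ℝ) ≤ Fintype.card ι₁ := by exact_mod_cast c.card_points_le
  have hhyp : (#c.hyperplanes : ℝ) * (1 - (Nat.card K : ℝ)⁻¹ ^ 2) ≤
      100 * (d * α) * (Nat.card K : ℝ)⁻¹ ^ 2 * (Nat.card K : ℝ) ^ (d + 1) :=
    card_le_of_mul_pointProb_le (by linarith) (by omega) (Nat.cast_nonneg _) hyp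
  have hcov := card_tangentSpaces_cover_le (c := c) (U := U) hd hV (by linarith) hU
    (b := max (#{B ∈ Gr K V (d + 1) | B ⊓ U = L₀} : ℝ)
      (4 * (Nat.card K : ℝ) ^ (d ^ 2 - d - 1) +
      12 * #(c.missing U) * (Nat.card K : ℝ) ^ (d ^ 2 - d - 2)))
    (le_max_of_le_left (Nat.cast_nonneg _))
    (fun i hi => card_extra_tangentSpaces_le hd hV (by linarith) hL₀ hL₀2 hi)
  rw [card_tangentSpaces hL₀ hL₀2] at hcov
  have hlow := le_card_inf_eq hL₀ (s := d + 1) (by omega)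
  rw [hL₀2, hU, hV, show 2 * d + 1 - 2 = 2 * d - 1 by omega, show d + 1 - 2 = d - 1 by omega,
    show d + 2 - 2 = d by omega, show 2 * d + 1 - (2 + 1) = 2 * d - 2 by omega,
    show d + 1 - (2 + 1) = d - 2 by omega] at hlow
  have hl := le_card_tangents (c.missing_subset U) (fun P hP => le_of_mem_missing hP)
  rw [hU, show d + 2 - 1 = d + 1 by omega] at hl
  have hl2 := card_tangents_le (U := U) (c.missing_subset U) (H := ⊤) (m := d + 1)
    (by rw [inf_top_eq, hU])
  simp only [le_top, filter_true] at hl2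
  obtain ⟨q, hqdef⟩ : ∃ q : ℝ, q = (Nat.card K : ℝ) := ⟨_, rfl⟩
  rw [← hqdef] at hsmall hcard hyp hmiss hk1 hq1 hq hfirst hpart hhyp hcov hlow hl hl2
  have hq0 : 0 < q := by linarith
  obtain ⟨u, hu⟩ : ∃ u : ℝ, u = q⁻¹ := ⟨_, rfl⟩
  rw [← hu] at hsmall hyp hhyp
  have hu0 : 0 < u := by rw [hu]; positivity
  have huq : u * q = 1 := by rw [hu]; exact inv_mul_cancel₀ hq0.ne'
  obtain ⟨w, hw⟩ : ∃ w : ℝ, w = gauss q (d + 1) 1 := ⟨_, rfl⟩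
  obtain ⟨N, hNdef⟩ : ∃ N : ℝ, N = gauss q (d + 2) 1 := ⟨_, rfl⟩
  have hNw : N = q * w + 1 := by
    rw [hNdef, hw, gauss_one_right, gauss_one_right]
    have : q - 1 ≠ 0 := by linarith
    field_simp
    ring
  have hwlow : q ^ d ≤ w := by
    have := pow_le_gauss hq1 d 1
    rwa [one_mul, ← hw] at this
  have hwup : w ≤ 2 * q ^ d := by
    have := gauss_le (show 3 ≤ q by linarith) d 1
    rwa [one_mul, ← hw] at this
  have hNup : N ≤ 2 * (q * q ^ d) := by
    have := gauss_le (show 3 ≤ q by linarith) (d + 1) 1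
    rwa [one_mul, ← hNdef, pow_succ'] at this
  rw [← hNdef] at hcard hpart
  rw [← hw] at hl hl2 hcov
  obtain ⟨k, hk⟩ : ∃ k : ℝ, k = #(c.missing U) := ⟨_, rfl⟩
  obtain ⟨t, ht⟩ : ∃ t : ℝ, t = #{P ∈ c.points | ¬ P ≤ U} := ⟨_, rfl⟩
  obtain ⟨h, hh⟩ : ∃ h : ℝ, h = #c.hyperplanes := ⟨_, rfl⟩
  obtain ⟨n₁, hn₁⟩ : ∃ h : ℝ, h = Fintype.card ι₁ := ⟨_, rfl⟩
  obtain ⟨n₂, hn₂⟩ : ∃ h : ℝ, h = Fintype.card ι₂ := ⟨_, rfl⟩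
  obtain ⟨n₃, hn₃⟩ : ∃ h : ℝ, h = Fintype.card ι₃ := ⟨_, rfl⟩
  obtain ⟨l, hldef⟩ : ∃ l : ℝ, l = #(tangents (c.missing U) U) := ⟨_, rfl⟩
  obtain ⟨b, hb⟩ : ∃ b : ℝ, b = #{B ∈ Gr K V (d + 1) | B ⊓ U = L₀} := ⟨_, rfl⟩
  push_cast at hcov
  rw [← hk] at hk1 hmiss hfirst hpart hl hl2 hcov
  rw [← ht] at hfirst hpart hcov
  rw [← hh] at hfirst hhyp
  rw [← hn₁] at hcard hfirst hpts hcov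
  rw [← hn₂] at hcard hfirst hcov
  rw [← hn₃] at hcard hfirst hcov
  rw [← hldef] at hl hl2 hcov
  rw [← hb] at hlow hcov
  have hk0 : 0 ≤ k := by rw [hk]; positivity
  have ht0 : 0 ≤ t := by rw [ht]; positivity
  have hh0 : 0 ≤ h := by rw [hh]; positivity
  have hn10 : 0 ≤ n₁ := by rw [hn₁]; positivity
  have hn20 : 0 ≤ n₂ := by rw [hn₂]; positivity
  have hn30 : 0 ≤ n₃ := by rw [hn₃]; positivity
  have hl0 : 0 ≤ l := by rw [hldef]; positivity
  -- The points of U number N = k + #points - t, and #points ≤ n₁, while n₁ + n₂ + n₃ ≤ N - q.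
  have hothers : t + n₂ + n₃ ≤ k - q := by linarith
  have hdα : 3 * α ≤ d * α := mul_le_mul_of_nonneg_right hd3 (by linarith)
  obtain ⟨e, rfl⟩ : ∃ e, d = e + 2 := ⟨d - 2, by omega⟩
  have hQ0 : 0 < q ^ (e + 2) := by positivity
  have hu1 : u * q ^ (e + 2) = q ^ (e + 1) := by
    rw [show q ^ (e + 2) = q * q ^ (e + 1) by ring, ← mul_assoc, huq, one_mul]
  have hu2 : u ^ 2 * q ^ (e + 2) = q ^ e := by
    rw [show q ^ (e + 2) = q * q * q ^ e by ring,
      show u ^ 2 * (q * q * q ^ e) = (u * q) * (u * q) * q ^ e by ring, huq]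
    ring
  have hkθ : k ≤ 220 * ((e + 2 : ℕ) * α) * u * q ^ (e + 2) := by
    refine missing_le_first (t := t) (h := h) (n₁₂ := n₁ + n₂) (n₃ := n₃) huq hu0 hα hdα hsmall
      hQ0 hk0 hmiss (by linarith) (by linarith) (by linarith) ?_ hh0 ?_
    · rw [pow_succ' q (e + 2)] at hhyp
      exact hhyp
    · rw [hu1]
      rw [pow_succ' q (e + 2)] at hfirst
      exact hfirst
  simp only [show e + 2 - 2 = e by omega, show e + 2 - 1 = e + 1 by omega,
    show 2 * (e + 2) - 1 = 2 * e + 3 by omega,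
    show 2 * (e + 2) - 2 = 2 * e + 2 by omega] at hlow hcov
  -- With e = d - 2, this is q^(d(d-2)), the common scale of all terms; β below is the number of B
  -- on a tangent line divided by it.
  set Y := q ^ (e * (e + 2)) with hY
  have hY0 : 0 < Y := by positivity
  have p1 : q ^ ((e + 2) ^ 2 - (e + 2) - 1) = u * q ^ (e + 2) * Y := by
    rw [hu1, hY, ← pow_add]
    congr 1
    have : (e + 2) ^ 2 = e + 1 + e * (e + 2) + 1 + (e + 2) := by ring
    omega
  have p2 : q ^ ((e + 2) ^ 2 - (e + 2) - 2) = u ^ 2 * q ^ (e + 2) * Y := by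
    rw [hu2, hY, ← pow_add]
    congr 1
    have : (e + 2) ^ 2 = e + e * (e + 2) + 2 + (e + 2) := by ring
    omega
  have p3 : q ^ ((e + 2) ^ 2 - 3) = q ^ (e + 1) * (u ^ 2 * q ^ (e + 2) * Y) := by
    rw [hu2, hY, ← pow_add, ← pow_add]
    congr 1
    have : (e + 2) ^ 2 = e + 1 + (e + e * (e + 2)) + 3 := by ring
    omega
  have p4 : q ^ ((e + 2) ^ 2 + (e + 2) - 2) = q ^ (e + 1) * (u * q ^ (e + 2) * q ^ (e + 2) * Y) := by
    rw [hu1, hY, ← pow_add, ← pow_add, ← pow_add]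
    congr 1
    have : (e + 2) ^ 2 + (e + 2) = e + 1 + (e + 1 + (e + 2) + e * (e + 2)) + 2 := by ring
    omega
  rw [p1, p2, p3, p4] at hcov
  have D2 : q ^ (e + 2) * Y ≤ gauss q (2 * e + 3) (e + 1) := by
    have := pow_le_gauss hq1 (e + 2) (e + 1)
    rw [show e + 2 + (e + 1) = 2 * e + 3 by ring] at this
    rw [hY, ← pow_add]
    convert this using 2
    ring
  have D3 : gauss q (2 * e + 2) e ≤ 2 * Y := by
    have := gauss_le (show 3 ≤ q by linarith) (e + 2) e
    rwa [show e + 2 + e = 2 * e + 2 by ring] at this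
  have D4 : gauss q (2 * e + 2) (e + 1) ≤ 2 * (q * Y) := by
    have := gauss_le (show 3 ≤ q by linarith) (e + 1) (e + 1)
    rw [show e + 1 + (e + 1) = 2 * e + 2 by ring,
      show (e + 1) * (e + 1) = e * (e + 2) + 1 by ring, pow_succ', ← hY] at this
    exact this
  have D5 : gauss q (e + 2) 1 ≤ 2 * (u * q ^ (e + 2)) := by
    have := gauss_le (show 3 ≤ q by linarith) (e + 1) 1
    rwa [one_mul, ← hu1] at this
  have D30 : 0 ≤ gauss q (2 * e + 2) e := gauss_nonneg hq1 _ _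
  have D40 : 0 ≤ gauss q (2 * e + 2) (e + 1) := gauss_nonneg hq1 _ _
  have D50 : 0 ≤ gauss q (e + 2) 1 := gauss_nonneg hq1 _ _
  refine missing_le_second (q := q) (u := u) (Q := q ^ (e + 2)) (Δ := (e + 2 : ℕ) * α) (α := α)
    (k := k) (t := t) (n₁ := n₁) (n₂ := n₂) (n₃ := n₃) (w := w) (N := N) (l := l) (β := b / Y)
    huq hu0 hα hdα hsmall (pow_le_pow_right₀ hq1.le hd) hkθ ht0 hn10 hn20 hn30 hk1 hothers
    (by linarith) hNw hwlow hNup hl ?_ ?_ ?_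
  · have := mul_le_mul_of_nonneg_left hwup hk0
    linarith
  · rw [le_div_iff₀ hY0]
    have h1 := mul_le_mul D5 D3 D30 (by positivity)
    linarith
  · have hmax : max b (4 * (u * q ^ (e + 2) * Y) + 12 * k * (u ^ 2 * q ^ (e + 2) * Y)) ≤
        max (b / Y) (4 * u * q ^ (e + 2) + 12 * k * u ^ 2 * q ^ (e + 2)) * Y := by
      apply max_le
      · rw [← div_le_iff₀ hY0]
        exact le_max_left _ _
      · refine le_trans (le_of_eq ?_) (mul_le_mul_of_nonneg_right (le_max_right _ _) hY0.le)
        ring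
    have hdiv : (n₂ * (16 * (q ^ (e + 1) * (u ^ 2 * q ^ (e + 2) * Y)) * w) +
        n₃ * (α * (q ^ (e + 1) * (u * q ^ (e + 2) * q ^ (e + 2) * Y)))) / q ^ (e + 1) =
        n₂ * (16 * (u ^ 2 * q ^ (e + 2) * Y) * w) +
        n₃ * (α * (u * q ^ (e + 2) * q ^ (e + 2) * Y)) := by
      field_simp
    rw [hdiv] at hcov
    have c1 := mul_le_mul_of_nonneg_left hmax hn10
    have c2 := mul_le_mul_of_nonneg_left D3 (mul_nonneg ht0 hl0)
    have c3 : n₂ * (k * gauss q (e + 2) 1 * gauss q (2 * e + 2) (e + 1)) ≤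
        n₂ * (4 * k * q ^ (e + 2)) * Y := by
      have h1 := mul_le_mul D5 D4 D40 (by positivity)
      have h2 := mul_le_mul_of_nonneg_left h1 (mul_nonneg hn20 hk0)
      have h3 : n₂ * k * (2 * (u * q ^ (e + 2)) * (2 * (q * Y))) =
        n₂ * (4 * k * q ^ (e + 2)) * Y * (u * q) := by ring
      rw [h3, huq] at h2
      linarith
    have c4 := mul_le_mul_of_nonneg_left hwup
      (show 0 ≤ n₂ * (16 * (u ^ 2 * q ^ (e + 2) * Y)) by positivity)
    rw [← mul_div_assoc, div_le_iff₀ hY0]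
    linarith

/-- A cover by few independent sets consists of sets that contain point-pencils, for distinct
points of a subspace of rank `d + 2`. -/
theorem structure_of_card_le (hd : 3 ≤ d) (hV : finrank K V = 2 * d + 1)
    (c : FlagCover K V d α ι₁ ι₂ ι₃)
    (hα : 5 ≤ α) (hsmall : d * α * (Nat.card K : ℝ)⁻¹ ≤ 1 / 10 ^ 6)
    (hcard : (Fintype.card ι₁ : ℝ) + Fintype.card ι₂ + Fintype.card ι₃ + Nat.card K ≤
      gauss (Nat.card K) (d + 2) 1)
    (hle : #c.hyperplanes ≤ #c.points) :
    (Fintype.card ι₁ : ℝ) + Nat.card K = gauss (Nat.card K) (d + 2) 1 ∧ IsEmpty ι₂ ∧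
      IsEmpty ι₃ ∧ Function.Injective c.P ∧
      ∃ U : Submodule K V, finrank K U = d + 2 ∧ ∀ i, c.P i ≤ U := by
  have hd3 : (3 : ℝ) ≤ d := by exact_mod_cast hd
  have hq1 := one_lt_natCard_real (K := K)
  have hq : 15 * 10 ^ 6 ≤ (Nat.card K : ℝ) := by
    have h1 : 15 * (Nat.card K : ℝ)⁻¹ ≤ d * α * (Nat.card K : ℝ)⁻¹ :=
      mul_le_mul_of_nonneg_right (by nlinarith) (by positivity)
    have h2 : (15 * 10 ^ 6) * (Nat.card K : ℝ)⁻¹ ≤ 1 := by linarith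
    rwa [← div_eq_mul_inv, div_le_one (by linarith)] at h2
  obtain ⟨h1, h2, h3, h4⟩ := c.estimates hd hV hα (by linarith) hsmall (by linarith) hle
  obtain ⟨U, hU, -, hmiss⟩ := exists_subspace_of_superfluous_le hd hV (by linarith)
    c.points_subset h2 h3 h4
  have hk : (#(c.missing U) : ℝ) ≤ Nat.card K := by
    exact_mod_cast card_missing_le hd hV hα hsmall hcard h1 hU hmiss
  have hpart := card_missing_add_card (c := c) U
  rw [hU] at hpart
  have hpts : (#c.points : ℝ) ≤ Fintype.card ι₁ := by exact_mod_cast c.card_points_le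
  have n2 : (0 : ℝ) ≤ Fintype.card ι₂ := Nat.cast_nonneg _
  have n3 : (0 : ℝ) ≤ Fintype.card ι₃ := Nat.cast_nonneg _
  have t0 : (0 : ℝ) ≤ #{P ∈ c.points | ¬ P ≤ U} := Nat.cast_nonneg _
  -- The number of points off U, the numbers of dual and of small members, and the excess of members
  -- over distinct points add up to at most k - q ≤ 0, so all of them vanish.
  refine ⟨by linarith, ?_, ?_, ?_, U, hU, ?_⟩
  · rw [← Fintype.card_eq_zero_iff]
    have : (Fintype.card ι₂ : ℝ) = 0 := by linarith
    exact_mod_cast this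
  · rw [← Fintype.card_eq_zero_iff]
    have : (Fintype.card ι₃ : ℝ) = 0 := by linarith
    exact_mod_cast this
  · have h5 : (#c.points : ℝ) = Fintype.card ι₁ := by linarith
    have h6 : #(univ.image c.P) = #(univ : Finset ι₁) := by
      rw [card_univ]
      exact_mod_cast h5
    exact Set.injOn_univ.1 (by simpa using card_image_iff.1 h6)
  · intro i
    by_contra hi
    have h5 : (#{P ∈ c.points | ¬ P ≤ U} : ℝ) = 0 := by linarith
    have h6 : #{P ∈ c.points | ¬ P ≤ U} = 0 := by exact_mod_cast h5
    rw [card_eq_zero] at h6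
    have : c.P i ∈ ({P ∈ c.points | ¬ P ≤ U} : Finset _) :=
      mem_filter.2 ⟨mem_image_of_mem _ (mem_univ i), hi⟩
    rw [h6] at this
    exact notMem_empty _ this

/-- The dual of `structure_of_card_le`. -/
theorem dual_structure_of_card_le (hd : 3 ≤ d) (hV : finrank K V = 2 * d + 1)
    (c : FlagCover K V d α ι₁ ι₂ ι₃)
    (hα : 5 ≤ α) (hsmall : d * α * (Nat.card K : ℝ)⁻¹ ≤ 1 / 10 ^ 6)
    (hcard : (Fintype.card ι₁ : ℝ) + Fintype.card ι₂ + Fintype.card ι₃ + Nat.card K ≤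
      gauss (Nat.card K) (d + 2) 1)
    (hle : #c.points ≤ #c.hyperplanes) :
    (Fintype.card ι₂ : ℝ) + Nat.card K = gauss (Nat.card K) (d + 2) 1 ∧ IsEmpty ι₁ ∧
      IsEmpty ι₃ ∧ Function.Injective c.H ∧
      ∃ U : Submodule K V, finrank K U = d - 1 ∧ ∀ i, U ≤ c.H i := by
  obtain ⟨D⟩ := nonempty_duality K V
  have e1 : (c.dual D hV).points = c.hyperplanes.image D.toEquiv := by
    rw [points, hyperplanes, image_image]; rfl
  have e2 : (c.dual D hV).hyperplanes = c.points.image D.toEquiv := by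
    rw [points, hyperplanes, image_image]; rfl
  obtain ⟨h1, h2, h3, h4, U, hU, h5⟩ := (c.dual D hV).structure_of_card_le hd hV hα hsmall
    (by linarith) (by rw [e1, e2, card_image_of_injective _ D.toEquiv.injective,
      card_image_of_injective _ D.toEquiv.injective]; exact hle)
  refine ⟨h1, h2, h3, fun i j h => h4 (congrArg D.toEquiv h), D.toEquiv.symm U, ?_, fun i => ?_⟩
  · rw [D.finrank_symm]; omega
  · rw [← D.le_iff, Equiv.apply_symm_apply]
    exact h5 i

end FlagCover

/-! ### Translation between flags as sets and flags as pairs. -/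

section Bridge

variable {K : Type u} [Field K] {d : ℕ}

namespace FlagOfType

/-- Members of a flag are comparable, so two members of the same rank are equal and each rank of the
type occurs exactly once. -/
theorem exists_pair (f : FlagOfType K (2 * d + 1) {d, d + 1}) :
    ∃ p : Submodule K (Fin (2 * d + 1) → K) × Submodule K (Fin (2 * d + 1) → K),
      f.1 = {p.1, p.2} ∧ finrank K p.1 = d ∧ finrank K p.2 = d + 1 ∧ p.1 ≤ p.2 := by
  obtain ⟨f, ⟨hf1, hf2⟩, hf3⟩ := f
  have hd : d ∈ vectorialType f := by rw [hf3]; exact Or.inl rfl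
  have hd' : d + 1 ∈ vectorialType f := by rw [hf3]; exact Or.inr rfl
  obtain ⟨A, hA, hAr⟩ := hd
  obtain ⟨B, hB, hBr⟩ := hd'
  have huniq : ∀ X ∈ f, ∀ Y ∈ f, finrank K X = finrank K Y → X = Y := by
    intro X hX Y hY h
    rcases hf2 X hX Y hY with h' | h'
    · exact Submodule.eq_of_le_of_finrank_eq h' h
    · exact (Submodule.eq_of_le_of_finrank_eq h' h.symm).symm
  refine ⟨(A, B), ?_, hAr, hBr, ?_⟩
  · ext X
    constructor
    · intro hX
      have : finrank K X ∈ ({d, d + 1} : Set ℕ) := by rw [← hf3]; exact ⟨X, hX, rfl⟩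
      rcases this with h | h
      · exact Or.inl (huniq X hX A hA (h.trans hAr.symm))
      · exact Or.inr (huniq X hX B hB (Eq.trans h hBr.symm))
    · rintro (rfl | rfl)
      · exact hA
      · exact hB
  · rcases hf2 A hA B hB with h | h
    · exact h
    · have := Submodule.finrank_mono h
      omega

/-- The pair of members of a flag. -/
noncomputable def pair (f : FlagOfType K (2 * d + 1) {d, d + 1}) :
    Submodule K (Fin (2 * d + 1) → K) × Submodule K (Fin (2 * d + 1) → K) :=
  f.exists_pair.choose

theorem eq_pair (f : FlagOfType K (2 * d + 1) {d, d + 1}) : f.1 = {f.pair.1, f.pair.2} :=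
  f.exists_pair.choose_spec.1

theorem finrank_pair_fst (f : FlagOfType K (2 * d + 1) {d, d + 1}) : finrank K f.pair.1 = d :=
  f.exists_pair.choose_spec.2.1

theorem finrank_pair_snd (f : FlagOfType K (2 * d + 1) {d, d + 1}) : finrank K f.pair.2 = d + 1 :=
  f.exists_pair.choose_spec.2.2.1

theorem pair_le (f : FlagOfType K (2 * d + 1) {d, d + 1}) : f.pair.1 ≤ f.pair.2 :=
  f.exists_pair.choose_spec.2.2.2

theorem pair_injective : Function.Injective (pair (K := K) (d := d)) := by
  intro f g h
  apply Subtype.ext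
  rw [f.eq_pair, g.eq_pair, h]

theorem eq_fst_of_mem {f : FlagOfType K (2 * d + 1) {d, d + 1}}
    {A : Submodule K (Fin (2 * d + 1) → K)} (hA : A ∈ f.1) (h : finrank K A = d) :
    A = f.pair.1 := by
  rw [f.eq_pair] at hA
  rcases hA with h' | h'
  · exact h'
  · have h1 : A = f.pair.2 := h'
    have := f.finrank_pair_snd
    rw [← h1] at this
    omega

theorem eq_snd_of_mem {f : FlagOfType K (2 * d + 1) {d, d + 1}}
    {A : Submodule K (Fin (2 * d + 1) → K)} (hA : A ∈ f.1) (h : finrank K A = d + 1) :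
    A = f.pair.2 := by
  rw [f.eq_pair] at hA
  rcases hA with h' | h'
  · have h1 : A = f.pair.1 := h'
    have := f.finrank_pair_fst
    rw [← h1] at this
    omega
  · exact h'

theorem mem_pencil {f : FlagOfType K (2 * d + 1) {d, d + 1}}
    {P : Submodule K (Fin (2 * d + 1) → K)} : f ∈ pencil d P ↔ P ≤ f.pair.1 := by
  constructor
  · rintro ⟨A, hA, h1, h2⟩
    rwa [← eq_fst_of_mem hA h1]
  · intro h
    exact ⟨f.pair.1, by rw [f.eq_pair]; exact Or.inl rfl, f.finrank_pair_fst, h⟩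

theorem mem_dualPencil {f : FlagOfType K (2 * d + 1) {d, d + 1}}
    {H : Submodule K (Fin (2 * d + 1) → K)} : f ∈ dualPencil d H ↔ f.pair.2 ≤ H := by
  constructor
  · rintro ⟨A, hA, h1, h2⟩
    rwa [← eq_snd_of_mem hA h1]
  · intro h
    exact ⟨f.pair.2, by rw [f.eq_pair]; exact Or.inr rfl, f.finrank_pair_snd, h⟩

theorem exists_pair_eq (hd : 1 ≤ d) {A B : Submodule K (Fin (2 * d + 1) → K)}
    (hA : finrank K A = d) (hB : finrank K B = d + 1) (hAB : A ≤ B) :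
    ∃ f : FlagOfType K (2 * d + 1) {d, d + 1}, f.pair = (A, B) := by
  have htop : finrank K (⊤ : Submodule K (Fin (2 * d + 1) → K)) = 2 * d + 1 := by
    rw [finrank_top, finrank_fin_fun]
  have hbot : finrank K (⊥ : Submodule K (Fin (2 * d + 1) → K)) = 0 := finrank_bot K _
  let f : FlagOfType K (2 * d + 1) {d, d + 1} := ⟨{A, B}, ⟨by
    rintro X (rfl | rfl)
    · exact ⟨fun h => by rw [h, hbot] at hA; omega, fun h => by rw [h, htop] at hA; omega⟩
    · exact ⟨fun h => by rw [h, hbot] at hB; omega, fun h => by rw [h, htop] at hB; omega⟩, by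
    rintro X (rfl | rfl) Y (rfl | rfl)
    · exact Or.inl le_rfl
    · exact Or.inl hAB
    · exact Or.inr hAB
    · exact Or.inl le_rfl⟩, by
    ext r
    constructor
    · rintro ⟨X, (rfl | rfl), rfl⟩
      · exact Or.inl hA
      · exact Or.inr hB
    · rintro (h | h)
      · exact ⟨A, Or.inl rfl, hA.trans h.symm⟩
      · exact ⟨B, Or.inr rfl, hB.trans (Eq.symm h)⟩⟩
  refine ⟨f, Prod.ext ?_ ?_⟩
  · exact (eq_fst_of_mem (f := f) (Or.inl rfl) hA).symm
  · exact (eq_snd_of_mem (f := f) (Or.inr rfl) hB).symm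

variable [Finite K]

theorem pair_mem_flags (f : FlagOfType K (2 * d + 1) {d, d + 1}) :
    f.pair ∈ flags K (Fin (2 * d + 1) → K) d :=
  mem_flags.2 ⟨f.finrank_pair_fst, f.finrank_pair_snd, f.pair_le⟩

/-- Ranks d and d+1 add up to 2d+1, so for A and B' trivial intersection and spanning are
equivalent. The condition for A, A' and the one for B, B' then follow. -/
theorem inGeneralPosition_iff (f g : FlagOfType K (2 * d + 1) {d, d + 1}) :
    InGeneralPosition f.1 g.1 ↔ OppositeFlags f.pair g.pair := by
  have hV : finrank K (Fin (2 * d + 1) → K) = 2 * d + 1 := finrank_fin_fun K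
  have key : ∀ A B : Submodule K (Fin (2 * d + 1) → K), finrank K A = d → finrank K B = d + 1 →
      ((A ⊓ B = ⊥ ∨ A ⊔ B = ⊤) ↔ Disjoint A B) := by
    intro A B hA hB
    have h1 := Submodule.finrank_sup_add_finrank_inf_eq A B
    rw [disjoint_iff]
    refine ⟨fun h => h.elim id fun h => ?_, Or.inl⟩
    rw [h, finrank_top, hV] at h1
    exact Submodule.finrank_eq_zero.1 (by omega)
  have hsup : ∀ A B : Submodule K (Fin (2 * d + 1) → K), finrank K A = d → finrank K B = d + 1 →
      Disjoint A B → A ⊔ B = ⊤ := by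
    intro A B hA hB h
    have h1 := Submodule.finrank_sup_add_finrank_inf_eq A B
    rw [disjoint_iff.1 h, finrank_bot] at h1
    exact Submodule.eq_top_of_finrank_eq (by omega)
  have f1 := f.finrank_pair_fst
  have f2 := f.finrank_pair_snd
  have g1 := g.finrank_pair_fst
  have g2 := g.finrank_pair_snd
  rw [InGeneralPosition, f.eq_pair, g.eq_pair]
  constructor
  · intro h
    refine ⟨(key _ _ f1 g2).1 (h _ (Or.inl rfl) _ (Or.inr rfl)), (key _ _ g1 f2).1 ?_⟩
    rw [inf_comm, sup_comm]
    exact h _ (Or.inr rfl) _ (Or.inl rfl)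
  · rintro ⟨h1, h2⟩ X (rfl | rfl) Y (rfl | rfl)
    · exact Or.inl (disjoint_iff.1 (h1.mono_right g.pair_le))
    · exact Or.inl (disjoint_iff.1 h1)
    · exact Or.inl (disjoint_iff.1 h2.symm)
    · exact Or.inr (top_le_iff.1 ((hsup _ _ f1 g2 h1).ge.trans (sup_le_sup_right f.pair_le _)))

theorem adj_iff (hd : 1 ≤ d) (f g : FlagOfType K (2 * d + 1) {d, d + 1}) :
    (flagGraph K d).Adj f g ↔ OppositeFlags f.pair g.pair := by
  rw [← inGeneralPosition_iff]
  refine ⟨fun h => h.2, fun h => ⟨?_, h⟩⟩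
  rintro rfl
  have h1 := ((inGeneralPosition_iff f f).1 h).1
  have h2 := f.finrank_pair_fst
  rw [disjoint_iff, inf_eq_left.2 f.pair_le] at h1
  rw [h1, finrank_bot] at h2
  omega

theorem isIndepSet_iff (hd : 1 ≤ d) (C : Set (FlagOfType K (2 * d + 1) {d, d + 1})) :
    (flagGraph K d).IsIndepSet C ↔ ∀ f ∈ C, ∀ g ∈ C, ¬ OppositeFlags f.pair g.pair := by
  constructor
  · intro h f hf g hg hop
    have h1 := (adj_iff hd f g).2 hop
    exact h hf hg h1.ne h1
  · intro h f hf g hg _ hadj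
    exact h f hf g hg ((adj_iff hd f g).1 hadj)

instance : Finite (FlagOfType K (2 * d + 1) {d, d + 1}) :=
  Finite.of_injective _ pair_injective

end FlagOfType

-- Stated for covers with at most N - q members, with equality as part of the conclusion, so that it
-- yields both the lower bound for the chromatic number and the description of the optimal covers.
open FlagOfType in
theorem structure_of_maximal_cover [Finite K] (hd : 3 ≤ d) {ρ : ℤ}
    (hρ : LargeIndepSetConjecture.{u} d ρ) {α : ℝ} (hα : 5 ≤ α) (hρα : (ρ : ℝ) ≤ α)
    (hsmall : d * α * (Nat.card K : ℝ)⁻¹ ≤ 1 / 10 ^ 6)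
    {𝓕 : Set (Set (FlagOfType K (2 * d + 1) {d, d + 1}))}
    (hmax : ∀ C ∈ 𝓕, IsMaxlIndepSet (flagGraph K d) C)
    (hcard : (𝓕.ncard : ℝ) + Nat.card K ≤ gauss (Nat.card K) (d + 2) 1)
    (hcover : ⋃₀ 𝓕 = Set.univ) :
    (𝓕.ncard : ℝ) + Nat.card K = gauss (Nat.card K) (d + 2) 1 ∧
    ((∃ U : Submodule K (Fin (2 * d + 1) → K), Module.finrank K U = d + 2 ∧
        ∃ μ : Set (FlagOfType K (2 * d + 1) {d, d + 1}) → Submodule K (Fin (2 * d + 1) → K),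
          Set.InjOn μ 𝓕 ∧
          ∀ C ∈ 𝓕, Module.finrank K (μ C) = 1 ∧ μ C ≤ U ∧ pencil d (μ C) ⊆ C) ∨
      (∃ U : Submodule K (Fin (2 * d + 1) → K), Module.finrank K U = d - 1 ∧
        ∃ μ : Set (FlagOfType K (2 * d + 1) {d, d + 1}) → Submodule K (Fin (2 * d + 1) → K),
          Set.InjOn μ 𝓕 ∧
          ∀ C ∈ 𝓕, Module.finrank K (μ C) = 2 * d ∧ U ≤ μ C ∧ dualPencil d (μ C) ⊆ C)) := by
  have hV : finrank K (Fin (2 * d + 1) → K) = 2 * d + 1 := finrank_fin_fun K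
  have hfin : 𝓕.Finite := Set.toFinite _
  set F := hfin.toFinset with hF
  have hFmem : ∀ {C}, C ∈ F ↔ C ∈ 𝓕 := fun {C} => hfin.mem_toFinset
  have hFcard : 𝓕.ncard = #F := Set.ncard_eq_toFinset_card 𝓕 hfin
  have := Fintype.ofFinite (FlagOfType K (2 * d + 1) {d, d + 1})
  let p₁ : Set (FlagOfType K (2 * d + 1) {d, d + 1}) → Prop := fun C =>
    ∃ P : Submodule K (Fin (2 * d + 1) → K), finrank K P = 1 ∧ pencil d P ⊆ C
  let p₂ : Set (FlagOfType K (2 * d + 1) {d, d + 1}) → Prop := fun C =>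
    ∃ P : Submodule K (Fin (2 * d + 1) → K), finrank K P = 2 * d ∧ dualPencil d P ⊆ C
  let F₁ : Finset (Set (FlagOfType K (2 * d + 1) {d, d + 1})) := {C ∈ F | p₁ C}
  let F₂ : Finset (Set (FlagOfType K (2 * d + 1) {d, d + 1})) := {C ∈ F | ¬ p₁ C ∧ p₂ C}
  let F₃ : Finset (Set (FlagOfType K (2 * d + 1) {d, d + 1})) := {C ∈ F | ¬ p₁ C ∧ ¬ p₂ C}
  have hsplit : #F₁ + (#F₂ + #F₃) = #F := by
    have h1 := card_filter_add_card_filter_not (s := F) p₁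
    have h2 := card_filter_add_card_filter_not (s := ({C ∈ F | ¬ p₁ C} : Finset _)) p₂
    rw [filter_filter, filter_filter] at h2
    rw [h2, h1]
  have hP : ∀ i : F₁, p₁ i := fun i => (mem_filter.1 i.2).2
  have hH : ∀ i : F₂, p₂ i := fun i => (mem_filter.1 i.2).2.2
  let pairs : Set (FlagOfType K (2 * d + 1) {d, d + 1}) →
      Finset (Submodule K (Fin (2 * d + 1) → K) × Submodule K (Fin (2 * d + 1) → K)) :=
    fun C => ({f | f ∈ C} : Finset (FlagOfType K (2 * d + 1) {d, d + 1})).image pair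
  have mem_pairs : ∀ {C f}, f ∈ C → pair f ∈ pairs C := fun {C f} h =>
    mem_image_of_mem _ (mem_filter.2 ⟨mem_univ _, h⟩)
  have of_mem_pairs : ∀ {C x}, x ∈ pairs C → ∃ f ∈ C, pair f = x := by
    intro C x hx
    obtain ⟨f, hf, rfl⟩ := mem_image.1 hx
    exact ⟨f, (mem_filter.1 hf).2, rfl⟩
  have pairs_indep : ∀ C ∈ F, ∀ f ∈ pairs C, ∀ g ∈ pairs C, ¬ OppositeFlags f g := by
    intro C hC f hf g hg
    obtain ⟨f, hf', rfl⟩ := of_mem_pairs hf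
    obtain ⟨g, hg', rfl⟩ := of_mem_pairs hg
    exact (isIndepSet_iff (by omega) C).1 (hmax C (hFmem.1 hC)).prop f hf' g hg'
  have pairs_sub : ∀ C, pairs C ⊆ flags K (Fin (2 * d + 1) → K) d := by
    intro C f hf
    obtain ⟨f, hf', rfl⟩ := of_mem_pairs hf
    exact f.pair_mem_flags
  have of_flag : ∀ x ∈ flags K (Fin (2 * d + 1) → K) d,
      ∃ f : FlagOfType K (2 * d + 1) {d, d + 1}, f.pair = x := by
    rintro ⟨A, B⟩ hx
    obtain ⟨h1, h2, h3⟩ := mem_flags.1 hx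
    exact exists_pair_eq (by omega) h1 h2 h3
  obtain ⟨c, hcP, hcH⟩ : ∃ c : FlagCover K (Fin (2 * d + 1) → K) d α F₁ F₂ F₃,
      (∀ i, pencil d (c.P i) ⊆ i.1) ∧ ∀ i, dualPencil d (c.H i) ⊆ i.1 := ⟨
    { C₁ := fun i => pairs i
      C₂ := fun i => pairs i
      C₃ := fun i => pairs i
      P := fun i => (hP i).choose
      H := fun i => (hH i).choose
      finrank_P := fun i => (hP i).choose_spec.1
      finrank_H := fun i => (hH i).choose_spec.1
      subset₁ := fun i => pairs_sub i
      subset₂ := fun i => pairs_sub i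
      indep₁ := fun i => pairs_indep i (mem_filter.1 i.2).1
      indep₂ := fun i => pairs_indep i (mem_filter.1 i.2).1
      pencil_mem := by
        intro i x hx h
        obtain ⟨f, rfl⟩ := of_flag x hx
        exact mem_pairs ((hP i).choose_spec.2 (mem_pencil.2 h))
      dual_mem := by
        intro i x hx h
        obtain ⟨f, rfl⟩ := of_flag x hx
        exact mem_pairs ((hH i).choose_spec.2 (mem_dualPencil.2 h))
      card_le := by
        intro i
        obtain ⟨h1, h2, h3⟩ := mem_filter.1 i.2
        -- Only members without a pencil of either kind are in the third class, so the size bound is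
        -- what the hypothesis leaves. Members with pencils of both kinds are in the first class.
        rcases hρ K i.1 (hmax _ (hFmem.1 h1)) with h | h | h
        · exact absurd h h2
        · exact absurd h h3
        · have h4 : (#(pairs i) : ℝ) = (i.1.ncard : ℝ) := by
            rw [card_image_of_injective _ pair_injective, Set.ncard_eq_toFinset_card']
            congr 2
            ext f
            simp
          have h5 : (i.1.ncard : ℝ) ≤ ρ * (Nat.card K : ℝ) ^ (d ^ 2 + d - 2) := by
            exact_mod_cast h
          rw [h4]
          exact h5.trans (mul_le_mul_of_nonneg_right hρα (by positivity))
      cover := by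
        intro x hx
        obtain ⟨f, rfl⟩ := of_flag x hx
        have hf : f ∈ ⋃₀ 𝓕 := by rw [hcover]; exact Set.mem_univ f
        obtain ⟨C, hC, hfC⟩ := hf
        by_cases h1 : p₁ C
        · exact Or.inl ⟨⟨C, mem_filter.2 ⟨hFmem.2 hC, h1⟩⟩, mem_pairs hfC⟩
        · by_cases h2 : p₂ C
          · exact Or.inr (Or.inl ⟨⟨C, mem_filter.2 ⟨hFmem.2 hC, h1, h2⟩⟩, mem_pairs hfC⟩)
          · exact Or.inr (Or.inr ⟨⟨C, mem_filter.2 ⟨hFmem.2 hC, h1, h2⟩⟩, mem_pairs hfC⟩) },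
    fun i => (hP i).choose_spec.2, fun i => (hH i).choose_spec.2⟩
  have hsplit' : (Fintype.card F₁ : ℝ) + Fintype.card F₂ + Fintype.card F₃ = 𝓕.ncard := by
    rw [Fintype.card_coe, Fintype.card_coe, Fintype.card_coe, hFcard, ← hsplit]
    push_cast
    ring
  have hcard' : (Fintype.card F₁ : ℝ) + Fintype.card F₂ + Fintype.card F₃ + Nat.card K ≤
      gauss (Nat.card K) (d + 2) 1 := by rw [hsplit']; exact hcard
  rcases le_total (#c.hyperplanes) (#c.points) with hle | hle
  · obtain ⟨h1, h2, h3, h4, U, hU, h5⟩ := c.structure_of_card_le hd hV hα hsmall hcard' hle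
    rw [@Fintype.card_eq_zero F₂ _ h2, @Fintype.card_eq_zero F₃ _ h3] at hsplit'
    refine ⟨by rw [← h1, ← hsplit']; simp, Or.inl ⟨U, hU, ?_⟩⟩
    have hall : ∀ C ∈ 𝓕, C ∈ F₁ := by
      intro C hC
      by_contra hcon
      by_cases h6 : p₂ C
      · exact h2.false ⟨C, mem_filter.2 ⟨hFmem.2 hC,
          fun h => hcon (mem_filter.2 ⟨hFmem.2 hC, h⟩), h6⟩⟩
      · exact h3.false ⟨C, mem_filter.2 ⟨hFmem.2 hC,
          fun h => hcon (mem_filter.2 ⟨hFmem.2 hC, h⟩), h6⟩⟩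
    have hμ : ∀ C (hC : C ∈ 𝓕), (if h : C ∈ F₁ then c.P ⟨C, h⟩ else ⊥) = c.P ⟨C, hall C hC⟩ :=
      fun C hC => dif_pos (hall C hC)
    -- The value ⊥ is never taken on `𝓕`, because the other two classes are empty.
    refine ⟨fun C => if h : C ∈ F₁ then c.P ⟨C, h⟩ else ⊥, fun C hC C' hC' h => ?_,
      fun C hC => ?_⟩
    · have h7 := (hμ C hC).symm.trans (h.trans (hμ C' hC'))
      exact congrArg Subtype.val (h4 h7)
    · beta_reduce
      rw [hμ C hC]
      exact ⟨c.finrank_P _, h5 _, hcP _⟩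
  · obtain ⟨h1, h2, h3, h4, U, hU, h5⟩ := c.dual_structure_of_card_le hd hV hα hsmall hcard' hle
    rw [@Fintype.card_eq_zero F₁ _ h2, @Fintype.card_eq_zero F₃ _ h3] at hsplit'
    refine ⟨by rw [← h1, ← hsplit']; simp, Or.inr ⟨U, hU, ?_⟩⟩
    have hall : ∀ C ∈ 𝓕, C ∈ F₂ := by
      intro C hC
      by_contra hcon
      by_cases h6 : p₁ C
      · exact h2.false ⟨C, mem_filter.2 ⟨hFmem.2 hC, h6⟩⟩
      · exact h3.false ⟨C, mem_filter.2 ⟨hFmem.2 hC, h6,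
          fun h => hcon (mem_filter.2 ⟨hFmem.2 hC, h6, h⟩)⟩⟩
    have hμ : ∀ C (hC : C ∈ 𝓕), (if h : C ∈ F₂ then c.H ⟨C, h⟩ else ⊥) = c.H ⟨C, hall C hC⟩ :=
      fun C hC => dif_pos (hall C hC)
    refine ⟨fun C => if h : C ∈ F₂ then c.H ⟨C, h⟩ else ⊥, fun C hC C' hC' h => ?_,
      fun C hC => ?_⟩
    · have h7 := (hμ C hC).symm.trans (h.trans (hμ C' hC'))
      exact congrArg Subtype.val (h4 h7)
    · beta_reduce
      rw [hμ C hC]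
      exact ⟨c.finrank_H _, h5 _, hcH _⟩

end Bridge

/-! ### A colouring with N - q classes. -/

section Coloring

variable {K V : Type*} [Field K] [Finite K] [AddCommGroup V] [Module K V] [Module.Finite K V]

theorem exists_le_finrank_eq (X : Submodule K V) {r : ℕ} (hr : r ≤ finrank K X) :
    ∃ E ≤ X, finrank K E = r := by
  induction r with
  | zero => exact ⟨⊥, bot_le, finrank_bot K V⟩
  | succ r ih =>
    obtain ⟨E, h1, h2⟩ := ih (by omega)
    obtain ⟨F, -, h3, h4⟩ := exists_between_finrank_succ h1 (by omega)
    exact ⟨F, h3, by omega⟩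

theorem card_points_line {L : Submodule K V} (hL : finrank K L = 2) :
    #{P ∈ Gr K V 1 | P ≤ L} = Nat.card K + 1 := by
  have hq := one_lt_natCard_real (K := K)
  have h1 := card_Gr_le L 1
  rw [hL, gauss_one_right] at h1
  have h2 : ((Nat.card K : ℝ) ^ 2 - 1) / (Nat.card K - 1) = Nat.card K + 1 := by
    have : (Nat.card K : ℝ) - 1 ≠ 0 := by linarith
    field_simp; ring
  rw [h2] at h1
  exact_mod_cast h1

/-- The lines of `U` that meet the line `ℓ` in a single point, which is not `P₀`, have distinct
representatives among their points off `ℓ`. -/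
theorem exists_representatives {U ℓ P₀ : Submodule K V} (hℓ : finrank K ℓ = 2)
    (hP₀ : finrank K P₀ = 1) (hP₀ℓ : P₀ ≤ ℓ) {𝓜 : Finset (Submodule K V)}
    (h𝓜 : ∀ M, M ∈ 𝓜 ↔ finrank K M = 2 ∧ M ≤ U ∧ M ≠ ℓ ∧
      ∃ Q : Submodule K V, finrank K Q = 1 ∧ Q ≤ ℓ ∧ Q ≠ P₀ ∧ Q ≤ M) :
    ∃ φ : 𝓜 → Submodule K V, Function.Injective φ ∧
      ∀ M, finrank K (φ M) = 1 ∧ φ M ≤ M ∧ ¬ φ M ≤ ℓ := by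
  have hmissed : #{Q ∈ Gr K V 1 | Q ≤ ℓ ∧ Q ≠ P₀} = Nat.card K := by
    have h1 : ({Q ∈ Gr K V 1 | Q ≤ ℓ ∧ Q ≠ P₀} : Finset _) =
        ({Q ∈ Gr K V 1 | Q ≤ ℓ} : Finset _).erase P₀ := by
      ext Q
      simp only [mem_filter, mem_erase]
      tauto
    rw [h1, card_erase_of_mem (mem_filter.2 ⟨mem_Gr.2 hP₀, hP₀ℓ⟩), card_points_line hℓ]
    omega
  let t : 𝓜 → Finset (Submodule K V) := fun M => {P ∈ Gr K V 1 | P ≤ M ∧ ¬ P ≤ ℓ}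
  have ht : ∀ M, #(t M) = Nat.card K := by
    rintro ⟨M, hM⟩
    obtain ⟨h1, h2, h3, Q, h4, h5, -, h6⟩ := (h𝓜 M).1 hM
    have e : t ⟨M, hM⟩ = ({P ∈ Gr K V 1 | P ≤ M} : Finset _).erase Q := by
      ext P
      simp only [t, mem_filter, mem_erase, mem_Gr]
      constructor
      · rintro ⟨a1, a2, a3⟩
        exact ⟨by rintro rfl; exact a3 h5, a1, a2⟩
      · rintro ⟨a1, a2, a3⟩
        refine ⟨a2, a3, fun a4 => h3 ?_⟩
        rw [← eq_sup_of_le a2 h4 a1 h1 a3 h6, eq_sup_of_le a2 h4 a1 hℓ a4 h5]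
    rw [e, card_erase_of_mem (mem_filter.2 ⟨mem_Gr.2 h4, h6⟩), card_points_line h1]
    omega
  -- Hall's condition by double counting: every M has exactly q points off ℓ, and a point off ℓ lies
  -- on at most q lines M, one for each point of ℓ other than P₀.
  have hhall : ∀ s : Finset 𝓜, #s ≤ #(s.biUnion t) := by
    intro s
    have h1 : ∑ M ∈ s, #{P ∈ s.biUnion t | P ∈ t M} = ∑ P ∈ s.biUnion t, #{M ∈ s | P ∈ t M} :=
      Finset.sum_card_bipartiteAbove_eq_sum_card_bipartiteBelow (fun M P => P ∈ t M)
    have h2 : ∑ M ∈ s, #{P ∈ s.biUnion t | P ∈ t M} = #s * Nat.card K := by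
      rw [← smul_eq_mul, ← sum_const]
      refine sum_congr rfl fun M hM => ?_
      rw [← ht M]
      congr 1
      ext P
      rw [mem_filter]
      exact ⟨fun h => h.2, fun h => ⟨mem_biUnion.2 ⟨M, hM, h⟩, h⟩⟩
    have h3 : ∑ P ∈ s.biUnion t, #{M ∈ s | P ∈ t M} ≤ #(s.biUnion t) * Nat.card K := by
      rw [← smul_eq_mul]
      refine sum_le_card_nsmul _ _ _ fun P _ => ?_
      rw [← hmissed]
      have hsub : ({M ∈ s | P ∈ t M} : Finset _).image Subtype.val ⊆
          ({Q ∈ Gr K V 1 | Q ≤ ℓ ∧ Q ≠ P₀} : Finset _).image (fun Q => P ⊔ Q) := by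
        intro M hM
        obtain ⟨M, hM', rfl⟩ := mem_image.1 hM
        obtain ⟨a1, a2, a3⟩ := mem_filter.1 (mem_filter.1 hM').2
        obtain ⟨h1, h2, h3, Q, h4, h5, h6, h7⟩ := (h𝓜 M).1 M.2
        exact mem_image.2 ⟨Q, mem_filter.2 ⟨mem_Gr.2 h4, h5, h6⟩,
          eq_sup_of_le (mem_Gr.1 a1) h4 (by rintro rfl; exact a3 h5) h1 a2 h7⟩
      rw [← card_image_of_injective _ Subtype.val_injective]
      exact (card_le_card hsub).trans card_image_le
    rw [← h1, h2] at h3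
    exact Nat.le_of_mul_le_mul_right h3 (by have := one_lt_natCard (K := K); omega)
  obtain ⟨φ, h1, h2⟩ := (Finset.all_card_le_biUnion_card_iff_exists_injective t).1 hhall
  refine ⟨φ, h1, fun M => ?_⟩
  obtain ⟨a1, a2, a3⟩ := mem_filter.1 (h2 M)
  exact ⟨mem_Gr.1 a1, a2, a3⟩

/-- Flags in the classes that are used for the colouring are not opposite. -/
theorem not_oppositeFlags {d : ℕ} {P L : Submodule K V} (hP : finrank K P = 1) (hPL : P ≤ L)
    (hL : 2 ≤ finrank K L) {f g : Submodule K V × Submodule K V} (hf : f ∈ flags K V d)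
    (hg : g ∈ flags K V d) (hfP : P ≤ f.1 ∨ L ≤ f.2) (hgP : P ≤ g.1 ∨ L ≤ g.2) :
    ¬ OppositeFlags f g := by
  rintro ⟨h1, h2⟩
  obtain ⟨f1, f2, f3⟩ := mem_flags.1 hf
  obtain ⟨g1, g2, g3⟩ := mem_flags.1 hg
  have hPf : P ≤ f.2 := hfP.elim (fun h => h.trans f3) (fun h => hPL.trans h)
  have hPg : P ≤ g.2 := hgP.elim (fun h => h.trans g3) (fun h => hPL.trans h)
  have hP0 : P ≠ ⊥ := by
    rintro rfl
    rw [finrank_bot] at hP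
    omega
  rcases hfP with h | h
  · exact hP0 (le_bot_iff.1 (h1 h hPg))
  rcases hgP with h' | h'
  · exact hP0 (le_bot_iff.1 (h2 h' hPf))
  -- In the last case L lies in both members of rank d+1. A hyperplane of `f.2` meets L
  -- nontrivially, and this intersection lies in `g.2`.
  have h3 := Submodule.finrank_sup_add_finrank_inf_eq f.1 L
  have h4 := Submodule.finrank_mono (sup_le f3 h)
  have h5 : f.1 ⊓ L ≤ ⊥ := h1 inf_le_left (inf_le_right.trans h')
  rw [le_bot_iff.1 h5, finrank_bot] at h3
  omega

/-- The classes of a colouring of the flags. -/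
theorem exists_classes {d : ℕ} (hd : 1 ≤ d) (hV : finrank K V = 2 * d + 1) :
    ∃ (S : Finset (Submodule K V)) (L : Submodule K V → Submodule K V),
      (#S : ℝ) + Nat.card K = gauss (Nat.card K) (d + 2) 1 ∧
      (∀ P ∈ S, finrank K P = 1 ∧ P ≤ L P ∧ 2 ≤ finrank K (L P)) ∧
      ∀ f ∈ flags K V d, ∃ P ∈ S, P ≤ f.1 ∨ L P ≤ f.2 := by
  obtain ⟨U, -, hU⟩ := exists_le_finrank_eq (⊤ : Submodule K V) (r := d + 2)
    (by rw [finrank_top]; omega)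
  obtain ⟨ℓ, hℓU, hℓ⟩ := exists_le_finrank_eq U (r := 2) (by omega)
  obtain ⟨P₀, hP₀ℓ, hP₀⟩ := exists_le_finrank_eq ℓ (r := 1) (by omega)
  have hfin := Fintype.ofFinite (Submodule K V)
  set 𝓜 : Finset (Submodule K V) := {M | finrank K M = 2 ∧ M ≤ U ∧ M ≠ ℓ ∧
      ∃ Q : Submodule K V, finrank K Q = 1 ∧ Q ≤ ℓ ∧ Q ≠ P₀ ∧ Q ≤ M} with h𝓜def
  have h𝓜 : ∀ M, M ∈ 𝓜 ↔ finrank K M = 2 ∧ M ≤ U ∧ M ≠ ℓ ∧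
      ∃ Q : Submodule K V, finrank K Q = 1 ∧ Q ≤ ℓ ∧ Q ≠ P₀ ∧ Q ≤ M := by
    intro M
    rw [h𝓜def, mem_filter]
    simp
  obtain ⟨φ, hφi, hφ⟩ := exists_representatives hℓ hP₀ hP₀ℓ h𝓜
  -- Of the q + 1 points of ℓ only P₀ is kept, which saves q classes.
  set S : Finset (Submodule K V) := {P ∈ Gr K V 1 | P ≤ U ∧ (P ≤ ℓ → P = P₀)} with hS
  -- A point that represents no line needs no line of its own; ⊤ is a harmless choice that keeps P ≤
  -- L P and the rank condition.
  let L : Submodule K V → Submodule K V := fun P =>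
    if P = P₀ then ℓ else if h : ∃ M, φ M = P then (h.choose : Submodule K V) else ⊤
  have hL0 : L P₀ = ℓ := if_pos rfl
  have hLφ : ∀ M, L (φ M) = M := by
    intro M
    have h1 : φ M ≠ P₀ := fun h => (hφ M).2.2 (h ▸ hP₀ℓ)
    have h2 : ∃ M', φ M' = φ M := ⟨M, rfl⟩
    have h3 : L (φ M) = (h2.choose : Submodule K V) := by
      simp only [L, if_neg h1, dif_pos h2]
    rw [h3, hφi h2.choose_spec]
  refine ⟨S, L, ?_, ?_, ?_⟩
  · have h1 : ({P ∈ Gr K V 1 | P ≤ U} : Finset _) =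
        S ∪ ({Q ∈ Gr K V 1 | Q ≤ ℓ} : Finset _).erase P₀ := by
      ext P
      simp only [hS, mem_union, mem_filter, mem_erase]
      constructor
      · rintro ⟨a1, a2⟩
        by_cases h : P ≤ ℓ ∧ P ≠ P₀
        · exact Or.inr ⟨h.2, a1, h.1⟩
        · push Not at h
          exact Or.inl ⟨a1, a2, h⟩
      · rintro (⟨a1, a2, -⟩ | ⟨-, a1, a2⟩)
        · exact ⟨a1, a2⟩
        · exact ⟨a1, a2.trans hℓU⟩
    have h2 : Disjoint S (({Q ∈ Gr K V 1 | Q ≤ ℓ} : Finset _).erase P₀) := by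
      rw [Finset.disjoint_left]
      intro P hP hP'
      exact (mem_erase.1 hP').1 ((mem_filter.1 hP).2.2 (mem_filter.1 (mem_erase.1 hP').2).2)
    have h3 := card_Gr_le U 1
    rw [hU, h1, card_union_of_disjoint h2,
      card_erase_of_mem (mem_filter.2 ⟨mem_Gr.2 hP₀, hP₀ℓ⟩), card_points_line hℓ,
      Nat.add_sub_cancel] at h3
    exact_mod_cast h3
  · intro P hP
    obtain ⟨h1, -, -⟩ := mem_filter.1 hP
    rw [mem_Gr] at h1
    refine ⟨h1, ?_⟩
    by_cases h2 : P = P₀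
    · rw [h2, hL0, hℓ]
      exact ⟨hP₀ℓ, le_rfl⟩
    by_cases h3 : ∃ M, φ M = P
    · obtain ⟨M, rfl⟩ := h3
      rw [hLφ]
      exact ⟨(hφ M).2.1, ((h𝓜 M).1 M.2).1.ge⟩
    · have h4 : L P = ⊤ := by simp only [L, if_neg h2, dif_neg h3]
      rw [h4, finrank_top]
      exact ⟨le_top, by omega⟩
  · intro f hf
    obtain ⟨f1, f2, f3⟩ := mem_flags.1 hf
    -- Ranks d and d+2 in rank 2d+1 force a common point Q of A and U.
    have h1 := Submodule.finrank_sup_add_finrank_inf_eq f.1 U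
    have h2 := Submodule.finrank_le (f.1 ⊔ U)
    obtain ⟨Q, hQ, hQ1⟩ := exists_le_finrank_eq (f.1 ⊓ U) (r := 1) (by omega)
    by_cases hQS : Q ∈ S
    · exact ⟨Q, hQS, Or.inl (hQ.trans inf_le_left)⟩
    have hQ2 : Q ≤ ℓ ∧ Q ≠ P₀ := by
      by_contra hcon
      push Not at hcon
      exact hQS (mem_filter.2 ⟨mem_Gr.2 hQ1, hQ.trans inf_le_right, hcon⟩)
    -- Q is a dropped point of ℓ. Since B meets U in rank at least 2, it contains a line M of U
    -- through Q, and the class that owns M takes the flag.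
    have h3 := Submodule.finrank_sup_add_finrank_inf_eq f.2 U
    have h4 := Submodule.finrank_le (f.2 ⊔ U)
    obtain ⟨M, hQM, hM, hM2⟩ := exists_between_finrank_succ
      (le_inf ((hQ.trans inf_le_left).trans f3) (hQ.trans inf_le_right)) (X := f.2 ⊓ U) (by omega)
    by_cases hMℓ : M = ℓ
    · refine ⟨P₀, mem_filter.2 ⟨mem_Gr.2 hP₀, hP₀ℓ.trans hℓU, fun _ => rfl⟩, Or.inr ?_⟩
      rw [hL0, ← hMℓ]
      exact hM.trans inf_le_left
    · have hMM : M ∈ 𝓜 := (h𝓜 M).2 ⟨by omega, hM.trans inf_le_right, hMℓ, Q, hQ1, hQ2.1,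
        hQ2.2, hQM⟩
      obtain ⟨a1, a2, a3⟩ := hφ ⟨M, hMM⟩
      refine ⟨φ ⟨M, hMM⟩, mem_filter.2 ⟨mem_Gr.2 a1, a2.trans (hM.trans inf_le_right),
        fun h => absurd h a3⟩, Or.inr ?_⟩
      rw [hLφ]
      exact hM.trans inf_le_left

end Coloring

/-! ### The size of q. -/

section Numerics

theorem cast_geom_div {q : ℕ} (hq : 2 ≤ q) (n : ℕ) :
    (((q ^ n - 1) / (q - 1) : ℕ) : ℝ) = gauss q n 1 := by
  have hq1 : (1 : ℝ) < q := by exact_mod_cast hq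
  rw [← Nat.geomSum_eq hq, gauss_one_right, ← geom_sum_eq hq1.ne']
  push_cast
  rfl

/-- The exponential hypothesis gives q ≥ 10¹²d² and the quadratic one gives q ≥ α²; their product
bounds q² below by (10⁶dα)². -/
theorem mul_inv_le_of_large {d : ℕ} (hd : 3 ≤ d) {q α : ℝ} (hα : 5 ≤ α)
    (hq₁ : (3 : ℝ) * 112 ^ (2 ^ (d + 1) - 1) * 2 ^ (-(d : ℤ) - 1) < q)
    (hq₂ : (3 / 2 : ℝ) * α ^ 2 + (21 / 2 : ℝ) * α + 17 ≤ q) :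
    d * α * q⁻¹ ≤ 1 / 10 ^ 6 := by
  have hexp : d + 12 ≤ 2 ^ (d + 1) - 1 := by
    obtain ⟨e, rfl⟩ : ∃ e, d = e + 3 := ⟨d - 3, by omega⟩
    have h1 : e < 2 ^ e := Nat.lt_two_pow_self
    have h2 : 2 ^ (e + 3 + 1) = 16 * 2 ^ e := by ring
    omega
  have hd2 : (d : ℝ) ≤ 2 ^ d := by exact_mod_cast (Nat.lt_two_pow_self).le
  have hlarge : 10 ^ 12 * (d : ℝ) ^ 2 ≤ q := by
    have h1 : (112 : ℝ) ^ (d + 12) ≤ 112 ^ (2 ^ (d + 1) - 1) :=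
      pow_le_pow_right₀ (by norm_num) hexp
    have h2 : (2 : ℝ) ^ (-(d : ℤ) - 1) * 2 ^ (d + 1) = 1 := by
      rw [← zpow_natCast, ← zpow_add₀ (by norm_num)]
      simp
    have h3 : (0 : ℝ) < 2 ^ (-(d : ℤ) - 1) := by positivity
    have h4 : 10 ^ 12 * (d : ℝ) ^ 2 * 2 ^ (d + 1) ≤ 3 * 112 ^ (2 ^ (d + 1) - 1) := by
      have h5 : (d : ℝ) ^ 2 ≤ (2 ^ d) ^ 2 := pow_le_pow_left₀ (Nat.cast_nonneg _) hd2 2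
      have h6 : ((2 : ℝ) ^ d) ^ 2 * 2 ^ (d + 1) = 2 * 8 ^ d := by
        rw [show (8 : ℝ) = 2 ^ 3 by norm_num, ← pow_mul, ← pow_mul, ← pow_add, ← pow_succ']
        congr 1
        ring
      have h7 : (8 : ℝ) ^ d ≤ 112 ^ d := pow_le_pow_left₀ (by norm_num) (by norm_num) d
      have h8 : (112 : ℝ) ^ (d + 12) = 112 ^ 12 * 112 ^ d := by rw [pow_add, mul_comm]
      have h9 : (d : ℝ) ^ 2 * 2 ^ (d + 1) ≤ (2 ^ d) ^ 2 * 2 ^ (d + 1) :=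
        mul_le_mul_of_nonneg_right h5 (by positivity)
      rw [h6] at h9
      rw [h8] at h1
      have h10 : (0 : ℝ) < 112 ^ d := by positivity
      have h11 : (10 : ℝ) ^ 12 * (2 * 112 ^ d) ≤ 112 ^ 12 * 112 ^ d := by
        rw [← mul_assoc]
        exact mul_le_mul_of_nonneg_right (by norm_num) h10.le
      linarith
    have h5 := mul_le_mul_of_nonneg_right h4 h3.le
    have e : 10 ^ 12 * (d : ℝ) ^ 2 * 2 ^ (d + 1) * 2 ^ (-(d : ℤ) - 1) =
      10 ^ 12 * (d : ℝ) ^ 2 * (2 ^ (-(d : ℤ) - 1) * 2 ^ (d + 1)) := by ring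
    rw [e, h2, mul_one] at h5
    linarith
  have hα2 : α ^ 2 ≤ q := by nlinarith
  have hd0 : (0 : ℝ) < d := by
    have : 0 < d := by omega
    exact_mod_cast this
  have hq0 : 0 < q := lt_of_lt_of_le (by positivity) hlarge
  have hsq : (10 ^ 6 * (d * α)) ^ 2 ≤ q ^ 2 := by
    calc (10 ^ 6 * (d * α)) ^ 2 = (10 ^ 12 * (d : ℝ) ^ 2) * α ^ 2 := by ring
      _ ≤ q * q := mul_le_mul hlarge hα2 (sq_nonneg _) hq0.le
      _ = q ^ 2 := (sq q).symm
  have h := abs_le_of_sq_le_sq hsq hq0.le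
  rw [← div_eq_mul_inv, div_le_iff₀ hq0]
  linarith [le_of_abs_le h]

end Numerics

/-! ### The chromatic number and the optimal covers. -/

section Chromatic

variable {K : Type u} [Field K] [Finite K] {d : ℕ}

open FlagOfType in
theorem colorable_flagGraph (hd : 1 ≤ d) {n : ℕ}
    (hn : (n : ℝ) + Nat.card K = gauss (Nat.card K) (d + 2) 1) : (flagGraph K d).Colorable n := by
  have hV : finrank K (Fin (2 * d + 1) → K) = 2 * d + 1 := finrank_fin_fun K
  obtain ⟨S, L, h1, h2, h3⟩ := exists_classes hd hV
  have h4 : #S = n := by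
    have : (#S : ℝ) = n := by linarith
    exact_mod_cast this
  choose φ hφ1 hφ2 using fun f : FlagOfType K (2 * d + 1) {d, d + 1} => h3 _ f.pair_mem_flags
  let C : (flagGraph K d).Coloring S := SimpleGraph.Coloring.mk (fun f => ⟨φ f, hφ1 f⟩) (by
    intro f g hadj heq
    have heq' : φ f = φ g := congrArg Subtype.val heq
    obtain ⟨a1, a2, a3⟩ := h2 _ (hφ1 f)
    refine not_oppositeFlags a1 a2 a3 f.pair_mem_flags g.pair_mem_flags (hφ2 f) ?_
      ((adj_iff hd f g).1 hadj)
    rw [heq']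
    exact hφ2 g)
  have h5 := C.colorable
  rwa [Fintype.card_coe, h4] at h5

/-- Colour classes extend to maximal independent sets. Different classes may have the same
extension, hence only an upper bound for the number of sets. -/
theorem exists_maximal_cover {X : Type u} [Finite X] {G : SimpleGraph X} {m : ℕ}
    (h : G.Colorable m) : ∃ 𝓕 : Set (Set X), (∀ C ∈ 𝓕, IsMaxlIndepSet G C) ∧ 𝓕.ncard ≤ m ∧
      ⋃₀ 𝓕 = Set.univ := by
  obtain ⟨C⟩ := h
  have hext : ∀ i, ∃ I, C.colorClass i ⊆ I ∧ IsMaxlIndepSet G I := by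
    intro i
    obtain ⟨I, h1, h2⟩ := (Set.toFinite {I : Set X | G.IsIndepSet I}).exists_le_maximal
      (C.isIndepSet_colorClass i)
    exact ⟨I, h1, h2⟩
  choose I hI1 hI2 using hext
  refine ⟨Set.range I, ?_, ?_, ?_⟩
  · rintro _ ⟨i, rfl⟩
    exact hI2 i
  · have h1 := Set.ncard_image_le (f := I) (Set.toFinite (Set.univ : Set (Fin m)))
    rwa [Set.image_univ, Set.ncard_univ, Nat.card_eq_fintype_card, Fintype.card_fin] at h1
  · rw [Set.eq_univ_iff_forall]
    intro x
    exact ⟨I (C x), ⟨C x, rfl⟩, hI1 _ (C.mem_colorClass x)⟩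

end Chromatic

theorem theorem1 (d : ℕ) (hd : 3 ≤ d) (ρ : ℤ) (hρ : LargeIndepSetConjecture.{u} d ρ)
    (K : Type u) [Field K] [Finite K] (q : ℕ) (hq : q = Nat.card K)
    (hq₁ : (3 : ℝ) * 112 ^ (2 ^ (d + 1) - 1) * 2 ^ (-(d : ℤ) - 1) < (q : ℝ))
    (α : ℤ) (hα : α = max 5 ρ)
    (hq₂ : (3 / 2 : ℝ) * (α : ℝ) ^ 2 + (21 / 2 : ℝ) * (α : ℝ) + 17 ≤ (q : ℝ)) :
    (flagGraph K d).chromaticNumber = (((q ^ (d + 2) - 1) / (q - 1) - q : ℕ) : ℕ∞) ∧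
    ∀ 𝓕 : Set (Set (FlagOfType K (2 * d + 1) {d, d + 1})),
      (∀ C ∈ 𝓕, IsMaxlIndepSet (flagGraph K d) C) →
      𝓕.ncard = (q ^ (d + 2) - 1) / (q - 1) - q →
      ⋃₀ 𝓕 = Set.univ →
      (∃ U : Submodule K (Fin (2 * d + 1) → K), Module.finrank K U = d + 2 ∧
        ∃ μ : Set (FlagOfType K (2 * d + 1) {d, d + 1}) → Submodule K (Fin (2 * d + 1) → K),
          Set.InjOn μ 𝓕 ∧
          ∀ C ∈ 𝓕, Module.finrank K (μ C) = 1 ∧ μ C ≤ U ∧ pencil d (μ C) ⊆ C) ∨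
      (∃ U : Submodule K (Fin (2 * d + 1) → K), Module.finrank K U = d - 1 ∧
        ∃ μ : Set (FlagOfType K (2 * d + 1) {d, d + 1}) → Submodule K (Fin (2 * d + 1) → K),
          Set.InjOn μ 𝓕 ∧
          ∀ C ∈ 𝓕, Module.finrank K (μ C) = 2 * d ∧ U ≤ μ C ∧ dualPencil d (μ C) ⊆ C) := by
  have hα5 : (5 : ℝ) ≤ α := by
    have : 5 ≤ α := by rw [hα]; exact le_max_left _ _
    exact_mod_cast this
  have hρα : (ρ : ℝ) ≤ α := by
    have : ρ ≤ α := by rw [hα]; exact le_max_right _ _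
    exact_mod_cast this
  have hsmall := mul_inv_le_of_large hd hα5 hq₁ hq₂
  have hq2 : 2 ≤ q := by
    have := one_lt_natCard (K := K)
    omega
  -- The summand q of the geometric sum shows that the natural subtraction in the statement is not
  -- truncated.
  have hqN : q ≤ (q ^ (d + 2) - 1) / (q - 1) := by
    rw [← Nat.geomSum_eq hq2]
    calc q = q ^ 1 := (pow_one q).symm
      _ ≤ _ := single_le_sum (f := fun k => q ^ k) (fun _ _ => Nat.zero_le _)
        (mem_range.2 (by omega))
  obtain ⟨n, hn⟩ : ∃ n, n = (q ^ (d + 2) - 1) / (q - 1) - q := ⟨_, rfl⟩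
  have hcast : (n : ℝ) + q = gauss q (d + 2) 1 := by
    rw [← cast_geom_div hq2, hn, Nat.cast_sub hqN]
    ring
  rw [← hn]
  rw [hq] at hcast hsmall
  have hstr := fun 𝓕 hmax hcard hcover => structure_of_maximal_cover (K := K) hd hρ hα5 hρα hsmall
    (𝓕 := 𝓕) hmax hcard hcover
  refine ⟨?_, fun 𝓕 hmax hcard hcover => (hstr 𝓕 hmax (by rw [hcard, hcast]) hcover).2⟩
  apply le_antisymm
  · exact (colorable_flagGraph (by omega) hcast).chromaticNumber_le
  · rw [SimpleGraph.le_chromaticNumber_iff_colorable]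
    intro m hm
    obtain ⟨𝓕, hmax, hcard, hcover⟩ := exists_maximal_cover hm
    -- A colouring with fewer colours gives a maximal cover with fewer than N - q members, against
    -- the equality in `structure_of_maximal_cover`.
    by_contra hcon
    have h1 : (𝓕.ncard : ℝ) < n := by exact_mod_cast lt_of_le_of_lt hcard (not_le.1 hcon)
    have h2 := (hstr 𝓕 hmax (by linarith) hcover).1
    linarith
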